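/- Let $\Omega\subset\mathbb R^n$ be a bounded open set, $\mathsf d=\operatorname{diam}\Omega$, and let $|A|$ denote Lebesgue measure. For $1\le q<\infty$ and $0\le\mu<1$ put $$\|f\|_{L^{q,\mu}(\Omega)}=\sup_{x\in\Omega,\ 0<r\le \mathsf d}\Big(\frac1{|B(x,r)|^{\mu}}\int_{B(x,r)\cap\Omega}|f(y)|^q\,dy\Big)^{1/q}.$$ For $1<p<\infty$, $\theta>0$, $\alpha\ge 0$ and $0\le\lambda<1$, the grand grand Morrey space $L^{p),\lambda)}_{\theta,\alpha}(\Omega)$ consists of the measurable real functions $f$ on $\Omega$ with $$\|f\|_{L^{p),\lambda)}_{\theta,\alpha}(\Omega)}=\sup_{0<\varepsilon<\min\{p-1,\lambda/\alpha\}}\varepsilon^{\frac{\theta}{p-\varepsilon}}\,\|f\|_{L^{p-\varepsilon,\lambda-\alpha\varepsilon}(\Omega)}<\infty,$$ where $\lambda/\alpha:=\infty$ if $\alpha=0$. Let $K:\Omega\times\Omega\setminus\{(x,x):x\in\Omega\}\to\mathbb R$ be a kernel such that, for some constant $C>0$, $$|K(x,y)|\le\frac{C}{|x-y|^n}\qquad(x,y\in\Omega,\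 x\ne y),$$ $$|K(x_1,y)-K(x_2,y)|+|K(y,x_1)-K(y,x_2)|\le C\,w\Big(\frac{|x_2-x_1|}{|x_2-y|}\Big)\frac1{|x_2-y|^n}$$ for all $x_1,x_2,y\in\Omega$ that are pairwise distinct and satisfy $|x_2-y|>C|x_1-x_2|$, where $w$ is a positive non-decreasing function on $(0,\infty)$ with $w(2t)\le c\,w(t)$ for all $t>0$ and some constant $c$, and $\int_0^1 w(t)\,\frac{dt}{t}<\infty$. Let $$Tf(x)=\mathrm{p.v.}\int_\Omega K(x,y)f(y)\,dy=\lim_{\delta\to0^+}\int_{\{y\in\Omega:\,|x-y|>\delta\}}K(x,y)f(y)\,dy,$$ and assume that for every $f\in L^2(\Omega)$ this limit exists for almost every $x\in\Omega$, and that $T$ is bounded on $L^2(\Omega)$. **Theorem.** Let $1<p<\infty$, $\theta>0$, $\alpha\ge0$ and $0<\lambda<1$. Then $T$ is bounded on $L^{p),\lambda)}_{\theta,\alpha}(\Omega)$: for every $f\in L^{p),\lambda)}_{\theta,\alpha}(\Omega)$ the principal value $Tf(x)$ exists for almost every $x\in\Omega$, $Tf\in L^{p),\lambda)}_{\theta,\alpha}(\Omega)$,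 and $$\|Tf\|_{L^{p),\lambda)}_{\theta,\alpha}(\Omega)}\le A\,\|f\|_{L^{p),\lambda)}_{\theta,\alpha}(\Omega)}$$ with a constant $A<\infty$ that does not depend on $f$. -/

import Mathlib

open MeasureTheory Filter Topology Set
open scoped NNReal ENNReal

noncomputable section

/-- The Morrey norm `sup_{x ∈ Ω, 0 < r ≤ diam Ω} (|B(x,r)|^(-λ) ∫_{B(x,r) ∩ Ω} |f|^p)^(1/p)`,
with values in `[0, ∞]`. -/
def morreyNorm {n : ℕ} (Ω : Set (EuclideanSpace ℝ (Fin n))) (p lam : ℝ)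
    (f : EuclideanSpace ℝ (Fin n) → ℝ) : ℝ≥0∞ :=
  ⨆ x ∈ Ω, ⨆ r ∈ Ioc (0 : ℝ) (Metric.diam Ω),
    ((∫⁻ y in Metric.ball x r ∩ Ω, ‖f y‖ₑ ^ p) / volume (Metric.ball x r) ^ lam) ^ (1 / p)

/-- The endpoint `min {p - 1, λ / α}`, with the convention `λ / 0 = ∞` (even for `λ = 0`). -/
def grandEndpoint (p lam α : ℝ) : ℝ :=
  if α = 0 then p - 1 else min (p - 1) (lam / α)

/-- The grand grand Morrey norm
`sup_{0 < ε < min {p - 1, λ / α}} ε^(θ / (p - ε)) ‖f‖_{L^{p - ε, λ - α ε}(Ω)}`,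
with values in `[0, ∞]`. -/
def grandGrandMorreyNorm {n : ℕ} (Ω : Set (EuclideanSpace ℝ (Fin n))) (p lam θ α : ℝ)
    (f : EuclideanSpace ℝ (Fin n) → ℝ) : ℝ≥0∞ :=
  ⨆ ε ∈ Ioo (0 : ℝ) (grandEndpoint p lam α),
    ENNReal.ofReal (ε ^ (θ / (p - ε))) * morreyNorm Ω (p - ε) (lam - α * ε) f

/-- Membership in the grand grand Morrey space: the functions that are (Lebesgue) measurable
on `Ω` and have finite norm. Only the values of `f` on `Ω` matter. -/
def MemGrandGrandMorrey {n : ℕ} (Ω : Set (EuclideanSpace ℝ (Fin n))) (p lam θ α : ℝ)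
    (f : EuclideanSpace ℝ (Fin n) → ℝ) : Prop :=
  AEStronglyMeasurable f (volume.restrict Ω) ∧ grandGrandMorreyNorm Ω p lam θ α f < ∞

/-- `w` is positive and non-decreasing on `(0, ∞)`, doubling, and satisfies the Dini condition
`∫_0^1 w(t) / t dt < ∞`. -/
structure IsDiniModulus (w : ℝ → ℝ) : Prop where
  pos : ∀ t, 0 < t → 0 < w t
  monotoneOn : MonotoneOn w (Ioi 0)
  doubling : ∃ c : ℝ, ∀ t, 0 < t → w (2 * t) ≤ c * w t
  dini : IntegrableOn (fun t => w t / t) (Ioo 0 1)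

/-- Calderón–Zygmund kernels on `Ω`: the size condition and the Dini smoothness condition in both
variables. Only the values of `K x y` with `x, y ∈ Ω`, `x ≠ y` matter. -/
def IsCalderonZygmundKernel {n : ℕ} (Ω : Set (EuclideanSpace ℝ (Fin n)))
    (K : EuclideanSpace ℝ (Fin n) → EuclideanSpace ℝ (Fin n) → ℝ) : Prop :=
  ∃ (C : ℝ) (w : ℝ → ℝ), 0 < C ∧ IsDiniModulus w ∧
    (∀ x ∈ Ω, ∀ y ∈ Ω, x ≠ y → |K x y| ≤ C / ‖x - y‖ ^ n) ∧
    (∀ x₁ ∈ Ω, ∀ x₂ ∈ Ω, ∀ y ∈ Ω, x₁ ≠ x₂ → x₁ ≠ y → x₂ ≠ y → C * ‖x₁ - x₂‖ < ‖x₂ - y‖ →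
      |K x₁ y - K x₂ y| + |K y x₁ - K y x₂| ≤
        C * w (‖x₂ - x₁‖ / ‖x₂ - y‖) * (1 / ‖x₂ - y‖ ^ n))

/-- The truncated integral `∫_{y ∈ Ω, |x - y| > δ} K(x, y) f(y) dy`. -/
def truncatedIntegral {n : ℕ} (Ω : Set (EuclideanSpace ℝ (Fin n)))
    (K : EuclideanSpace ℝ (Fin n) → EuclideanSpace ℝ (Fin n) → ℝ)
    (f : EuclideanSpace ℝ (Fin n) → ℝ) (x : EuclideanSpace ℝ (Fin n)) (δ : ℝ) : ℝ :=
  ∫ y in {y | y ∈ Ω ∧ δ < ‖x - y‖}, K x y * f y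

/-- The principal value defining `Tf(x)` exists (as a finite limit). -/
def PVExistsAt {n : ℕ} (Ω : Set (EuclideanSpace ℝ (Fin n)))
    (K : EuclideanSpace ℝ (Fin n) → EuclideanSpace ℝ (Fin n) → ℝ)
    (f : EuclideanSpace ℝ (Fin n) → ℝ) (x : EuclideanSpace ℝ (Fin n)) : Prop :=
  ∃ l : ℝ, Tendsto (truncatedIntegral Ω K f x) (𝓝[>] 0) (𝓝 l)

/-- `Tf(x) = p.v. ∫_Ω K(x, y) f(y) dy`; meaningful where the principal value exists. -/
def pvOperator {n : ℕ} (Ω : Set (EuclideanSpace ℝ (Fin n)))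
    (K : EuclideanSpace ℝ (Fin n) → EuclideanSpace ℝ (Fin n) → ℝ)
    (f : EuclideanSpace ℝ (Fin n) → ℝ) (x : EuclideanSpace ℝ (Fin n)) : ℝ :=
  limUnder (𝓝[>] (0 : ℝ)) (truncatedIntegral Ω K f x)

/-- The principal value operator with kernel `K` is a Calderón–Zygmund operator on `Ω`: `K` is a
Calderón–Zygmund kernel, `Tf` exists almost everywhere on `Ω` for all `f ∈ L²(Ω)`, and `T` is
bounded on `L²(Ω)`. -/
structure IsCalderonZygmundOperator {n : ℕ} (Ω : Set (EuclideanSpace ℝ (Fin n)))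
    (K : EuclideanSpace ℝ (Fin n) → EuclideanSpace ℝ (Fin n) → ℝ) : Prop where
  kernel : IsCalderonZygmundKernel Ω K
  pv_exists : ∀ f : EuclideanSpace ℝ (Fin n) → ℝ, MemLp f 2 (volume.restrict Ω) →
    ∀ᵐ x ∂(volume.restrict Ω), PVExistsAt Ω K f x
  bounded_L2 : ∃ A : ℝ≥0, ∀ f : EuclideanSpace ℝ (Fin n) → ℝ, MemLp f 2 (volume.restrict Ω) →
    eLpNorm (pvOperator Ω K f) 2 (volume.restrict Ω) ≤ A * eLpNorm f 2 (volume.restrict Ω)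

end

/-!
The argument has four layers.

**Boundedness on `L ^ q (Ω)` for `1 < q < ∞`.** Only `L ^ 2` bounds are given, on an arbitrary open
set, where Lebesgue measure restricted to `Ω` need not be doubling. Balls are therefore handled as in
the theory of non-doubling measures. The maximal function `enlMax` divides the integral over a ball
by the measure of the ball with five times the radius, and is of weak type `(1, 1)` by the Vitali
covering lemma. From a radius that is not doubling one moves through a chain of scales
(`SteepScales`) to the nearest doubling radius; along the chain the measure of balls changes so fast
that the size bound `C / |x - y| ^ n` sums geometrically (`SteepScales.lintegral_le`). The Dini
condition gives Hörmander's condition (`KernelBounds.exists_hormander`). Together these yield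
Cotlar's inequality (`KernelBounds.exists_cotlar`), hence the weak type `(s, s)` of the maximal
truncated operator from a bound on `L ^ s`, and a good-`λ` inequality
(`KernelBounds.exists_good_lambda`), which improves the bound on `L ^ s` to one on `L ^ q` for all
`q > s`. As this only raises the exponent, it is used twice: for `K` from `L ^ 2`, and, after
passing to duals, for the transposed kernel from an exponent near `1`; dualizing again covers all
exponents (`IsCalderonZygmundOperator.exists_truncBounded`).

**Principal values.** Bounded functions are in `L ^ 2` and dense in `L ^ s`, so the weak type bound
for the maximal truncated operator gives principal values almost everywhere for `f ∈ L ^ s (Ω)`,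
`s > 1` (`IsCalderonZygmundOperator.ae_pvExistsAt`), and Fatou's lemma transfers the `L ^ q` bounds.

**Morrey spaces.** On a ball `B(x, r)` the part of `f` in the double ball is handled by the `L ^ q`
bound, and the rest by the size of the kernel, summed over dyadic annuli; the sum is geometric since
`μ < 1`. The constant is uniform for `q` in compact subsets of `(1, ∞)` and `μ` in compact subsets of
`[0, 1)` (`IsCalderonZygmundOperator.exists_morreyNorm_pvOperator_le`).

**Grand grand Morrey spaces.** That constant may blow up as `p - ε` tends to `1`, but by Hölder's
inequality only the parameters `ε` in some interval `(0, σ]` matter for the norm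
(`exists_grandGrandMorreyNorm_le_mul_iSup`), and for these the constant is uniform.
-/

/-! ### Layer-cake formulas and the integrated good-`λ` inequality -/

theorem lintegral_rpow_eq_lintegral_meas_ofReal_lt {X : Type*} [MeasurableSpace X] (μ : Measure X)
    {F : X → ℝ≥0∞} (hF : AEMeasurable F μ) (hfin : ∀ᵐ x ∂μ, F x < ∞) {q : ℝ} (hq : 0 < q) :
    ∫⁻ x, F x ^ q ∂μ = ENNReal.ofReal q *
      ∫⁻ t in Ioi (0 : ℝ), μ {x | ENNReal.ofReal t < F x} * ENNReal.ofReal (t ^ (q - 1)) := by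
  have h := lintegral_rpow_eq_lintegral_meas_lt_mul μ (f := fun x => (F x).toReal)
    (Eventually.of_forall fun x => ENNReal.toReal_nonneg) hF.ennreal_toReal hq
  have h1 : ∫⁻ x, F x ^ q ∂μ = ∫⁻ x, ENNReal.ofReal ((F x).toReal ^ q) ∂μ := by
    refine lintegral_congr_ae ?_
    filter_upwards [hfin] with x hx
    rw [← ENNReal.ofReal_rpow_of_nonneg ENNReal.toReal_nonneg hq.le, ENNReal.ofReal_toReal hx.ne]
  rw [h1, h]
  congr 1
  refine setLIntegral_congr_fun measurableSet_Ioi fun t ht => ?_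
  congr 1
  refine measure_congr ?_
  filter_upwards [hfin] with x hx
  exact propext (ENNReal.ofReal_lt_iff_lt_toReal (le_of_lt ht) hx.ne).symm

/-- The relative distributional inequality `μ {H t < F} ≤ κ μ {t < F} + μ {γ t < G}`, integrated
against `t ^ (q - 1) dt`; the first term on the right is absorbed because `κ H ^ q < 1`. -/
theorem lintegral_rpow_le_of_good_lambda {X : Type*} [MeasurableSpace X] (μ : Measure X)
    {F G : X → ℝ≥0∞} (hF : AEMeasurable F μ) (hG : AEMeasurable G μ)
    (hFfin : ∀ᵐ x ∂μ, F x < ∞) {q H κ γ ρ : ℝ} (hq : 0 < q) (hH : 0 < H)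
    (hγ : 0 < γ) (hρ : 0 ≤ ρ) (hρ1 : ρ < 1) (hκH : κ * H ^ q ≤ ρ)
    (hint : ∫⁻ x, F x ^ q ∂μ < ∞)
    (hgood : ∀ t : ℝ, 0 < t → μ {x | ENNReal.ofReal (H * t) < F x} ≤
      ENNReal.ofReal κ * μ {x | ENNReal.ofReal t < F x} + μ {x | ENNReal.ofReal (γ * t) < G x}) :
    ∫⁻ x, F x ^ q ∂μ ≤ ENNReal.ofReal (H ^ q / (1 - ρ) / γ ^ q) * ∫⁻ x, G x ^ q ∂μ := by
  have h1ρ : 0 < 1 - ρ := by linarith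
  have hHq : 0 < H ^ q := Real.rpow_pos_of_pos hH q
  have hγq : 0 < γ ^ q := Real.rpow_pos_of_pos hγ q
  by_cases hGi : ∫⁻ x, G x ^ q ∂μ = ∞
  · rw [hGi, ENNReal.mul_top]
    · exact le_top
    · simp only [ne_eq, ENNReal.ofReal_eq_zero, not_le]; positivity
  have hGfin : ∀ᵐ x ∂μ, G x < ∞ := by
    filter_upwards [ae_lt_top' (hG.pow_const q) hGi] with x hx
    by_contra hcon
    rw [not_lt, top_le_iff] at hcon
    rw [hcon, ENNReal.top_rpow_of_pos hq] at hx
    exact lt_irrefl _ hx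
  -- a scaled layer cake: `∫ F ^ q` through the level sets `{c t < F}`
  have scaled : ∀ (F : X → ℝ≥0∞) (c : ℝ), 0 < c → AEMeasurable F μ → (∀ᵐ x ∂μ, F x < ∞) →
      ∫⁻ x, F x ^ q ∂μ = ENNReal.ofReal (c ^ q) * (ENNReal.ofReal q *
      ∫⁻ t in Ioi (0 : ℝ), μ {x | ENNReal.ofReal (c * t) < F x} *
        ENNReal.ofReal (t ^ (q - 1))) := by
    intro F c hc hF hfin
    have hc0 : ENNReal.ofReal c ≠ 0 := by simpa using hc
    have := lintegral_rpow_eq_lintegral_meas_ofReal_lt μ (F := fun x => F x / ENNReal.ofReal c)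
      (hF.div_const _) (by
        filter_upwards [hfin] with x hx
        exact ENNReal.div_lt_top hx.ne hc0) hq
    have e2 : ∀ t : ℝ, {x | ENNReal.ofReal t < F x / ENNReal.ofReal c} =
        {x | ENNReal.ofReal (c * t) < F x} := by
      intro t
      ext x
      simp only [mem_ofPred_eq]
      rw [ENNReal.lt_div_iff_mul_lt (Or.inl hc0) (Or.inl ENNReal.ofReal_ne_top),
        mul_comm c t, ENNReal.ofReal_mul' hc.le]
    simp only [e2] at this
    rw [← this, ← ENNReal.ofReal_rpow_of_pos hc, ← lintegral_const_mul' _ _ (by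
      exact ENNReal.rpow_ne_top_of_nonneg hq.le ENNReal.ofReal_ne_top)]
    refine lintegral_congr fun x => ?_
    rw [ENNReal.div_rpow_of_nonneg _ _ hq.le, ENNReal.mul_div_cancel]
    · exact (ENNReal.rpow_pos (pos_iff_ne_zero.2 hc0) ENNReal.ofReal_ne_top).ne'
    · exact ENNReal.rpow_ne_top_of_nonneg hq.le ENNReal.ofReal_ne_top
  set I := ∫⁻ x, F x ^ q ∂μ with hI
  set J := ∫⁻ x, G x ^ q ∂μ with hJ
  have hmono : ENNReal.ofReal q *
      ∫⁻ t in Ioi (0 : ℝ), μ {x | ENNReal.ofReal (H * t) < F x} * ENNReal.ofReal (t ^ (q - 1)) ≤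
      ENNReal.ofReal κ * I + ENNReal.ofReal ((γ ^ q)⁻¹) * J := by
    have a1 := scaled F 1 one_pos hF hFfin
    have a2 := scaled G γ hγ hG hGfin
    simp only [Real.one_rpow, ENNReal.ofReal_one, one_mul] at a1
    rw [hI, hJ, a1, a2, ← mul_assoc (ENNReal.ofReal ((γ ^ q)⁻¹)),
      ← ENNReal.ofReal_mul (by positivity), inv_mul_cancel₀ hγq.ne', ENNReal.ofReal_one, one_mul,
      mul_left_comm, ← mul_add]
    gcongr
    rw [← lintegral_const_mul' _ _ ENNReal.ofReal_ne_top, ← lintegral_add_left']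
    · refine setLIntegral_mono' measurableSet_Ioi fun t ht => ?_
      rw [← mul_assoc, ← add_mul]
      gcongr
      exact hgood t ht
    · have : Antitone fun t : ℝ => μ {x | ENNReal.ofReal t < F x} := fun s t hst =>
        measure_mono fun x hx => lt_of_le_of_lt (ENNReal.ofReal_le_ofReal hst) hx
      exact (((this.measurable).mul (by fun_prop)).const_mul _).aemeasurable
  have hmain : I ≤ ENNReal.ofReal ρ * I + ENNReal.ofReal (H ^ q / γ ^ q) * J := by
    calc I ≤ ENNReal.ofReal (H ^ q) * (ENNReal.ofReal κ * I + ENNReal.ofReal ((γ ^ q)⁻¹) * J) := by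
          conv_lhs => rw [hI, scaled F H hH hF hFfin]
          gcongr
      _ = ENNReal.ofReal (κ * H ^ q) * I + ENNReal.ofReal (H ^ q / γ ^ q) * J := by
          rw [mul_add, ← mul_assoc, ← mul_assoc, ← ENNReal.ofReal_mul hHq.le,
            ← ENNReal.ofReal_mul hHq.le, mul_comm κ, div_eq_mul_inv]
      _ ≤ _ := by gcongr
  have hsub : ENNReal.ofReal (1 - ρ) * I ≤ ENNReal.ofReal (H ^ q / γ ^ q) * J := by
    rw [ENNReal.ofReal_sub _ hρ, ENNReal.ofReal_one, ENNReal.sub_mul (fun _ _ => hint.ne), one_mul]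
    exact tsub_le_iff_left.2 hmain
  have : I = ENNReal.ofReal ((1 - ρ)⁻¹) * (ENNReal.ofReal (1 - ρ) * I) := by
    rw [← mul_assoc, ← ENNReal.ofReal_mul (by positivity), inv_mul_cancel₀ h1ρ.ne',
      ENNReal.ofReal_one, one_mul]
  rw [this]
  calc _ ≤ ENNReal.ofReal ((1 - ρ)⁻¹) * (ENNReal.ofReal (H ^ q / γ ^ q) * J) := by gcongr
    _ = _ := by
      rw [← mul_assoc, ← ENNReal.ofReal_mul (by positivity)]
      congr 2
      field_simp

/-! ### A maximal function for measures without the doubling property -/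

/-- The non-centred maximal function in which the integral over a ball is divided by the measure of
the ball with five times the radius. This normalisation makes the Vitali covering lemma give a
weak type `(1, 1)` bound for every measure. Balls `B` with `μ (5 B) = 0` contribute `0 / 0 = 0`. -/
noncomputable def enlMax {X : Type*} [PseudoMetricSpace X] [MeasurableSpace X] (μ : Measure X)
    (g : X → ℝ≥0∞) (x : X) : ℝ≥0∞ :=
  ⨆ (z : X) (r : ℝ) (_ : x ∈ Metric.ball z r),
    (∫⁻ y in Metric.ball z r, g y ∂μ) / μ (Metric.ball z (5 * r))

section Maximal

variable {X : Type*} [MetricSpace X] [MeasurableSpace X] {μ : Measure X}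

theorem lintegral_ball_le_enlMax [IsFiniteMeasure μ] (g : X → ℝ≥0∞) {x z : X} {r : ℝ}
    (hx : x ∈ Metric.ball z r) :
    ∫⁻ y in Metric.ball z r, g y ∂μ ≤ enlMax μ g x * μ (Metric.ball z (5 * r)) := by
  have hr : 0 < r := Metric.pos_of_mem_ball hx
  by_cases h0 : μ (Metric.ball z (5 * r)) = 0
  · have : μ (Metric.ball z r) = 0 :=
      measure_mono_null (Metric.ball_subset_ball (by linarith)) h0
    rw [setLIntegral_measure_zero _ _ this]
    exact zero_le
  · rw [← ENNReal.div_le_iff h0 (measure_ne_top _ _)]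
    exact le_iSup_of_le z (le_iSup_of_le r (le_iSup_of_le hx le_rfl))

theorem enlMax_le_iff {g : X → ℝ≥0∞} {x : X} {t : ℝ≥0∞} :
    enlMax μ g x ≤ t ↔ ∀ z r, x ∈ Metric.ball z r →
      (∫⁻ y in Metric.ball z r, g y ∂μ) / μ (Metric.ball z (5 * r)) ≤ t := by
  simp [enlMax, iSup_le_iff]

theorem setOf_lt_enlMax_eq (g : X → ℝ≥0∞) (t : ℝ≥0∞) :
    {x | t < enlMax μ g x} = ⋃ N : ℕ, ⋃ b ∈ {b : X × ℝ | b.2 ≤ N ∧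
      t < (∫⁻ y in Metric.ball b.1 b.2, g y ∂μ) / μ (Metric.ball b.1 (5 * b.2))},
      Metric.ball b.1 b.2 := by
  ext x
  simp only [enlMax, mem_ofPred_eq, lt_iSup_iff, mem_iUnion, exists_prop, Prod.exists]
  constructor
  · rintro ⟨z, r, hx, h⟩
    obtain ⟨N, hN⟩ := exists_nat_ge r
    exact ⟨N, z, r, ⟨hN, h⟩, hx⟩
  · rintro ⟨N, z, r, ⟨hN, h⟩, hx⟩
    exact ⟨z, r, hx, h⟩

theorem isOpen_setOf_lt_enlMax (g : X → ℝ≥0∞) (t : ℝ≥0∞) : IsOpen {x | t < enlMax μ g x} := by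
  rw [setOf_lt_enlMax_eq]
  exact isOpen_iUnion fun N => isOpen_biUnion fun b _ => Metric.isOpen_ball

theorem measurable_enlMax [OpensMeasurableSpace X] (g : X → ℝ≥0∞) : Measurable (enlMax μ g) :=
  measurable_of_Ioi fun t => (isOpen_setOf_lt_enlMax g t).measurableSet

theorem enlMax_congr_ae {g h : X → ℝ≥0∞} (hgh : g =ᵐ[μ] h) : enlMax μ g = enlMax μ h := by
  funext x
  have : ∀ s : Set X, ∫⁻ y in s, g y ∂μ = ∫⁻ y in s, h y ∂μ := fun s =>
    lintegral_congr_ae (ae_restrict_of_ae hgh)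
  simp only [enlMax, this]

/-- Weak type `(1, 1)`, by the Vitali covering lemma. -/
theorem mul_measure_lt_enlMax_le [OpensMeasurableSpace X] [TopologicalSpace.SeparableSpace X]
    [IsFiniteMeasure μ] (g : X → ℝ≥0∞) (t : ℝ≥0∞) :
    t * μ {x | t < enlMax μ g x} ≤ ∫⁻ x, g x ∂μ := by
  rw [setOf_lt_enlMax_eq]
  set I : ℕ → Set (X × ℝ) := fun N => {b : X × ℝ | b.2 ≤ N ∧
      t < (∫⁻ y in Metric.ball b.1 b.2, g y ∂μ) / μ (Metric.ball b.1 (5 * b.2))} with hI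
  have hmono : Monotone fun N : ℕ => ⋃ b ∈ I N, Metric.ball b.1 b.2 := by
    intro N N' hN
    refine biUnion_subset_biUnion_left fun b hb => ⟨hb.1.trans (by exact_mod_cast hN), hb.2⟩
  rw [hmono.measure_iUnion, ENNReal.mul_iSup]
  refine iSup_le fun N => ?_
  -- balls of non-positive radius are empty, hence do not enter the family `I N`
  have hpos : ∀ b ∈ I N, 0 < b.2 := by
    intro b hb
    by_contra hcon
    have : Metric.ball b.1 b.2 = ∅ := Metric.ball_eq_empty.2 (not_lt.1 hcon)
    have h2 := hb.2
    simp [this] at h2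
  have hball : ∀ b ∈ I N, t * μ (Metric.ball b.1 (5 * b.2)) ≤
      ∫⁻ y in Metric.ball b.1 b.2, g y ∂μ := fun b hb => by
    have h2 := hb.2
    by_cases h0 : μ (Metric.ball b.1 (5 * b.2)) = 0
    · simp [h0]
    · exact ((ENNReal.lt_div_iff_mul_lt (Or.inl h0) (Or.inl (measure_ne_top _ _))).1 h2).le
  obtain ⟨u, huI, hdisj, hcov⟩ := Vitali.exists_disjoint_subfamily_covering_enlargement_closedBall
    (I N) Prod.fst Prod.snd N (fun b hb => hb.1) 4 (by norm_num)
  have hcount : u.Countable := by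
    refine hdisj.countable_of_nonempty_interior fun b hb => ?_
    exact ⟨b.1, interior_mono Metric.ball_subset_closedBall
      (by rw [Metric.isOpen_ball.interior_eq]; exact Metric.mem_ball_self (hpos b (huI hb)))⟩
  have hsub : (⋃ b ∈ I N, Metric.ball b.1 b.2) ⊆ ⋃ b ∈ u, Metric.ball b.1 (5 * b.2) := by
    refine iUnion₂_subset fun b hb => ?_
    obtain ⟨c, hc, hbc⟩ := hcov b hb
    refine Metric.ball_subset_closedBall.trans (hbc.trans ?_)
    refine (Metric.closedBall_subset_ball ?_).trans
      (subset_biUnion_of_mem (u := fun b : X × ℝ => Metric.ball b.1 (5 * b.2)) hc)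
    have := hpos c (huI hc)
    linarith
  calc t * μ (⋃ b ∈ I N, Metric.ball b.1 b.2)
      ≤ t * ∑' b : u, μ (Metric.ball b.1.1 (5 * b.1.2)) := by
        gcongr
        exact (measure_mono hsub).trans (measure_biUnion_le μ hcount _)
    _ = ∑' b : u, t * μ (Metric.ball b.1.1 (5 * b.1.2)) := ENNReal.tsum_mul_left.symm
    _ ≤ ∑' b : u, ∫⁻ y in Metric.closedBall b.1.1 b.1.2, g y ∂μ := by
        refine ENNReal.tsum_le_tsum fun b => (hball b.1 (huI b.2)).trans ?_
        exact lintegral_mono_set Metric.ball_subset_closedBall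
    _ = ∫⁻ y in ⋃ b ∈ u, Metric.closedBall b.1 b.2, g y ∂μ := by
        rw [lintegral_biUnion hcount (fun b _ => Metric.isClosed_closedBall.measurableSet) hdisj]
    _ ≤ ∫⁻ y, g y ∂μ := setLIntegral_le_lintegral _ _

theorem measure_lt_enlMax_le_indicator [OpensMeasurableSpace X] [TopologicalSpace.SeparableSpace X]
    [IsFiniteMeasure μ] {g : X → ℝ≥0∞} (hg : Measurable g) {t : ℝ} (ht : 0 < t) :
    μ {x | ENNReal.ofReal t < enlMax μ g x} ≤
      ENNReal.ofReal (2 / t) * μ.withDensity g {x | ENNReal.ofReal t < 2 * g x} := by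
  set A : Set X := {x | ENNReal.ofReal t < 2 * g x} with hA
  have hAm : MeasurableSet A := measurableSet_lt measurable_const (hg.const_mul 2)
  set τ : ℝ≥0∞ := ENNReal.ofReal (t / 2) with hτ
  have htt : ENNReal.ofReal t = τ + τ := by
    rw [hτ, ← ENNReal.ofReal_add (by positivity) (by positivity)]; congr 1; ring
  have hgle : ∀ y, g y ≤ A.indicator g y + τ := by
    intro y
    by_cases hy : y ∈ A
    · simp [hy]
    · have : 2 * g y ≤ 2 * τ := by
        rw [two_mul τ, ← htt]; exact not_lt.1 hy
      simpa [hy] using (ENNReal.mul_le_mul_iff_right (by norm_num) (by norm_num)).1 this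
  have hmax : ∀ x, enlMax μ g x ≤ enlMax μ (A.indicator g) x + τ := by
    intro x
    rw [enlMax_le_iff]
    intro z r hx
    refine ENNReal.div_le_of_le_mul ?_
    calc ∫⁻ y in Metric.ball z r, g y ∂μ
        ≤ ∫⁻ y in Metric.ball z r, (A.indicator g y + τ) ∂μ := lintegral_mono hgle
      _ = ∫⁻ y in Metric.ball z r, A.indicator g y ∂μ + τ * μ (Metric.ball z r) := by
          rw [lintegral_add_right _ measurable_const, setLIntegral_const]
      _ ≤ (enlMax μ (A.indicator g) x + τ) * μ (Metric.ball z (5 * r)) := by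
          rw [add_mul]
          gcongr
          · exact lintegral_ball_le_enlMax _ hx
          · have := Metric.pos_of_mem_ball hx
            linarith
  have hsub : {x | ENNReal.ofReal t < enlMax μ g x} ⊆ {x | τ < enlMax μ (A.indicator g) x} := by
    intro x hx
    have h1 : τ + τ < enlMax μ (A.indicator g) x + τ := by
      rw [← htt]; exact lt_of_lt_of_le hx (hmax x)
    exact lt_of_add_lt_add_right h1
  have hweak := mul_measure_lt_enlMax_le (μ := μ) (A.indicator g) τ
  rw [lintegral_indicator hAm, ← withDensity_apply _ hAm] at hweak
  calc _ ≤ μ {x | τ < enlMax μ (A.indicator g) x} := measure_mono hsub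
    _ = ENNReal.ofReal (2 / t) * (τ * μ {x | τ < enlMax μ (A.indicator g) x}) := by
        rw [← mul_assoc, hτ, ← ENNReal.ofReal_mul (by positivity)]
        have : 2 / t * (t / 2) = 1 := by field_simp
        rw [this, ENNReal.ofReal_one, one_mul]
    _ ≤ _ := by gcongr

/-- Strong type `(r, r)` for `1 < r`, by interpolation between the weak type `(1, 1)` bound and the
trivial `L^∞` bound. -/
theorem lintegral_enlMax_rpow_le [OpensMeasurableSpace X] [TopologicalSpace.SeparableSpace X]
    [IsFiniteMeasure μ] {g : X → ℝ≥0∞} (hg : AEMeasurable g μ) {r : ℝ} (hr : 1 < r) :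
    ∫⁻ x, enlMax μ g x ^ r ∂μ ≤ ENNReal.ofReal (r / (r - 1) * 2 ^ r) * ∫⁻ x, g x ^ r ∂μ := by
  wlog hgm : Measurable g generalizing g
  · have h := this hg.measurable_mk.aemeasurable hg.measurable_mk
    rw [enlMax_congr_ae hg.ae_eq_mk]
    refine h.trans (le_of_eq ?_)
    congr 1
    refine lintegral_congr_ae ?_
    filter_upwards [hg.ae_eq_mk] with x hx
    rw [hx]
  have hr0 : 0 < r := by linarith
  have hr1 : 0 < r - 1 := by linarith
  by_cases hfin : ∫⁻ x, g x ^ r ∂μ = ∞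
  · rw [hfin, ENNReal.mul_top]
    · exact le_top
    · simp only [ne_eq, ENNReal.ofReal_eq_zero, not_le]; positivity
  have hgfin : ∀ᵐ x ∂μ, g x < ∞ := by
    filter_upwards [ae_lt_top' (hg.pow_const r) hfin] with x hx
    by_contra hcon
    rw [not_lt, top_le_iff] at hcon
    rw [hcon, ENNReal.top_rpow_of_pos hr0] at hx
    exact lt_irrefl _ hx
  have hg1 : ∫⁻ x, g x ∂μ < ∞ := by
    have hle : ∀ x, g x ≤ 1 + g x ^ r := by
      intro x
      rcases le_total (g x) 1 with h | h
      · exact h.trans le_self_add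
      · calc g x = g x ^ (1 : ℝ) := (ENNReal.rpow_one _).symm
          _ ≤ g x ^ r := ENNReal.rpow_le_rpow_of_exponent_le h hr.le
          _ ≤ _ := le_add_self
    refine (lintegral_mono hle).trans_lt ?_
    rw [lintegral_add_left measurable_const]
    exact ENNReal.add_lt_top.2 ⟨by simp, lt_top_iff_ne_top.2 hfin⟩
  have hMfin : ∀ᵐ x ∂μ, enlMax μ g x < ∞ := by
    rw [ae_iff]
    by_contra hne
    set a := μ {x | ¬ enlMax μ g x < ∞} with ha
    have hle : ∀ k : ℕ, (k : ℝ≥0∞) * a ≤ ∫⁻ x, g x ∂μ := fun k => by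
      refine le_trans ?_ (mul_measure_lt_enlMax_le (μ := μ) g k)
      rw [ha]
      refine mul_le_mul_right (measure_mono fun x hx => ?_) _
      simp only [not_lt, top_le_iff, mem_ofPred_eq] at hx ⊢
      rw [hx]; exact ENNReal.natCast_lt_top k
    obtain ⟨k, hk⟩ := ENNReal.exists_nat_mul_gt hne hg1.ne
    exact absurd (hle k) (not_le.2 hk)
  set ν := μ.withDensity g with hν
  have hcake := lintegral_rpow_eq_lintegral_meas_ofReal_lt ν (F := fun x => 2 * g x)
    (hgm.const_mul 2).aemeasurable
    ((withDensity_absolutelyContinuous μ g).ae_le (by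
      filter_upwards [hgfin] with x hx
      exact ENNReal.mul_lt_top (by norm_num) hx)) hr1
  have hνint : ∫⁻ x, (2 * g x) ^ (r - 1) ∂ν = ENNReal.ofReal (2 ^ (r - 1)) * ∫⁻ x, g x ^ r ∂μ := by
    rw [hν, lintegral_withDensity_eq_lintegral_mul _ hgm ((hgm.const_mul 2).pow_const _),
      ← lintegral_const_mul' _ _ ENNReal.ofReal_ne_top]
    refine lintegral_congr fun x => ?_
    rw [Pi.mul_apply, ENNReal.mul_rpow_of_nonneg _ _ hr1.le, mul_left_comm,
      ← ENNReal.ofReal_rpow_of_pos (by norm_num)]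
    congr 1
    · simp
    · conv_lhs => enter [1]; rw [← ENNReal.rpow_one (g x)]
      rw [← ENNReal.rpow_add_of_nonneg _ _ zero_le_one hr1.le]
      congr 1; ring
  calc ∫⁻ x, enlMax μ g x ^ r ∂μ
      = ENNReal.ofReal r * ∫⁻ t in Ioi (0 : ℝ), μ {x | ENNReal.ofReal t < enlMax μ g x} *
          ENNReal.ofReal (t ^ (r - 1)) :=
        lintegral_rpow_eq_lintegral_meas_ofReal_lt μ (measurable_enlMax g).aemeasurable hMfin hr0
    _ ≤ ENNReal.ofReal r * ∫⁻ t in Ioi (0 : ℝ), ENNReal.ofReal 2 *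
          (ν {x | ENNReal.ofReal t < 2 * g x} * ENNReal.ofReal (t ^ (r - 1 - 1))) := by
        refine mul_le_mul_right (setLIntegral_mono' measurableSet_Ioi fun t ht => ?_) _
        have ht : 0 < t := ht
        calc _ ≤ (ENNReal.ofReal (2 / t) * ν {x | ENNReal.ofReal t < 2 * g x}) *
              ENNReal.ofReal (t ^ (r - 1)) := by
              gcongr
              exact measure_lt_enlMax_le_indicator hgm ht
          _ = ν {x | ENNReal.ofReal t < 2 * g x} *
              (ENNReal.ofReal (2 / t) * ENNReal.ofReal (t ^ (r - 1))) := by ring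
          _ = ν {x | ENNReal.ofReal t < 2 * g x} *
              (ENNReal.ofReal 2 * ENNReal.ofReal (t ^ (r - 1 - 1))) := by
              rw [← ENNReal.ofReal_mul (by positivity), ← ENNReal.ofReal_mul (by positivity),
                Real.rpow_sub_one ht.ne' (r - 1)]
              congr 2
              ring
          _ = _ := by ring
    _ = ENNReal.ofReal r * (ENNReal.ofReal 2 * (ENNReal.ofReal (r - 1)⁻¹ *
          ∫⁻ x, (2 * g x) ^ (r - 1) ∂ν)) := by
        rw [hcake, lintegral_const_mul' _ _ ENNReal.ofReal_ne_top,
          ← mul_assoc (ENNReal.ofReal (r - 1)⁻¹), ← ENNReal.ofReal_mul (by positivity),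
          inv_mul_cancel₀ hr1.ne', ENNReal.ofReal_one, one_mul]
    _ = _ := by
        rw [hνint, ← mul_assoc, ← mul_assoc, ← mul_assoc, ← ENNReal.ofReal_mul (by positivity),
          ← ENNReal.ofReal_mul (by positivity), ← ENNReal.ofReal_mul (by positivity)]
        congr 2
        rw [Real.rpow_sub_one (by norm_num) r]
        field_simp

end Maximal

/-! ### Calderón–Zygmund kernels -/

/-- The size and smoothness conditions on a Calderón–Zygmund kernel, with named constant and
modulus. -/
structure KernelBounds {n : ℕ} (Ω : Set (EuclideanSpace ℝ (Fin n)))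
    (K : EuclideanSpace ℝ (Fin n) → EuclideanSpace ℝ (Fin n) → ℝ) (C : ℝ) (w : ℝ → ℝ) : Prop where
  pos : 0 < C
  modulus : IsDiniModulus w
  size : ∀ x ∈ Ω, ∀ y ∈ Ω, x ≠ y → |K x y| ≤ C / ‖x - y‖ ^ n
  smooth : ∀ x₁ ∈ Ω, ∀ x₂ ∈ Ω, ∀ y ∈ Ω, x₁ ≠ x₂ → x₁ ≠ y → x₂ ≠ y → C * ‖x₁ - x₂‖ < ‖x₂ - y‖ →
      |K x₁ y - K x₂ y| + |K y x₁ - K y x₂| ≤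
        C * w (‖x₂ - x₁‖ / ‖x₂ - y‖) * (1 / ‖x₂ - y‖ ^ n)

theorem IsCalderonZygmundKernel.exists_kernelBounds {n : ℕ} {Ω : Set (EuclideanSpace ℝ (Fin n))}
    {K : EuclideanSpace ℝ (Fin n) → EuclideanSpace ℝ (Fin n) → ℝ}
    (h : IsCalderonZygmundKernel Ω K) : ∃ C w, KernelBounds Ω K C w := by
  obtain ⟨C, w, h1, h2, h3, h4⟩ := h
  exact ⟨C, w, h1, h2, h3, h4⟩

/-- A Dini modulus is summable along the dyadic scales. -/
theorem IsDiniModulus.tsum_ne_top {w : ℝ → ℝ} (hw : IsDiniModulus w) :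
    ∑' k : ℕ, ENNReal.ofReal (w ((1 / 2) ^ (k + 1))) ≠ ∞ := by
  have hfin : ∫⁻ t in Ioo (0 : ℝ) 1, ENNReal.ofReal (w t / t) < ∞ := by
    have := hw.dini.2
    rw [hasFiniteIntegral_iff_enorm] at this
    refine lt_of_le_of_lt (lintegral_mono fun t => ?_) this
    rw [Real.enorm_eq_ofReal_abs]
    exact ENNReal.ofReal_le_ofReal (le_abs_self _)
  have hterm : ∀ k : ℕ, ENNReal.ofReal (w ((1 / 2) ^ (k + 1))) ≤
      2 * ∫⁻ t in Ioo ((1 / 2 : ℝ) ^ (k + 1)) ((1 / 2) ^ k), ENNReal.ofReal (w t / t) := by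
    intro k
    set a : ℝ := (1 / 2) ^ (k + 1) with ha
    have ha0 : 0 < a := by positivity
    have ha2 : (1 / 2 : ℝ) ^ k = 2 * a := by rw [ha, pow_succ]; ring
    rw [ha2]
    have : ∫⁻ t in Ioo a (2 * a), ENNReal.ofReal (w a / (2 * a)) ≤
        ∫⁻ t in Ioo a (2 * a), ENNReal.ofReal (w t / t) := by
      refine setLIntegral_mono' measurableSet_Ioo fun t ht => ENNReal.ofReal_le_ofReal ?_
      have ht0 : 0 < t := ha0.trans ht.1
      exact div_le_div₀ (hw.pos t ht0).le (hw.monotoneOn ha0 ht0 ht.1.le) ht0 ht.2.le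
    rw [setLIntegral_const, Real.volume_Ioo] at this
    calc ENNReal.ofReal (w a)
        = 2 * (ENNReal.ofReal (w a / (2 * a)) * ENNReal.ofReal (2 * a - a)) := by
          rw [← ENNReal.ofReal_mul (div_nonneg (hw.pos a ha0).le (by positivity)),
            show (2 : ℝ≥0∞) = ENNReal.ofReal 2 by simp, ← ENNReal.ofReal_mul (by norm_num)]
          congr 1
          field_simp
          ring
      _ ≤ _ := by gcongr
  have hdisj : Pairwise (Function.onFun Disjoint
      fun k : ℕ => Ioo ((1 / 2 : ℝ) ^ (k + 1)) ((1 / 2) ^ k)) := by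
    intro i j hij
    wlog h : i < j generalizing i j
    · exact (this hij.symm (lt_of_le_of_ne (not_lt.1 h) hij.symm)).symm
    refine Set.disjoint_left.2 fun t hti htj => ?_
    have : (1 / 2 : ℝ) ^ j ≤ (1 / 2) ^ (i + 1) :=
      pow_le_pow_of_le_one (by norm_num) (by norm_num) h
    exact absurd (hti.1.trans htj.2) (not_lt.2 this)
  refine ne_of_lt (lt_of_le_of_lt (ENNReal.tsum_le_tsum hterm) ?_)
  rw [ENNReal.tsum_mul_left, ← lintegral_iUnion (fun k => measurableSet_Ioo) hdisj]
  refine ENNReal.mul_lt_top (by norm_num) (lt_of_le_of_lt (lintegral_mono_set ?_) hfin)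
  refine iUnion_subset fun k t ht => ⟨lt_trans (by positivity) ht.1, ht.2.trans_le ?_⟩
  exact pow_le_one₀ (by norm_num) (by norm_num)

theorem IsDiniModulus.exists_small {w : ℝ → ℝ} (hw : IsDiniModulus w) {ε : ℝ} (hε : 0 < ε) :
    ∃ t, 0 < t ∧ w t < ε := by
  have h := ENNReal.tendsto_atTop_zero_of_tsum_ne_top hw.tsum_ne_top
  have h2 := h.eventually (gt_mem_nhds (show (0 : ℝ≥0∞) < ENNReal.ofReal ε by simpa using hε))
  obtain ⟨k, hk⟩ := h2.exists
  exact ⟨(1 / 2) ^ (k + 1), by positivity, (ENNReal.ofReal_lt_ofReal_iff hε).1 hk⟩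

theorem volume_restrict_ball_le {n : ℕ} (Ω : Set (EuclideanSpace ℝ (Fin n)))
    (x : EuclideanSpace ℝ (Fin n)) {r : ℝ} (hr : 0 < r) :
    volume.restrict Ω (Metric.ball x r) ≤
      ENNReal.ofReal (r ^ n) * volume (Metric.ball (0 : EuclideanSpace ℝ (Fin n)) 1) := by
  refine (Measure.restrict_apply_le _ _).trans (le_of_eq ?_)
  rw [Measure.addHaar_ball_of_pos volume x hr]
  simp

theorem lintegral_mul_le_of_subset_ball {n : ℕ} {Ω : Set (EuclideanSpace ℝ (Fin n))}
    (hΩ : MeasurableSet Ω) {g φ : EuclideanSpace ℝ (Fin n) → ℝ≥0∞} {x : EuclideanSpace ℝ (Fin n)}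
    {r : ℝ} {c : ℝ≥0∞} {S : Set (EuclideanSpace ℝ (Fin n))} (hS : MeasurableSet S)
    (hSr : S ⊆ Metric.ball x r) (hc : c ≠ ∞) (hφ : ∀ y ∈ Ω, y ∈ S → φ y ≤ c) :
    ∫⁻ y in S, φ y * g y ∂(volume.restrict Ω) ≤
      c * ∫⁻ y in Metric.ball x r, g y ∂(volume.restrict Ω) := by
  calc ∫⁻ y in S, φ y * g y ∂(volume.restrict Ω)
      ≤ ∫⁻ y in S, c * g y ∂(volume.restrict Ω) := by
        rw [Measure.restrict_restrict hS]
        exact setLIntegral_mono' (hS.inter hΩ) fun y hy => by gcongr; exact hφ y hy.2 hy.1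
    _ = c * ∫⁻ y in S, g y ∂(volume.restrict Ω) := lintegral_const_mul' _ _ hc
    _ ≤ _ := by gcongr

/-- Domination of the averages of `g` over balls centred at `x`, in terms of the growth `r ^ n`. -/
theorem lintegral_ball_le_of_maximal_bound {n : ℕ} {Ω : Set (EuclideanSpace ℝ (Fin n))}
    {g : EuclideanSpace ℝ (Fin n) → ℝ≥0∞} {x : EuclideanSpace ℝ (Fin n)} {M : ℝ≥0∞}
    (hM : ∀ r > 0, ∫⁻ y in Metric.ball x r, g y ∂(volume.restrict Ω) ≤
      M * volume.restrict Ω (Metric.ball x (5 * r))) {r : ℝ} (hr : 0 < r) :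
    ∫⁻ y in Metric.ball x r, g y ∂(volume.restrict Ω) ≤
      ENNReal.ofReal (r ^ n) *
        (ENNReal.ofReal (5 ^ n) * volume (Metric.ball (0 : EuclideanSpace ℝ (Fin n)) 1) * M) := by
  refine (hM r hr).trans ?_
  calc _ ≤ M * (ENNReal.ofReal ((5 * r) ^ n) *
        volume (Metric.ball (0 : EuclideanSpace ℝ (Fin n)) 1)) := by
        gcongr; exact volume_restrict_ball_le Ω x (by positivity)
    _ = _ := by
        rw [mul_pow, ENNReal.ofReal_mul (by positivity)]; ring

section Kernel

variable {n : ℕ} {Ω : Set (EuclideanSpace ℝ (Fin n))}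
  {K : EuclideanSpace ℝ (Fin n) → EuclideanSpace ℝ (Fin n) → ℝ} {C : ℝ} {w : ℝ → ℝ}

theorem KernelBounds.swap (h : KernelBounds Ω K C w) :
    KernelBounds Ω (fun x y => K y x) C w where
  pos := h.pos
  modulus := h.modulus
  size x hx y hy hxy := by rw [norm_sub_rev]; exact h.size y hy x hx hxy.symm
  smooth x₁ h1 x₂ h2 y hy h12 h1y h2y hC := by
    rw [add_comm]; exact h.smooth x₁ h1 x₂ h2 y hy h12 h1y h2y hC

theorem KernelBounds.enorm_le (h : KernelBounds Ω K C w) {x y : EuclideanSpace ℝ (Fin n)}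
    (hx : x ∈ Ω) (hy : y ∈ Ω) {a : ℝ} (ha : 0 < a) (hxy : a ≤ ‖x - y‖) :
    ‖K x y‖ₑ ≤ ENNReal.ofReal (C / a ^ n) := by
  have hne : x ≠ y := by
    rintro rfl
    simp at hxy; linarith
  rw [Real.enorm_eq_ofReal_abs]
  refine ENNReal.ofReal_le_ofReal ((h.size x hx y hy hne).trans ?_)
  have := h.pos
  gcongr

/-- Local uniform continuity of the kernel in each variable, away from the diagonal. -/
theorem KernelBounds.exists_uniform_continuity (h : KernelBounds Ω K C w) {r ε : ℝ} (hr : 0 < r)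
    (hε : 0 < ε) : ∃ η > 0, ∀ x ∈ Ω, ∀ x₀ ∈ Ω, ∀ y ∈ Ω, r ≤ ‖x₀ - y‖ → ‖x - x₀‖ < η →
      |K x y - K x₀ y| + |K y x - K y x₀| < ε := by
  have hC := h.pos
  obtain ⟨t, ht, hwt⟩ := h.modulus.exists_small (ε := ε * r ^ n / C) (by positivity)
  refine ⟨min (t * r) (r / (C + 1)), by positivity, fun x hx x₀ hx₀ y hy hxy hxx => ?_⟩
  by_cases heq : x = x₀
  · subst heq; simpa using hε
  have h1 : ‖x - x₀‖ < t * r := hxx.trans_le (min_le_left _ _)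
  have h2 : ‖x - x₀‖ * (C + 1) < r := by
    rw [← lt_div_iff₀ (by positivity)]; exact hxx.trans_le (min_le_right _ _)
  have hn : 0 < ‖x - x₀‖ := norm_pos_iff.2 (sub_ne_zero.2 heq)
  have hxy0 : x₀ ≠ y := by rintro rfl; simp at hxy; linarith
  have hxy1 : x ≠ y := by
    rintro rfl
    rw [norm_sub_rev] at hxy
    nlinarith [mul_pos hn hC]
  refine (h.smooth x hx x₀ hx₀ y hy heq hxy1 hxy0 (by nlinarith)).trans_lt ?_
  have hpos : 0 < ‖x₀ - y‖ := hr.trans_le hxy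
  have hdiv : ‖x₀ - x‖ / ‖x₀ - y‖ ≤ t := by
    rw [div_le_iff₀ hpos, norm_sub_rev]
    nlinarith
  have hdpos : 0 < ‖x₀ - x‖ / ‖x₀ - y‖ := by rw [norm_sub_rev x₀ x]; positivity
  have hw1 := h.modulus.monotoneOn hdpos ht hdiv
  calc C * w (‖x₀ - x‖ / ‖x₀ - y‖) * (1 / ‖x₀ - y‖ ^ n) ≤ C * w t * (1 / r ^ n) := by
        gcongr
        exact mul_nonneg hC.le (h.modulus.pos t ht).le
    _ < C * (ε * r ^ n / C) * (1 / r ^ n) := by gcongr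
    _ = ε := by field_simp

theorem KernelBounds.continuousOn_uncurry (h : KernelBounds Ω K C w) :
    ContinuousOn (Function.uncurry K) {p | p.1 ∈ Ω ∧ p.2 ∈ Ω ∧ p.1 ≠ p.2} := by
  rintro ⟨x₀, y₀⟩ ⟨hx₀, hy₀, hne⟩
  rw [Metric.continuousWithinAt_iff]
  intro ε hε
  have hr : 0 < ‖x₀ - y₀‖ := norm_pos_iff.2 (sub_ne_zero.2 hne)
  simp only at hx₀ hy₀ hne
  obtain ⟨η, hη, H⟩ := h.exists_uniform_continuity (half_pos hr) (half_pos hε)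
  refine ⟨min η (‖x₀ - y₀‖ / 2), by positivity, ?_⟩
  rintro ⟨x, y⟩ ⟨hx, hy, hxy⟩ hd
  simp only at hx hy hxy
  rw [Prod.dist_eq, max_lt_iff, dist_eq_norm, dist_eq_norm] at hd
  obtain ⟨hd1, hd2⟩ := hd
  simp only at hd1 hd2
  have e1 := H x hx x₀ hx₀ y hy (by
    have := norm_sub_le_norm_sub_add_norm_sub x₀ y y₀
    have := hd2.trans_le (min_le_right _ _)
    linarith) (hd1.trans_le (min_le_left _ _))
  have e2 := H y hy y₀ hy₀ x₀ hx₀ (by rw [norm_sub_rev y₀ x₀]; linarith) (hd2.trans_le (min_le_left _ _))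
  rw [Real.dist_eq]
  simp only [Function.uncurry]
  have := abs_sub_le (K x y) (K x₀ y) (K x₀ y₀)
  have := abs_nonneg (K y x - K y x₀)
  have := abs_nonneg (K y x₀ - K y₀ x₀)
  linarith

/-- The Hörmander-type integral condition in the form of a maximal estimate: the Dini condition
sums the contributions of the dyadic annuli. -/
theorem KernelBounds.exists_hormander (hΩ : MeasurableSet Ω) (h : KernelBounds Ω K C w) :
    ∃ A : ℝ≥0, ∀ x ∈ Ω, ∀ u ∈ Ω, ∀ R > 0, ‖u - x‖ ≤ R →
      ∀ (g : EuclideanSpace ℝ (Fin n) → ℝ≥0∞) (N : ℝ≥0∞),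
      (∀ r > 0, ∫⁻ y in Metric.ball x r, g y ∂(volume.restrict Ω) ≤ ENNReal.ofReal (r ^ n) * N) →
      ∫⁻ y in {y | max C 2 * R < ‖x - y‖}, ‖K u y - K x y‖ₑ * g y ∂(volume.restrict Ω) ≤
        A * N := by
  have hC := h.pos
  set T := ∑' k : ℕ, ENNReal.ofReal (w ((1 / 2) ^ (k + 1))) with hT
  have hTfin : T ≠ ∞ := h.modulus.tsum_ne_top
  refine ⟨(ENNReal.ofReal (C * 4 ^ n) * T).toNNReal, fun x hx u hu R hR hux g N hN => ?_⟩
  rw [ENNReal.coe_toNNReal (ENNReal.mul_ne_top ENNReal.ofReal_ne_top hTfin)]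
  set L := max C 2 with hL
  have hL2 : 2 ≤ L := le_max_right _ _
  have hLC : C ≤ L := le_max_left _ _
  have hLR : 0 < L * R := by positivity
  set S : ℕ → Set (EuclideanSpace ℝ (Fin n)) :=
    fun k => {y | L * R < ‖x - y‖ ∧ L * R * 2 ^ k ≤ ‖x - y‖ ∧ ‖x - y‖ < L * R * 2 ^ (k + 1)} with hS
  have hnorm : ∀ x : EuclideanSpace ℝ (Fin n), Measurable fun y => ‖x - y‖ := fun x => by fun_prop
  have hcov : {y | L * R < ‖x - y‖} ⊆ ⋃ k, S k := by
    intro y hy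
    have hy : L * R < ‖x - y‖ := hy
    obtain ⟨k, hk⟩ := exists_nat_pow_near (x := ‖x - y‖ / (L * R)) (y := 2)
      (by rw [le_div_iff₀ hLR]; linarith) (by norm_num)
    rw [le_div_iff₀ hLR, div_lt_iff₀ hLR] at hk
    exact mem_iUnion.2 ⟨k, hy, by rw [mul_comm]; exact hk.1, by rw [mul_comm]; exact hk.2⟩
  have hann : ∀ k, ∫⁻ y in S k, ‖K u y - K x y‖ₑ * g y ∂(volume.restrict Ω) ≤
      ENNReal.ofReal (w ((1 / 2) ^ (k + 1))) * (ENNReal.ofReal (C * 4 ^ n) * N) := by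
    intro k
    have hwk := h.modulus.pos ((1 / 2) ^ (k + 1)) (by positivity)
    have hSm : MeasurableSet (S k) :=
      (measurableSet_lt measurable_const (hnorm x)).inter
        ((measurableSet_le measurable_const (hnorm x)).inter
          (measurableSet_lt (hnorm x) measurable_const))
    have hb := lintegral_mul_le_of_subset_ball (g := g) (φ := fun y => ‖K u y - K x y‖ₑ) hΩ hSm
      (r := L * R * 2 ^ (k + 2))
      (c := ENNReal.ofReal (C * w ((1 / 2) ^ (k + 1)) * (1 / (L * R * 2 ^ k) ^ n)))
      (x := x) ?_ ENNReal.ofReal_ne_top ?_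
    · refine hb.trans ((mul_le_mul_right (hN _ (by positivity)) _).trans (le_of_eq ?_))
      rw [← mul_assoc, ← mul_assoc, ← ENNReal.ofReal_mul (by positivity),
        ← ENNReal.ofReal_mul hwk.le]
      congr 2
      have : (L * R * 2 ^ (k + 2)) ^ n = (L * R * 2 ^ k) ^ n * 4 ^ n := by
        rw [← mul_pow]; congr 1; ring
      rw [this]
      field_simp
    · intro y hy
      rw [Metric.mem_ball, dist_comm, dist_eq_norm]
      refine hy.2.2.trans_le ?_
      gcongr <;> norm_num
    · intro y hyΩ hy
      have hy1 : L * R * 2 ^ k ≤ ‖x - y‖ := hy.2.1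
      have hbig : L * R < ‖x - y‖ := hy.1
      have hk1 : (1 : ℝ) ≤ 2 ^ k := one_le_pow₀ (by norm_num)
      have hpos : 0 < L * R * 2 ^ k := by positivity
      by_cases hux0 : u = x
      · subst hux0; simp
      have hxy : x ≠ y := by rintro rfl; simp at hbig; linarith
      have huy : u ≠ y := by
        rintro rfl
        rw [norm_sub_rev] at hbig
        nlinarith
      have hsm := h.smooth u hu x hx y hyΩ hux0 huy hxy
        (lt_of_le_of_lt (mul_le_mul hLC hux (norm_nonneg _) (by positivity)) hbig)
      have hn : 0 < ‖x - u‖ := norm_pos_iff.2 (sub_ne_zero.2 (Ne.symm hux0))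
      have hdiv : ‖x - u‖ / ‖x - y‖ ≤ (1 / 2) ^ (k + 1) := by
        rw [div_le_iff₀ (hpos.trans_le hy1), norm_sub_rev]
        calc ‖u - x‖ ≤ R := hux
          _ = (1 / 2) ^ (k + 1) * (2 * R * 2 ^ k) := by
              rw [pow_succ, one_div, inv_pow]; field_simp
          _ ≤ (1 / 2) ^ (k + 1) * (L * R * 2 ^ k) := by gcongr
          _ ≤ _ := by gcongr
      have hw1 := h.modulus.monotoneOn (show ‖x - u‖ / ‖x - y‖ ∈ Ioi 0 from
        div_pos hn (hpos.trans_le hy1)) (show ((1 / 2 : ℝ) ^ (k + 1)) ∈ Ioi 0 by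
          simp only [mem_Ioi]; positivity) hdiv
      rw [Real.enorm_eq_ofReal_abs]
      refine ENNReal.ofReal_le_ofReal ?_
      have := abs_nonneg (K y u - K y x)
      refine le_trans (by linarith) (hsm.trans ?_)
      gcongr
  calc _ ≤ ∫⁻ y in ⋃ k, S k, ‖K u y - K x y‖ₑ * g y ∂(volume.restrict Ω) :=
        lintegral_mono_set hcov
    _ ≤ ∑' k, ∫⁻ y in S k, ‖K u y - K x y‖ₑ * g y ∂(volume.restrict Ω) := lintegral_iUnion_le _ _
    _ ≤ ∑' k, ENNReal.ofReal (w ((1 / 2) ^ (k + 1))) * (ENNReal.ofReal (C * 4 ^ n) * N) :=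
        ENNReal.tsum_le_tsum hann
    _ = _ := by rw [ENNReal.tsum_mul_right, ← hT]; ring

end Kernel

/-! ### Doubling radii and steep chains of radii -/

/-- Along the radii `R, R / 20, …, R / 20 ^ k` around `x`, each step shrinks the measure of `Ω` in
the ball at least by the factor `2 * 20 ^ n`, twice the factor lost by full Lebesgue measure. Such
steps are harmless: the kernel `|x - y| ^ (-n)` integrates over them with geometric decay. -/
def SteepScales {n : ℕ} (Ω : Set (EuclideanSpace ℝ (Fin n))) (x : EuclideanSpace ℝ (Fin n))
    (R : ℝ) (k : ℕ) : Prop :=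
  ∀ j < k, ENNReal.ofReal (2 * 20 ^ n) * volume.restrict Ω (Metric.ball x (R / 20 ^ (j + 1))) ≤
    volume.restrict Ω (Metric.ball x (R / 20 ^ j))

section Scales

variable {n : ℕ} {Ω : Set (EuclideanSpace ℝ (Fin n))} {x : EuclideanSpace ℝ (Fin n)}

theorem measure_ball_pos_of_mem (hΩ : IsOpen Ω) (hx : x ∈ Ω) {r : ℝ} (hr : 0 < r) :
    0 < volume.restrict Ω (Metric.ball x r) := by
  rw [Measure.restrict_apply Metric.isOpen_ball.measurableSet]
  exact (Metric.isOpen_ball.inter hΩ).measure_pos _ ⟨x, Metric.mem_ball_self hr, hx⟩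

/-- Below every radius there is a doubling one, reached through a steep chain; it exists because
small balls around a point of the open set `Ω` are contained in `Ω`. -/
theorem exists_steepScales_down (hΩ : IsOpen Ω) (hx : x ∈ Ω) {R : ℝ} (hR : 0 < R) :
    ∃ k, SteepScales Ω x R k ∧ volume.restrict Ω (Metric.ball x (R / 20 ^ k)) ≤
      ENNReal.ofReal (2 * 20 ^ n) * volume.restrict Ω (Metric.ball x (R / 20 ^ (k + 1))) := by
  classical
  have hex : ∃ k, volume.restrict Ω (Metric.ball x (R / 20 ^ k)) ≤
      ENNReal.ofReal (2 * 20 ^ n) * volume.restrict Ω (Metric.ball x (R / 20 ^ (k + 1))) := by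
    obtain ⟨r, hr, hball⟩ := Metric.isOpen_iff.1 hΩ x hx
    obtain ⟨k, hk⟩ := pow_unbounded_of_one_lt (R / r) (by norm_num : (1 : ℝ) < 20)
    have hk' : R / 20 ^ k ≤ r := by
      rw [div_lt_iff₀ hr] at hk
      rw [div_le_iff₀ (by positivity)]
      linarith
    refine ⟨k, (Measure.restrict_apply_le _ _).trans ?_⟩
    have hsub : Metric.ball x (R / 20 ^ (k + 1)) ⊆ Ω := by
      refine (Metric.ball_subset_ball (le_trans ?_ hk')).trans hball
      gcongr <;> norm_num
    rw [Measure.restrict_eq_self _ hsub, Measure.addHaar_ball_of_pos volume x (by positivity),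
      Measure.addHaar_ball_of_pos volume x (by positivity), ← mul_assoc,
      ← ENNReal.ofReal_mul (by positivity)]
    gcongr
    simp only [finrank_euclideanSpace, Fintype.card_fin]
    have : (R / 20 ^ k) ^ n = 20 ^ n * (R / 20 ^ (k + 1)) ^ n := by
      rw [← mul_pow]; congr 1; rw [pow_succ]; field_simp
    rw [this]
    have : 0 ≤ 20 ^ n * (R / 20 ^ (k + 1)) ^ n := by positivity
    nlinarith
  refine ⟨Nat.find hex, fun j hj => ?_, Nat.find_spec hex⟩
  exact (not_le.1 (Nat.find_min hex hj)).le

/-- Above every radius there is a doubling one, reached through a steep chain; it exists because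
`Ω` has finite measure. -/
theorem exists_steepScales_up (hΩ : IsOpen Ω) [IsFiniteMeasure (volume.restrict Ω)] (hx : x ∈ Ω)
    {δ : ℝ} (hδ : 0 < δ) :
    ∃ k, SteepScales Ω x (20 ^ k * δ) k ∧
      volume.restrict Ω (Metric.ball x (20 * (20 ^ k * δ))) ≤
      ENNReal.ofReal (2 * 20 ^ n) * volume.restrict Ω (Metric.ball x (20 ^ k * δ)) := by
  classical
  have hex : ∃ k, volume.restrict Ω (Metric.ball x (20 ^ (k + 1) * δ)) ≤
      ENNReal.ofReal (2 * 20 ^ n) * volume.restrict Ω (Metric.ball x (20 ^ k * δ)) := by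
    by_contra! hcon
    have hgrow : ∀ k : ℕ, (2 : ℝ≥0∞) ^ k * volume.restrict Ω (Metric.ball x δ) ≤
        volume.restrict Ω (Metric.ball x (20 ^ k * δ)) := by
      intro k
      induction k with
      | zero => simp
      | succ k ih =>
        refine le_trans ?_ (hcon k).le
        rw [pow_succ, mul_comm ((2 : ℝ≥0∞) ^ k), mul_assoc]
        gcongr
        rw [show (2 : ℝ≥0∞) = ENNReal.ofReal 2 by simp]
        refine ENNReal.ofReal_le_ofReal ?_
        have : (1 : ℝ) ≤ 20 ^ n := one_le_pow₀ (by norm_num)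
        linarith
    have hpos := measure_ball_pos_of_mem hΩ hx hδ
    obtain ⟨N, hN⟩ := ENNReal.exists_nat_mul_gt hpos.ne' (measure_ne_top (volume.restrict Ω) univ)
    have h1 : (N : ℝ≥0∞) ≤ 2 ^ N := by exact_mod_cast N.lt_two_pow_self.le
    have := (mul_le_mul_left h1 (volume.restrict Ω (Metric.ball x δ))).trans (hgrow N)
    exact absurd (hN.trans_le (this.trans (measure_mono (subset_univ _)))) (lt_irrefl _)
  refine ⟨Nat.find hex, fun j hj => ?_, ?_⟩
  · have hlt : Nat.find hex - 1 - j < Nat.find hex := by omega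
    have h := (not_le.1 (Nat.find_min hex hlt)).le
    have key : ∀ a b : ℕ, (20 : ℝ) ^ (a + b) * δ / 20 ^ b = 20 ^ a * δ := by
      intro a b; rw [pow_add]; field_simp
    have e1 := key (Nat.find hex - 1 - j) (j + 1)
    have e2 := key (Nat.find hex - 1 - j + 1) j
    rw [show Nat.find hex - 1 - j + (j + 1) = Nat.find hex by omega] at e1
    rw [show Nat.find hex - 1 - j + 1 + j = Nat.find hex by omega] at e2
    rw [e1, e2]
    exact h
  · have := Nat.find_spec hex
    rwa [pow_succ, mul_comm ((20 : ℝ) ^ _) 20, mul_assoc] at this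

theorem SteepScales.measure_ball_le {R : ℝ} {k : ℕ} (hR : 0 < R) (h : SteepScales Ω x R k) {j : ℕ}
    (hj : j ≤ k) : volume.restrict Ω (Metric.ball x (R / 20 ^ j)) ≤
      ENNReal.ofReal (R ^ n / (2 * 20 ^ n) ^ j) *
        volume (Metric.ball (0 : EuclideanSpace ℝ (Fin n)) 1) := by
  induction j with
  | zero => simpa using volume_restrict_ball_le Ω x hR
  | succ j ih =>
    have h1 := (h j (by omega)).trans (ih (by omega))
    have hD : (0 : ℝ) < 2 * 20 ^ n := by positivity
    calc volume.restrict Ω (Metric.ball x (R / 20 ^ (j + 1)))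
        = ENNReal.ofReal ((2 * 20 ^ n)⁻¹) * (ENNReal.ofReal (2 * 20 ^ n) *
            volume.restrict Ω (Metric.ball x (R / 20 ^ (j + 1)))) := by
          rw [← mul_assoc, ← ENNReal.ofReal_mul (by positivity), inv_mul_cancel₀ hD.ne',
            ENNReal.ofReal_one, one_mul]
      _ ≤ ENNReal.ofReal ((2 * 20 ^ n)⁻¹) * (ENNReal.ofReal (R ^ n / (2 * 20 ^ n) ^ j) *
        volume (Metric.ball (0 : EuclideanSpace ℝ (Fin n)) 1)) := by gcongr
      _ = _ := by
          rw [← mul_assoc, ← ENNReal.ofReal_mul (by positivity)]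
          congr 2
          rw [pow_succ (2 * 20 ^ n : ℝ) j]
          field_simp

theorem measurable_norm_sub_left (x : EuclideanSpace ℝ (Fin n)) : Measurable fun y => ‖x - y‖ := by
  fun_prop

theorem lintegral_annulus_le (hΩ : MeasurableSet Ω) {g φ : EuclideanSpace ℝ (Fin n) → ℝ≥0∞}
    {M : ℝ≥0∞} (hM : ∀ r > 0, ∫⁻ y in Metric.ball x r, g y ∂(volume.restrict Ω) ≤
      M * volume.restrict Ω (Metric.ball x (5 * r))) {a b B : ℝ} (ha : 0 < a) (hb : 0 < b)
    (hB : 0 ≤ B) {S : Set (EuclideanSpace ℝ (Fin n))} (hS : MeasurableSet S)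
    (hSb : ∀ y ∈ S, ‖x - y‖ < b) (hφ : ∀ y ∈ Ω, y ∈ S → φ y ≤ ENNReal.ofReal (B / a ^ n)) :
    ∫⁻ y in S, φ y * g y ∂(volume.restrict Ω) ≤ ENNReal.ofReal (B * (b / a) ^ n) *
      (ENNReal.ofReal (5 ^ n) * volume (Metric.ball (0 : EuclideanSpace ℝ (Fin n)) 1) * M) := by
  refine (lintegral_mul_le_of_subset_ball (x := x) (r := b) hΩ hS (fun y hy => ?_)
    ENNReal.ofReal_ne_top hφ).trans ?_
  · rw [Metric.mem_ball, dist_comm, dist_eq_norm]; exact hSb y hy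
  · refine (mul_le_mul_right (lintegral_ball_le_of_maximal_bound hM hb) _).trans (le_of_eq ?_)
    rw [← mul_assoc, ← ENNReal.ofReal_mul (by positivity)]
    congr 2
    rw [div_pow]; field_simp

/-- Integrals of `|x - y| ^ (-n)` across a steep chain are controlled by the maximal function, with
a constant independent of the length of the chain. -/
theorem SteepScales.lintegral_le (hΩ : MeasurableSet Ω) {R : ℝ} {k : ℕ} (hR : 0 < R)
    (h : SteepScales Ω x R k) {g φ : EuclideanSpace ℝ (Fin n) → ℝ≥0∞} {M : ℝ≥0∞}
    (hM : ∀ r > 0, ∫⁻ y in Metric.ball x r, g y ∂(volume.restrict Ω) ≤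
      M * volume.restrict Ω (Metric.ball x (5 * r))) {B : ℝ} (hB : 0 ≤ B)
    (hφ : ∀ a > 0, ∀ y ∈ Ω, R / 20 ^ k < ‖x - y‖ → a < ‖x - y‖ → φ y ≤ ENNReal.ofReal (B / a ^ n)) :
    ∫⁻ y in {y | R / 20 ^ k < ‖x - y‖ ∧ ‖x - y‖ ≤ R}, φ y * g y ∂(volume.restrict Ω) ≤
      ENNReal.ofReal (B * (4 * 400 ^ n)) *
        (volume (Metric.ball (0 : EuclideanSpace ℝ (Fin n)) 1) * M) := by
  set v := volume (Metric.ball (0 : EuclideanSpace ℝ (Fin n)) 1) with hv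
  have hbig : ∀ j ≤ k, volume.restrict Ω (Metric.ball x (20 * (R / 20 ^ j))) ≤
      ENNReal.ofReal (2 * (20 * R) ^ n / (2 * 20 ^ n) ^ j) * v := by
    intro j hj
    rcases j with _ | j
    · refine (volume_restrict_ball_le Ω x (by positivity)).trans ?_
      gcongr
      have : 0 ≤ (20 * R) ^ n := by positivity
      simp only [pow_zero, div_one]
      linarith
    · have e : 20 * (R / 20 ^ (j + 1)) = R / 20 ^ j := by rw [pow_succ]; field_simp
      rw [e]
      refine (h.measure_ball_le hR (by omega)).trans (le_of_eq ?_)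
      congr 2
      rw [pow_succ (2 * 20 ^ n : ℝ) j, mul_pow 20 R]
      field_simp
  have hstep : ∀ j < k, ∫⁻ y in {y | R / 20 ^ (j + 1) < ‖x - y‖ ∧ ‖x - y‖ ≤ R / 20 ^ j},
      φ y * g y ∂(volume.restrict Ω) ≤
      ENNReal.ofReal (B * (2 * 400 ^ n) * (1 / 2) ^ j) * (v * M) := by
    intro j hj
    have hSm : MeasurableSet {y | R / 20 ^ (j + 1) < ‖x - y‖ ∧ ‖x - y‖ ≤ R / 20 ^ j} :=
      (measurableSet_lt measurable_const (measurable_norm_sub_left x)).inter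
        (measurableSet_le (measurable_norm_sub_left x) measurable_const)
    have hRj : 0 < R / 20 ^ j := by positivity
    refine (lintegral_mul_le_of_subset_ball (x := x) (r := 2 * (R / 20 ^ j)) hΩ hSm ?_
      (ENNReal.ofReal_ne_top (r := B / (R / 20 ^ (j + 1)) ^ n)) ?_).trans ?_
    · intro y hy
      rw [Metric.mem_ball, dist_comm, dist_eq_norm]
      linarith [hy.2]
    · intro y hyΩ hy
      refine hφ _ (by positivity) y hyΩ (lt_of_le_of_lt ?_ hy.1) hy.1
      gcongr
      · norm_num
      · omega
    · calc _ ≤ ENNReal.ofReal (B / (R / 20 ^ (j + 1)) ^ n) *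
            (M * (ENNReal.ofReal (2 * (20 * R) ^ n / (2 * 20 ^ n) ^ j) * v)) := by
            gcongr
            refine (hM _ (by positivity)).trans ?_
            gcongr
            refine (measure_mono (Metric.ball_subset_ball ?_)).trans (hbig j hj.le)
            linarith
        _ = ENNReal.ofReal (B / (R / 20 ^ (j + 1)) ^ n) *
            ENNReal.ofReal (2 * (20 * R) ^ n / (2 * 20 ^ n) ^ j) * (v * M) := by ring
        _ = _ := by
            rw [← ENNReal.ofReal_mul (by positivity)]
            congr 2
            have h400 : (400 : ℝ) ^ n = 20 ^ n * 20 ^ n := by rw [← mul_pow]; norm_num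
            rw [h400, div_pow, mul_pow, mul_pow, div_pow, ← pow_mul, ← pow_mul, add_mul, one_mul,
              pow_add, mul_comm j n]
            field_simp
            try ring
  have hind : ∀ i ≤ k, ∫⁻ y in {y | R / 20 ^ i < ‖x - y‖ ∧ ‖x - y‖ ≤ R},
      φ y * g y ∂(volume.restrict Ω) ≤
      ENNReal.ofReal (B * (2 * 400 ^ n) * ∑ j ∈ Finset.range i, (1 / 2) ^ j) * (v * M) := by
    intro i hi
    induction i with
    | zero =>
      have : {y | R / 20 ^ 0 < ‖x - y‖ ∧ ‖x - y‖ ≤ R} = ∅ := by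
        ext y
        simp
      rw [this]; simp
    | succ i ih =>
      have hsub : {y | R / 20 ^ (i + 1) < ‖x - y‖ ∧ ‖x - y‖ ≤ R} ⊆
          {y | R / 20 ^ i < ‖x - y‖ ∧ ‖x - y‖ ≤ R} ∪
          {y | R / 20 ^ (i + 1) < ‖x - y‖ ∧ ‖x - y‖ ≤ R / 20 ^ i} := by
        intro y hy
        rcases lt_or_ge (R / 20 ^ i) ‖x - y‖ with h1 | h1
        · exact Or.inl ⟨h1, hy.2⟩
        · exact Or.inr ⟨hy.1, h1⟩
      refine (lintegral_mono_set hsub).trans ((lintegral_union_le _ _ _).trans ?_)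
      refine (add_le_add (ih (by omega)) (hstep i (by omega))).trans (le_of_eq ?_)
      rw [← add_mul, ← ENNReal.ofReal_add (by positivity) (by positivity), Finset.sum_range_succ,
        mul_add]
  refine (hind k le_rfl).trans ?_
  gcongr ENNReal.ofReal ?_ * _
  have hs : ∑ j ∈ Finset.range k, (1 / 2 : ℝ) ^ j ≤ 2 := sum_geometric_two_le k
  calc B * (2 * 400 ^ n) * ∑ j ∈ Finset.range k, (1 / 2 : ℝ) ^ j ≤ B * (2 * 400 ^ n) * 2 := by gcongr
    _ = _ := by ring

end Scales

/-! ### Truncated integrals -/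

section Truncated

variable {n : ℕ} {Ω : Set (EuclideanSpace ℝ (Fin n))}
  {K : EuclideanSpace ℝ (Fin n) → EuclideanSpace ℝ (Fin n) → ℝ} {C : ℝ} {w : ℝ → ℝ}

/-- The kernel cut off to `|x - y| > δ`. -/
noncomputable def truncKernel (K : EuclideanSpace ℝ (Fin n) → EuclideanSpace ℝ (Fin n) → ℝ) (δ : ℝ)
    (x y : EuclideanSpace ℝ (Fin n)) : ℝ :=
  {y | δ < ‖x - y‖}.indicator (K x) y

theorem truncKernel_of_lt {δ : ℝ} {x y : EuclideanSpace ℝ (Fin n)} (h : δ < ‖x - y‖) :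
    truncKernel K δ x y = K x y := indicator_of_mem (s := {y | δ < ‖x - y‖}) h _

theorem truncKernel_of_le {δ : ℝ} {x y : EuclideanSpace ℝ (Fin n)} (h : ‖x - y‖ ≤ δ) :
    truncKernel K δ x y = 0 := indicator_of_notMem (s := {y | δ < ‖x - y‖}) (not_lt.2 h) _

theorem truncKernel_swap (δ : ℝ) (x y : EuclideanSpace ℝ (Fin n)) :
    truncKernel (fun x y => K y x) δ x y = truncKernel K δ y x := by
  rcases lt_or_ge δ ‖x - y‖ with h | h
  · rw [truncKernel_of_lt h, truncKernel_of_lt (by rwa [norm_sub_rev])]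
  · rw [truncKernel_of_le h, truncKernel_of_le (by rwa [norm_sub_rev])]

theorem measurableSet_lt_norm_sub (δ : ℝ) (x : EuclideanSpace ℝ (Fin n)) :
    MeasurableSet {y | δ < ‖x - y‖} :=
  measurableSet_lt measurable_const (measurable_norm_sub_left x)

theorem setIntegral_lt_norm_sub_eq (a : ℝ) (x : EuclideanSpace ℝ (Fin n))
    (F : EuclideanSpace ℝ (Fin n) → ℝ) :
    ∫ y in {y | y ∈ Ω ∧ a < ‖x - y‖}, F y =
      ∫ y, {y | a < ‖x - y‖}.indicator F y ∂(volume.restrict Ω) := by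
  rw [integral_indicator (measurableSet_lt_norm_sub a x),
    Measure.restrict_restrict (measurableSet_lt_norm_sub a x)]
  congr 2
  ext y
  exact and_comm

theorem truncatedIntegral_eq (f : EuclideanSpace ℝ (Fin n) → ℝ) (x : EuclideanSpace ℝ (Fin n))
    (δ : ℝ) : truncatedIntegral Ω K f x δ =
      ∫ y, truncKernel K δ x y * f y ∂(volume.restrict Ω) := by
  rw [truncatedIntegral, setIntegral_lt_norm_sub_eq]
  refine integral_congr_ae (Eventually.of_forall fun y => ?_)
  rcases lt_or_ge δ ‖x - y‖ with h | h
  · simp only [truncKernel_of_lt h]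
    exact indicator_of_mem (s := {y | δ < ‖x - y‖}) h _
  · simp only [truncKernel_of_le h, zero_mul]
    exact indicator_of_notMem (s := {y | δ < ‖x - y‖}) (not_lt.2 h) _

theorem KernelBounds.norm_truncKernel_le (h : KernelBounds Ω K C w)
    {x y : EuclideanSpace ℝ (Fin n)} (hx : x ∈ Ω) (hy : y ∈ Ω) {δ : ℝ} (hδ : 0 < δ) :
    ‖truncKernel K δ x y‖ ≤ C / δ ^ n := by
  have hC := h.pos
  rcases lt_or_ge δ ‖x - y‖ with hlt | hle
  · rw [truncKernel_of_lt hlt]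
    have hne : x ≠ y := by rintro rfl; simp at hlt; linarith
    refine (h.size x hx y hy hne).trans ?_
    gcongr
  · rw [truncKernel_of_le hle, norm_zero]; positivity

theorem KernelBounds.aestronglyMeasurable_uncurry_truncKernel (hΩ : IsOpen Ω)
    (h : KernelBounds Ω K C w) {δ : ℝ} (hδ : 0 < δ) :
    AEStronglyMeasurable (fun p : EuclideanSpace ℝ (Fin n) × EuclideanSpace ℝ (Fin n) =>
      truncKernel K δ p.1 p.2) ((volume.restrict Ω).prod (volume.restrict Ω)) := by
  set U : Set (EuclideanSpace ℝ (Fin n) × EuclideanSpace ℝ (Fin n)) :=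
    {p | p.1 ∈ Ω ∧ p.2 ∈ Ω ∧ δ < ‖p.1 - p.2‖} with hU
  have hUo : IsOpen U := (hΩ.preimage continuous_fst).inter
    ((hΩ.preimage continuous_snd).inter (isOpen_lt continuous_const (continuous_fst.sub continuous_snd).norm))
  have hcont : ContinuousOn (Function.uncurry K) U :=
    h.continuousOn_uncurry.mono fun p hp => ⟨hp.1, hp.2.1, fun he => by
      have := hp.2.2
      rw [he, sub_self, norm_zero] at this
      linarith⟩
  have hm : AEStronglyMeasurable (U.indicator (Function.uncurry K))
      ((volume.restrict Ω).prod (volume.restrict Ω)) := by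
    rw [aestronglyMeasurable_indicator_iff hUo.measurableSet]
    exact hcont.aestronglyMeasurable hUo.measurableSet
  refine hm.congr ?_
  have hae : ∀ᵐ p ∂((volume.restrict Ω).prod (volume.restrict Ω)), p ∈ Ω ×ˢ Ω := by
    rw [Measure.prod_restrict]
    exact ae_restrict_mem (hΩ.measurableSet.prod hΩ.measurableSet)
  filter_upwards [hae] with p hp
  rcases lt_or_ge δ ‖p.1 - p.2‖ with hlt | hle
  · rw [truncKernel_of_lt hlt, indicator_of_mem (show p ∈ U from ⟨hp.1, hp.2, hlt⟩)]; rfl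
  · rw [truncKernel_of_le hle, indicator_of_notMem fun hpU => absurd hpU.2.2 (not_lt.2 hle)]

theorem KernelBounds.aestronglyMeasurable_truncKernel (hΩ : IsOpen Ω)
    (h : KernelBounds Ω K C w) {δ : ℝ} (hδ : 0 < δ) {x : EuclideanSpace ℝ (Fin n)} (hx : x ∈ Ω) :
    AEStronglyMeasurable (truncKernel K δ x) (volume.restrict Ω) := by
  set U : Set (EuclideanSpace ℝ (Fin n)) := {y | y ∈ Ω ∧ δ < ‖x - y‖} with hU
  have hUo : IsOpen U := hΩ.inter (isOpen_lt continuous_const (continuous_const.sub continuous_id).norm)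
  have hcont : ContinuousOn (K x) U := by
    refine h.continuousOn_uncurry.comp (f := fun y => (x, y)) (by fun_prop) fun y hy => ?_
    refine ⟨hx, hy.1, fun he => ?_⟩
    have h2 := hy.2
    have he' : x = y := he
    rw [he', sub_self, norm_zero] at h2
    linarith
  have hm : AEStronglyMeasurable (U.indicator (K x)) (volume.restrict Ω) := by
    rw [aestronglyMeasurable_indicator_iff hUo.measurableSet]
    exact hcont.aestronglyMeasurable hUo.measurableSet
  refine hm.congr ?_
  filter_upwards [ae_restrict_mem hΩ.measurableSet] with y hy
  rcases lt_or_ge δ ‖x - y‖ with hlt | hle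
  · rw [truncKernel_of_lt hlt, indicator_of_mem (show y ∈ U from ⟨hy, hlt⟩)]
  · rw [truncKernel_of_le hle, indicator_of_notMem fun hpU => absurd hpU.2 (not_lt.2 hle)]

theorem KernelBounds.integrable_truncKernel_mul (hΩ : IsOpen Ω) (h : KernelBounds Ω K C w) {δ : ℝ}
    (hδ : 0 < δ) {x : EuclideanSpace ℝ (Fin n)} (hx : x ∈ Ω) {f : EuclideanSpace ℝ (Fin n) → ℝ}
    (hf : Integrable f (volume.restrict Ω)) :
    Integrable (fun y => truncKernel K δ x y * f y) (volume.restrict Ω) := by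
  refine hf.bdd_mul (c := C / δ ^ n) (h.aestronglyMeasurable_truncKernel hΩ hδ hx) ?_
  filter_upwards [ae_restrict_mem hΩ.measurableSet] with y hy
  exact h.norm_truncKernel_le hx hy hδ

theorem KernelBounds.truncatedIntegral_add (hΩ : IsOpen Ω) (h : KernelBounds Ω K C w) {δ : ℝ}
    (hδ : 0 < δ) {x : EuclideanSpace ℝ (Fin n)} (hx : x ∈ Ω) {f g : EuclideanSpace ℝ (Fin n) → ℝ}
    (hf : Integrable f (volume.restrict Ω)) (hg : Integrable g (volume.restrict Ω)) :
    truncatedIntegral Ω K (f + g) x δ =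
      truncatedIntegral Ω K f x δ + truncatedIntegral Ω K g x δ := by
  simp only [truncatedIntegral_eq, Pi.add_apply, mul_add]
  exact integral_add (h.integrable_truncKernel_mul hΩ hδ hx hf)
    (h.integrable_truncKernel_mul hΩ hδ hx hg)

theorem KernelBounds.enorm_truncatedIntegral_le (hΩ : IsOpen Ω) (h : KernelBounds Ω K C w) {δ : ℝ}
    (hδ : 0 < δ) {x : EuclideanSpace ℝ (Fin n)} (hx : x ∈ Ω)
    (f : EuclideanSpace ℝ (Fin n) → ℝ) :
    ‖truncatedIntegral Ω K f x δ‖ₑ ≤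
      ENNReal.ofReal (C / δ ^ n) * ∫⁻ y, ‖f y‖ₑ ∂(volume.restrict Ω) := by
  rw [truncatedIntegral_eq]
  refine (enorm_integral_le_lintegral_enorm _).trans ?_
  rw [← lintegral_const_mul' _ _ ENNReal.ofReal_ne_top]
  refine lintegral_mono_ae ?_
  filter_upwards [ae_restrict_mem hΩ.measurableSet] with y hy
  rw [enorm_mul]
  gcongr
  rw [← ofReal_norm]
  exact ENNReal.ofReal_le_ofReal (h.norm_truncKernel_le hx hy hδ)

theorem KernelBounds.continuousOn_truncatedIntegral (hn : 0 < n) (hΩ : IsOpen Ω)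
    (h : KernelBounds Ω K C w) {δ : ℝ} (hδ : 0 < δ) {f : EuclideanSpace ℝ (Fin n) → ℝ}
    (hf : Integrable f (volume.restrict Ω)) :
    ContinuousOn (fun x => truncatedIntegral Ω K f x δ) Ω := by
  have : Nonempty (Fin n) := ⟨⟨0, hn⟩⟩
  intro x hx
  refine ContinuousAt.continuousWithinAt ?_
  simp only [truncatedIntegral_eq]
  have hΩx : ∀ᶠ z in 𝓝 x, z ∈ Ω := hΩ.mem_nhds hx
  refine continuousAt_of_dominated (bound := fun y => C / δ ^ n * ‖f y‖) ?_ ?_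
    (hf.norm.const_mul _) ?_
  · filter_upwards [hΩx] with z hz
    exact (h.integrable_truncKernel_mul hΩ hδ hz hf).aestronglyMeasurable
  · filter_upwards [hΩx] with z hz
    filter_upwards [ae_restrict_mem hΩ.measurableSet] with y hy
    rw [norm_mul]
    gcongr
    exact h.norm_truncKernel_le hz hy hδ
  · -- the discontinuities lie on the sphere `|x - y| = δ`, a null set
    have hsph : ∀ᵐ y ∂(volume.restrict Ω), y ∉ Metric.sphere x δ := by
      refine ae_restrict_of_ae ?_
      rw [ae_iff]
      simpa only [not_not] using! Measure.addHaar_sphere volume x δ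
    filter_upwards [ae_restrict_mem hΩ.measurableSet, hsph] with y hy hys
    refine ContinuousAt.mul ?_ continuousAt_const
    have hys' : ‖x - y‖ ≠ δ := by
      intro he; apply hys; rw [mem_sphere_iff_norm, norm_sub_rev]; exact he
    have hnc : ContinuousAt (fun z => ‖z - y‖) x := by fun_prop
    rcases lt_or_gt_of_ne hys' with hlt | hgt
    · refine (continuousAt_const (y := (0 : ℝ))).congr ?_
      filter_upwards [hnc.eventually (gt_mem_nhds hlt)] with z hz
      exact (truncKernel_of_le hz.le).symm
    · have hne : x ≠ y := by rintro rfl; simp at hgt; linarith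
      have hK : ContinuousAt (fun z => K z y) x := by
        have hopen : IsOpen {p : EuclideanSpace ℝ (Fin n) × EuclideanSpace ℝ (Fin n) |
            p.1 ∈ Ω ∧ p.2 ∈ Ω ∧ p.1 ≠ p.2} := (hΩ.preimage continuous_fst).inter
          ((hΩ.preimage continuous_snd).inter (isOpen_ne_fun continuous_fst continuous_snd))
        have := h.continuousOn_uncurry.continuousAt
          (hopen.mem_nhds (show (x, y) ∈ _ from ⟨hx, hy, hne⟩))
        exact ContinuousAt.comp (f := fun z => (z, y)) this (by fun_prop)
      refine hK.congr ?_
      filter_upwards [hnc.eventually (lt_mem_nhds hgt)] with z hz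
      exact (truncKernel_of_lt hz).symm

/-- The maximal truncated operator with the truncation radii bounded below by `η`. -/
noncomputable def maxTrunc (Ω : Set (EuclideanSpace ℝ (Fin n)))
    (K : EuclideanSpace ℝ (Fin n) → EuclideanSpace ℝ (Fin n) → ℝ) (η : ℝ)
    (f : EuclideanSpace ℝ (Fin n) → ℝ) (x : EuclideanSpace ℝ (Fin n)) : ℝ≥0∞ :=
  ⨆ δ ∈ Ici η, ‖truncatedIntegral Ω K f x δ‖ₑ

theorem enorm_truncatedIntegral_le_maxTrunc {η δ : ℝ} (h : η ≤ δ)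
    (f : EuclideanSpace ℝ (Fin n) → ℝ) (x : EuclideanSpace ℝ (Fin n)) :
    ‖truncatedIntegral Ω K f x δ‖ₑ ≤ maxTrunc Ω K η f x :=
  le_iSup₂_of_le δ h le_rfl

theorem KernelBounds.isOpen_lt_maxTrunc (hn : 0 < n) (hΩ : IsOpen Ω) (h : KernelBounds Ω K C w)
    {η : ℝ} (hη : 0 < η) {f : EuclideanSpace ℝ (Fin n) → ℝ}
    (hf : Integrable f (volume.restrict Ω)) (t : ℝ≥0∞) :
    IsOpen (Ω ∩ {x | t < maxTrunc Ω K η f x}) := by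
  have : Ω ∩ {x | t < maxTrunc Ω K η f x} =
      ⋃ δ ∈ Ici η, Ω ∩ (fun x => ‖truncatedIntegral Ω K f x δ‖ₑ) ⁻¹' Ioi t := by
    ext x
    simp only [maxTrunc, lt_iSup_iff, mem_inter_iff, mem_ofPred_eq, mem_iUnion, mem_preimage,
      mem_Ioi, exists_prop]
    tauto
  rw [this]
  refine isOpen_biUnion fun δ hδ => ?_
  exact ((h.continuousOn_truncatedIntegral hn hΩ (hη.trans_le hδ) hf).enorm).isOpen_inter_preimage
    hΩ isOpen_Ioi

theorem KernelBounds.aemeasurable_maxTrunc (hn : 0 < n) (hΩ : IsOpen Ω) (h : KernelBounds Ω K C w)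
    {η : ℝ} (hη : 0 < η) {f : EuclideanSpace ℝ (Fin n) → ℝ}
    (hf : Integrable f (volume.restrict Ω)) :
    AEMeasurable (maxTrunc Ω K η f) (volume.restrict Ω) := by
  refine ⟨Ω.indicator (maxTrunc Ω K η f), ?_, ?_⟩
  · refine measurable_of_Ioi fun t => ?_
    have : Ω.indicator (maxTrunc Ω K η f) ⁻¹' Ioi t = Ω ∩ {x | t < maxTrunc Ω K η f x} := by
      ext x
      by_cases hx : x ∈ Ω <;> simp [hx]
    rw [this]
    exact (h.isOpen_lt_maxTrunc hn hΩ hη hf t).measurableSet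
  · filter_upwards [ae_restrict_mem hΩ.measurableSet] with x hx
    rw [indicator_of_mem hx]

theorem KernelBounds.maxTrunc_le (hΩ : IsOpen Ω) (h : KernelBounds Ω K C w) {η : ℝ} (hη : 0 < η)
    {x : EuclideanSpace ℝ (Fin n)} (hx : x ∈ Ω) (f : EuclideanSpace ℝ (Fin n) → ℝ) :
    maxTrunc Ω K η f x ≤ ENNReal.ofReal (C / η ^ n) * ∫⁻ y, ‖f y‖ₑ ∂(volume.restrict Ω) := by
  have hC := h.pos
  refine iSup₂_le fun δ hδ => (h.enorm_truncatedIntegral_le hΩ (hη.trans_le hδ) hx f).trans ?_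
  have : η ≤ δ := hδ
  gcongr

theorem KernelBounds.maxTrunc_add_le (hΩ : IsOpen Ω) (h : KernelBounds Ω K C w) {η : ℝ}
    (hη : 0 < η) {x : EuclideanSpace ℝ (Fin n)} (hx : x ∈ Ω)
    {f g : EuclideanSpace ℝ (Fin n) → ℝ} (hf : Integrable f (volume.restrict Ω))
    (hg : Integrable g (volume.restrict Ω)) {c : ℝ≥0∞}
    (hc : ∀ δ ≥ η, ‖truncatedIntegral Ω K g x δ‖ₑ ≤ c) :
    maxTrunc Ω K η (f + g) x ≤ maxTrunc Ω K η f x + c := by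
  refine iSup₂_le fun δ hδ => ?_
  rw [h.truncatedIntegral_add hΩ (hη.trans_le hδ) hx hf hg]
  exact (enorm_add_le _ _).trans (add_le_add (enorm_truncatedIntegral_le_maxTrunc hδ f x) (hc δ hδ))

end Truncated

/-! ### Cotlar's inequality -/

theorem lintegral_le_rpow_mul_measure_univ {X : Type*} [MeasurableSpace X] {μ : Measure X}
    {g : X → ℝ≥0∞} (hg : AEMeasurable g μ) {s : ℝ} (hs : 1 ≤ s) :
    ∫⁻ x, g x ∂μ ≤ (∫⁻ x, g x ^ s ∂μ) ^ (1 / s) * μ univ ^ (1 - 1 / s) := by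
  rcases hs.eq_or_lt with rfl | hs
  · simp
  have h := ENNReal.lintegral_mul_le_Lp_mul_Lq μ (Real.HolderConjugate.conjExponent hs) hg
    (aemeasurable_const (b := (1 : ℝ≥0∞)))
  have e : (1 : ℝ) / s.conjExponent = 1 - 1 / s := by
    have := (Real.HolderConjugate.conjExponent hs).one_sub_inv
    rw [one_div, one_div, this]
  simpa [e] using h

section

variable {n : ℕ} {Ω : Set (EuclideanSpace ℝ (Fin n))}
  {K : EuclideanSpace ℝ (Fin n) → EuclideanSpace ℝ (Fin n) → ℝ} {C : ℝ} {w : ℝ → ℝ}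

/-- The maximal function of `|f| ^ s` on `Ω`. Its power `1 / s` is an `L ^ s`-maximal function
of `f`. -/
noncomputable def powMax (Ω : Set (EuclideanSpace ℝ (Fin n))) (s : ℝ)
    (f : EuclideanSpace ℝ (Fin n) → ℝ) : EuclideanSpace ℝ (Fin n) → ℝ≥0∞ :=
  enlMax (volume.restrict Ω) fun y => ‖f y‖ₑ ^ s

theorem lintegral_ball_le_powMax [IsFiniteMeasure (volume.restrict Ω)]
    {f : EuclideanSpace ℝ (Fin n) → ℝ} (hf : AEStronglyMeasurable f (volume.restrict Ω)) {s : ℝ}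
    (hs : 1 ≤ s) {x z : EuclideanSpace ℝ (Fin n)} {r : ℝ} (hx : x ∈ Metric.ball z r) :
    ∫⁻ y in Metric.ball z r, ‖f y‖ₑ ∂(volume.restrict Ω) ≤
      powMax Ω s f x ^ (1 / s) * volume.restrict Ω (Metric.ball z (5 * r)) := by
  have hs0 : 0 < s := by linarith
  have hr := Metric.pos_of_mem_ball hx
  have hle : 0 ≤ 1 - 1 / s := by
    rw [sub_nonneg, div_le_one hs0]; exact hs
  have h5 : volume.restrict Ω (Metric.ball z r) ≤ volume.restrict Ω (Metric.ball z (5 * r)) :=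
    measure_mono (Metric.ball_subset_ball (by linarith))
  refine (lintegral_le_rpow_mul_measure_univ
    (μ := (volume.restrict Ω).restrict (Metric.ball z r)) hf.enorm.restrict hs).trans ?_
  rw [Measure.restrict_apply_univ]
  calc _ ≤ (powMax Ω s f x * volume.restrict Ω (Metric.ball z (5 * r))) ^ (1 / s) *
        volume.restrict Ω (Metric.ball z (5 * r)) ^ (1 - 1 / s) := by
        gcongr
        exact lintegral_ball_le_enlMax _ hx
    _ = powMax Ω s f x ^ (1 / s) * volume.restrict Ω (Metric.ball z (5 * r)) := by
        rw [ENNReal.mul_rpow_of_nonneg _ _ (by positivity), mul_assoc,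
          ← ENNReal.rpow_add_of_nonneg _ _ (by positivity) hle]
        simp

/-- An operator `S`, bounded on `L ^ s (Ω)`, which away from the support acts through the kernel `K`
at all scales `ρ ≥ η`. Both the principal value operator and the truncated operators are of this
kind, so that one argument covers them. -/
structure LocalOp (Ω : Set (EuclideanSpace ℝ (Fin n)))
    (K : EuclideanSpace ℝ (Fin n) → EuclideanSpace ℝ (Fin n) → ℝ) (s : ℝ) (B : ℝ≥0) (η : ℝ)
    (S : (EuclideanSpace ℝ (Fin n) → ℝ) → EuclideanSpace ℝ (Fin n) → ℝ) : Prop where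
  aestronglyMeasurable : ∀ f, MemLp f (ENNReal.ofReal s) (volume.restrict Ω) →
    AEStronglyMeasurable (S f) (volume.restrict Ω)
  lintegral_le : ∀ f, MemLp f (ENNReal.ofReal s) (volume.restrict Ω) →
    ∫⁻ y, ‖S f y‖ₑ ^ s ∂(volume.restrict Ω) ≤ B * ∫⁻ y, ‖f y‖ₑ ^ s ∂(volume.restrict Ω)
  split : ∀ f, MemLp f (ENNReal.ofReal s) (volume.restrict Ω) → ∀ x ∈ Ω, ∀ ρ ≥ η,
    ∀ᵐ y ∂(volume.restrict Ω), y ∈ Metric.ball x ρ →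
      S f y = S ((Metric.closedBall x (2 * ρ)).indicator f) y +
        ∫ z in {z | z ∈ Ω ∧ 2 * ρ < ‖x - z‖}, K y z * f z

/-- If `R` is the last radius of a steep chain starting at `δ`, the truncations at `δ` and at `2 R`
differ by a multiple of the maximal function. -/
theorem KernelBounds.enorm_truncatedIntegral_sub_le (hΩ : IsOpen Ω) (h : KernelBounds Ω K C w)
    {x : EuclideanSpace ℝ (Fin n)} (hx : x ∈ Ω) {δ : ℝ} (hδ : 0 < δ) {k : ℕ}
    (hk : SteepScales Ω x (20 ^ k * δ) k) {f : EuclideanSpace ℝ (Fin n) → ℝ}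
    (hf : Integrable f (volume.restrict Ω)) {M : ℝ≥0∞}
    (hM : ∀ r > 0, ∫⁻ y in Metric.ball x r, ‖f y‖ₑ ∂(volume.restrict Ω) ≤
      M * volume.restrict Ω (Metric.ball x (5 * r))) :
    ‖truncatedIntegral Ω K f x δ - truncatedIntegral Ω K f x (2 * (20 ^ k * δ))‖ₑ ≤
      ENNReal.ofReal (C * (4 * 400 ^ n)) *
        (volume (Metric.ball (0 : EuclideanSpace ℝ (Fin n)) 1) * M) +
      ENNReal.ofReal (C * 3 ^ n) * (ENNReal.ofReal (5 ^ n) *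
        volume (Metric.ball (0 : EuclideanSpace ℝ (Fin n)) 1) * M) := by
  have hC := h.pos
  set R : ℝ := 20 ^ k * δ with hR
  have hR0 : 0 < R := by positivity
  have hδR : δ ≤ R := by
    have : (1 : ℝ) ≤ 20 ^ k := one_le_pow₀ (by norm_num)
    nlinarith
  have hRk : R / 20 ^ k = δ := by rw [hR]; field_simp
  set S1 : Set (EuclideanSpace ℝ (Fin n)) := {y | R / 20 ^ k < ‖x - y‖ ∧ ‖x - y‖ ≤ R} with hS1
  set S2 : Set (EuclideanSpace ℝ (Fin n)) := {y | R < ‖x - y‖ ∧ ‖x - y‖ ≤ 2 * R} with hS2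
  have hS1m : MeasurableSet S1 := (measurableSet_lt measurable_const (measurable_norm_sub_left x)).inter
        (measurableSet_le (measurable_norm_sub_left x) measurable_const)
  have hS2m : MeasurableSet S2 := (measurableSet_lt measurable_const (measurable_norm_sub_left x)).inter
        (measurableSet_le (measurable_norm_sub_left x) measurable_const)
  rw [truncatedIntegral_eq, truncatedIntegral_eq,
    ← integral_sub (h.integrable_truncKernel_mul hΩ hδ hx hf)
      (h.integrable_truncKernel_mul hΩ (by positivity) hx hf)]
  refine (enorm_integral_le_lintegral_enorm _).trans ?_
  calc _ ≤ ∫⁻ y, (S1 ∪ S2).indicator (fun y => ‖K x y‖ₑ * ‖f y‖ₑ) y ∂(volume.restrict Ω) := by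
        refine lintegral_mono fun y => ?_
        rw [← sub_mul, enorm_mul]
        rcases lt_or_ge δ ‖x - y‖ with h1 | h1
        · rcases lt_or_ge (2 * R) ‖x - y‖ with h2 | h2
          · rw [truncKernel_of_lt h1, truncKernel_of_lt h2]; simp
          · have hy : y ∈ S1 ∪ S2 := by
              rcases lt_or_ge R ‖x - y‖ with h3 | h3
              · exact Or.inr ⟨h3, h2⟩
              · exact Or.inl ⟨by rwa [hRk], h3⟩
            rw [truncKernel_of_lt h1, truncKernel_of_le h2, indicator_of_mem hy, sub_zero]
        · rw [truncKernel_of_le h1, truncKernel_of_le (by linarith)]; simp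
    _ = ∫⁻ y in S1 ∪ S2, ‖K x y‖ₑ * ‖f y‖ₑ ∂(volume.restrict Ω) :=
        lintegral_indicator (hS1m.union hS2m) _
    _ ≤ _ := by
        refine (lintegral_union_le _ _ _).trans (add_le_add ?_ ?_)
        · exact hk.lintegral_le hΩ.measurableSet hR0 hM hC.le
            fun a ha y hy _ hay => h.enorm_le hx hy ha hay.le
        · have := lintegral_annulus_le hΩ.measurableSet hM (φ := fun y => ‖K x y‖ₑ) (a := R)
            (b := 3 * R) (B := C) hR0 (by positivity) hC.le hS2m
            (fun y hy => by linarith [hy.2]) (fun y hyΩ hy => h.enorm_le hx hyΩ hR0 hy.1.le)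
          rwa [show 3 * R / R = 3 by field_simp] at this

/-- Moving the pole of the kernel by at most `R` changes the integral over `|x - z| > 2 R` by a
multiple of the maximal function. -/
theorem KernelBounds.exists_enorm_integral_sub_truncatedIntegral_le (hΩ : IsOpen Ω)
    (h : KernelBounds Ω K C w) :
    ∃ A : ℝ≥0, ∀ x ∈ Ω, ∀ R > 0, ∀ u ∈ Ω, u ∈ Metric.ball x R →
      ∀ f : EuclideanSpace ℝ (Fin n) → ℝ, Integrable f (volume.restrict Ω) → ∀ M : ℝ≥0∞,
      (∀ r > 0, ∫⁻ y in Metric.ball x r, ‖f y‖ₑ ∂(volume.restrict Ω) ≤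
        M * volume.restrict Ω (Metric.ball x (5 * r))) →
      ‖(∫ z in {z | z ∈ Ω ∧ 2 * R < ‖x - z‖}, K u z * f z) -
        truncatedIntegral Ω K f x (2 * R)‖ₑ ≤ A * M := by
  obtain ⟨A, hA⟩ := h.exists_hormander hΩ.measurableSet
  have hC := h.pos
  set v := volume (Metric.ball (0 : EuclideanSpace ℝ (Fin n)) 1) with hv
  have hvfin : v ≠ ∞ := measure_ball_lt_top.ne
  set L := max C 2 with hL
  have hL2 : 2 ≤ L := le_max_right _ _
  refine ⟨(A + ENNReal.ofReal (2 * C * (2 * L) ^ n)).toNNReal * (ENNReal.ofReal (5 ^ n) * v).toNNReal,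
    fun x hx R hR u hu hux f hf M hM => ?_⟩
  have hcoe : (((A + ENNReal.ofReal (2 * C * (2 * L) ^ n)).toNNReal *
      (ENNReal.ofReal (5 ^ n) * v).toNNReal : ℝ≥0) : ℝ≥0∞) * M =
      A * (ENNReal.ofReal (5 ^ n) * v * M) +
        ENNReal.ofReal (2 * C * (2 * L) ^ n) * (ENNReal.ofReal (5 ^ n) * v * M) := by
    rw [ENNReal.coe_mul, ENNReal.coe_toNNReal (by simp), ENNReal.coe_toNNReal
      (ENNReal.mul_ne_top ENNReal.ofReal_ne_top hvfin)]
    ring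
  rw [hcoe]
  rw [Metric.mem_ball, dist_eq_norm] at hux
  set T : Set (EuclideanSpace ℝ (Fin n)) := {z | 2 * R < ‖x - z‖} with hT
  have hTm : MeasurableSet T := measurableSet_lt_norm_sub _ x
  have hfar : ∀ z ∈ T, R < ‖u - z‖ := by
    intro z hz
    have hz : 2 * R < ‖x - z‖ := hz
    have := norm_sub_le_norm_sub_add_norm_sub x u z
    rw [norm_sub_rev x u] at this
    linarith
  have hint : Integrable (T.indicator fun z => K u z * f z) (volume.restrict Ω) := by
    refine ((h.integrable_truncKernel_mul hΩ hR hu hf).indicator hTm).congr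
      (Eventually.of_forall fun z => ?_)
    by_cases hz : z ∈ T
    · simp only [indicator_of_mem hz, truncKernel_of_lt (hfar z hz)]
    · simp only [indicator_of_notMem hz]
  rw [setIntegral_lt_norm_sub_eq, truncatedIntegral_eq,
    ← integral_sub hint (h.integrable_truncKernel_mul hΩ (by positivity) hx hf)]
  refine (enorm_integral_le_lintegral_enorm _).trans ?_
  set S1 : Set (EuclideanSpace ℝ (Fin n)) := {z | L * R < ‖x - z‖} with hS1
  set S2 : Set (EuclideanSpace ℝ (Fin n)) := {z | 2 * R < ‖x - z‖ ∧ ‖x - z‖ ≤ L * R} with hS2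
  have hS1m : MeasurableSet S1 := measurableSet_lt_norm_sub _ x
  have hS2m : MeasurableSet S2 := (measurableSet_lt measurable_const (measurable_norm_sub_left x)).inter
        (measurableSet_le (measurable_norm_sub_left x) measurable_const)
  calc _ ≤ ∫⁻ z, (S1 ∪ S2).indicator (fun z => ‖K u z - K x z‖ₑ * ‖f z‖ₑ) z ∂(volume.restrict Ω) := by
        refine lintegral_mono fun z => ?_
        by_cases hz : z ∈ T
        · have hz' : 2 * R < ‖x - z‖ := hz
          have hmem : z ∈ S1 ∪ S2 := by
            rcases lt_or_ge (L * R) ‖x - z‖ with h1 | h1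
            · exact Or.inl h1
            · exact Or.inr ⟨hz', h1⟩
          rw [indicator_of_mem hz, indicator_of_mem hmem, truncKernel_of_lt hz', ← sub_mul,
            enorm_mul]
        · rw [indicator_of_notMem hz, truncKernel_of_le (not_lt.1 hz)]
          simp
    _ = ∫⁻ z in S1 ∪ S2, ‖K u z - K x z‖ₑ * ‖f z‖ₑ ∂(volume.restrict Ω) :=
        lintegral_indicator (hS1m.union hS2m) _
    _ ≤ _ := by
        refine (lintegral_union_le _ _ _).trans (add_le_add ?_ ?_)
        · exact hA x hx u hu R hR hux.le _ _ fun r hr => lintegral_ball_le_of_maximal_bound hM hr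
        · have := lintegral_annulus_le hΩ.measurableSet hM (φ := fun z => ‖K u z - K x z‖ₑ) (a := R)
            (b := 2 * L * R) (B := 2 * C) hR (by positivity) (by positivity) hS2m
            (fun y hy => by nlinarith [hy.2]) (fun z hzΩ hz => by
              refine enorm_sub_le.trans ((add_le_add (h.enorm_le hu hzΩ hR (hfar z hz.1).le)
                (h.enorm_le hx hzΩ hR (by linarith [hz.1]))).trans (le_of_eq ?_))
              rw [← ENNReal.ofReal_add (by positivity) (by positivity)]
              congr 1; ring)
          rwa [show 2 * L * R / R = 2 * L by field_simp] at this

/-- Cotlar's inequality for a measure without the doubling property: the truncations are dominated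
by the maximal functions of `f` and `S f`, the average of `S f` being taken over the first doubling
ball above the truncation radius. -/
theorem KernelBounds.exists_cotlar (hΩ : IsOpen Ω) [IsFiniteMeasure (volume.restrict Ω)]
    (h : KernelBounds Ω K C w) {s : ℝ} (hs : 1 < s) (B : ℝ≥0) :
    ∃ A : ℝ≥0, ∀ η > 0, ∀ S, LocalOp Ω K s B η S →
      ∀ f, MemLp f (ENNReal.ofReal s) (volume.restrict Ω) → ∀ x ∈ Ω,
      maxTrunc Ω K η f x ≤ A * (powMax Ω s f x ^ (1 / s) + powMax Ω s (S f) x ^ (1 / s)) := by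
  obtain ⟨A₁, hA₁⟩ := h.exists_enorm_integral_sub_truncatedIntegral_le hΩ
  have hC := h.pos
  have hs0 : 0 < s := by linarith
  set v := volume (Metric.ball (0 : EuclideanSpace ℝ (Fin n)) 1) with hv
  have hvfin : v ≠ ∞ := measure_ball_lt_top.ne
  set D : ℝ≥0∞ := ENNReal.ofReal (2 * 20 ^ n) with hD
  set E₁ : ℝ≥0∞ := ENNReal.ofReal (C * (4 * 400 ^ n)) * v +
    ENNReal.ofReal (C * 3 ^ n) * (ENNReal.ofReal (5 ^ n) * v) with hE₁
  have hE₁fin : E₁ ≠ ∞ := by finiteness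
  set A : ℝ≥0∞ := E₁ + A₁ + (B * D) ^ (1 / s) + D with hA
  have hAfin : A ≠ ∞ := by
    have : (B * D) ^ (1 / s) ≠ ∞ := ENNReal.rpow_ne_top_of_nonneg (by positivity)
      (ENNReal.mul_ne_top ENNReal.coe_ne_top ENNReal.ofReal_ne_top)
    finiteness
  refine ⟨A.toNNReal, fun η hη S hS f hf x hx => iSup₂_le fun δ hδ => ?_⟩
  rw [ENNReal.coe_toNNReal hAfin]
  have hδη : η ≤ δ := hδ
  have hδ0 : 0 < δ := hη.trans_le hδη
  have hfi : Integrable f (volume.restrict Ω) :=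
    hf.integrable (by rw [← ENNReal.ofReal_one]; exact ENNReal.ofReal_le_ofReal hs.le)
  obtain ⟨k, hk, hdoub⟩ := exists_steepScales_up hΩ hx hδ0
  set P := powMax Ω s f x with hP
  set Q := powMax Ω s (S f) x with hQ
  have hM : ∀ r > 0, ∫⁻ y in Metric.ball x r, ‖f y‖ₑ ∂(volume.restrict Ω) ≤
      P ^ (1 / s) * volume.restrict Ω (Metric.ball x (5 * r)) := fun r hr =>
    lintegral_ball_le_powMax hf.1 hs.le (Metric.mem_ball_self hr)
  have hclose := h.enorm_truncatedIntegral_sub_le hΩ hx hδ0 hk hfi hM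
  set R : ℝ := 20 ^ k * δ with hR
  have hR0 : 0 < R := by positivity
  have hηR : η ≤ R := by
    have : (1 : ℝ) ≤ 20 ^ k := one_le_pow₀ (by norm_num)
    nlinarith
  set ball := Metric.ball x R with hball
  set b := volume.restrict Ω ball with hb
  have hb0 : b ≠ 0 := (measure_ball_pos_of_mem hΩ hx hR0).ne'
  have hbfin : b ≠ ∞ := measure_ne_top _ _
  set f₁ := (Metric.closedBall x (2 * R)).indicator f with hf₁
  have hf₁m : MemLp f₁ (ENNReal.ofReal s) (volume.restrict Ω) :=
    hf.indicator Metric.isClosed_closedBall.measurableSet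
  set I := truncatedIntegral Ω K f x (2 * R) with hI
  -- the pointwise comparison of `I` with values of `S f` on the doubling ball
  have hpt : ∀ᵐ y ∂(volume.restrict Ω), y ∈ ball →
      ‖I‖ₑ ≤ (A₁ * P ^ (1 / s) + ‖S f y‖ₑ) + ‖S f₁ y‖ₑ := by
    filter_upwards [hS.split f hf x hx R hηR, ae_restrict_mem hΩ.measurableSet] with y hy hyΩ hyb
    have h1 := hA₁ x hx R hR0 y hyΩ hyb f hfi _ hM
    set J := ∫ z in {z | z ∈ Ω ∧ 2 * R < ‖x - z‖}, K y z * f z with hJ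
    have e : I = -(J - I) + S f y - S f₁ y := by rw [hy hyb]; ring
    calc ‖I‖ₑ = ‖-(J - I) + S f y - S f₁ y‖ₑ := by rw [← e]
      _ ≤ ‖-(J - I) + S f y‖ₑ + ‖S f₁ y‖ₑ := enorm_sub_le
      _ ≤ (‖-(J - I)‖ₑ + ‖S f y‖ₑ) + ‖S f₁ y‖ₑ := by gcongr; exact enorm_add_le _ _
      _ ≤ _ := by rw [enorm_neg]; gcongr
  have h5 : volume.restrict Ω (Metric.ball x (5 * R)) ≤ D * b :=
    (measure_mono (Metric.ball_subset_ball (by linarith))).trans hdoub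
  have h15 : volume.restrict Ω (Metric.ball x (5 * (3 * R))) ≤ D * b :=
    (measure_mono (Metric.ball_subset_ball (by linarith))).trans hdoub
  have hSf : ∫⁻ y in ball, ‖S f y‖ₑ ∂(volume.restrict Ω) ≤ D * Q ^ (1 / s) * b := by
    refine (lintegral_ball_le_powMax (hS.aestronglyMeasurable f hf) hs.le
      (Metric.mem_ball_self hR0)).trans ?_
    calc _ ≤ Q ^ (1 / s) * (D * b) := by gcongr
      _ = _ := by ring
  have hSf₁ : ∫⁻ y in ball, ‖S f₁ y‖ₑ ∂(volume.restrict Ω) ≤ (B * D) ^ (1 / s) * P ^ (1 / s) * b := by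
    refine (lintegral_le_rpow_mul_measure_univ (μ := (volume.restrict Ω).restrict ball)
      (hS.aestronglyMeasurable f₁ hf₁m).enorm.restrict hs.le).trans ?_
    rw [Measure.restrict_apply_univ]
    have hint : ∫⁻ y in ball, ‖S f₁ y‖ₑ ^ s ∂(volume.restrict Ω) ≤ B * D * P * b := by
      calc _ ≤ ∫⁻ y, ‖S f₁ y‖ₑ ^ s ∂(volume.restrict Ω) := setLIntegral_le_lintegral _ _
        _ ≤ B * ∫⁻ y, ‖f₁ y‖ₑ ^ s ∂(volume.restrict Ω) := hS.lintegral_le f₁ hf₁m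
        _ ≤ B * ∫⁻ y, (Metric.ball x (3 * R)).indicator (fun y => ‖f y‖ₑ ^ s) y
              ∂(volume.restrict Ω) := by
            gcongr with y
            by_cases hy : y ∈ Metric.closedBall x (2 * R)
            · rw [hf₁, indicator_of_mem hy,
                indicator_of_mem (Metric.closedBall_subset_ball (by linarith) hy)]
            · rw [hf₁, indicator_of_notMem hy]
              simp [hs0]
        _ = B * ∫⁻ y in Metric.ball x (3 * R), ‖f y‖ₑ ^ s ∂(volume.restrict Ω) := by
            rw [lintegral_indicator Metric.isOpen_ball.measurableSet]
        _ ≤ B * (P * (D * b)) := by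
            gcongr
            refine (lintegral_ball_le_enlMax _ (Metric.mem_ball_self (by positivity))).trans ?_
            gcongr
            exact le_rfl
        _ = _ := by ring
    calc _ ≤ (B * D * P * b) ^ (1 / s) * b ^ (1 - 1 / s) := by gcongr
      _ = _ := by
        have hle : 0 ≤ 1 - 1 / s := by
          rw [sub_nonneg, div_le_one hs0]; exact hs.le
        rw [ENNReal.mul_rpow_of_nonneg _ _ (by positivity),
          ENNReal.mul_rpow_of_nonneg _ _ (by positivity), mul_assoc,
          ← ENNReal.rpow_add_of_nonneg _ _ (by positivity) hle]
        simp
  have hIb : ‖I‖ₑ * b ≤ (A₁ * P ^ (1 / s) + D * Q ^ (1 / s) + (B * D) ^ (1 / s) * P ^ (1 / s)) * b := by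
    calc ‖I‖ₑ * b = ∫⁻ y in ball, ‖I‖ₑ ∂(volume.restrict Ω) := by rw [setLIntegral_const]
      _ ≤ ∫⁻ y in ball, ((A₁ * P ^ (1 / s) + ‖S f y‖ₑ) + ‖S f₁ y‖ₑ) ∂(volume.restrict Ω) :=
          lintegral_mono_ae ((ae_restrict_iff' Metric.isOpen_ball.measurableSet).2 hpt)
      _ = A₁ * P ^ (1 / s) * b + ∫⁻ y in ball, ‖S f y‖ₑ ∂(volume.restrict Ω) +
          ∫⁻ y in ball, ‖S f₁ y‖ₑ ∂(volume.restrict Ω) := by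
          rw [lintegral_add_right' _ (hS.aestronglyMeasurable f₁ hf₁m).enorm.restrict,
            lintegral_add_left measurable_const, setLIntegral_const]
      _ ≤ A₁ * P ^ (1 / s) * b + D * Q ^ (1 / s) * b + (B * D) ^ (1 / s) * P ^ (1 / s) * b := by
          gcongr
      _ = _ := by ring
  have hI' := (ENNReal.mul_le_mul_iff_left hb0 hbfin).1 hIb
  calc ‖truncatedIntegral Ω K f x δ‖ₑ = ‖(truncatedIntegral Ω K f x δ - I) + I‖ₑ := by
        rw [sub_add_cancel]
    _ ≤ _ := enorm_add_le _ _
    _ ≤ E₁ * P ^ (1 / s) +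
        (A₁ * P ^ (1 / s) + D * Q ^ (1 / s) + (B * D) ^ (1 / s) * P ^ (1 / s)) := by
        refine add_le_add (hclose.trans (le_of_eq ?_)) hI'
        rw [hE₁]; ring
    _ = (E₁ + A₁ + (B * D) ^ (1 / s)) * P ^ (1 / s) + D * Q ^ (1 / s) := by ring
    _ ≤ A * P ^ (1 / s) + A * Q ^ (1 / s) := by
        gcongr
        · exact le_self_add
        · exact le_add_self
    _ = _ := by ring

/-- Weak type `(s, s)` of the maximal truncated operator. -/
theorem KernelBounds.exists_maxTrunc_weak (hΩ : IsOpen Ω) [IsFiniteMeasure (volume.restrict Ω)]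
    (h : KernelBounds Ω K C w) {s : ℝ} (hs : 1 < s) (B : ℝ≥0) :
    ∃ A : ℝ≥0, ∀ η > 0, ∀ S, LocalOp Ω K s B η S →
      ∀ f, MemLp f (ENNReal.ofReal s) (volume.restrict Ω) → ∀ t > 0,
      ENNReal.ofReal (t ^ s) * volume.restrict Ω {x | ENNReal.ofReal t < maxTrunc Ω K η f x} ≤
        A * ∫⁻ y, ‖f y‖ₑ ^ s ∂(volume.restrict Ω) := by
  obtain ⟨A, hA⟩ := h.exists_cotlar hΩ hs B
  have hs0 : 0 < s := by linarith
  set a : ℝ := 2 * (A + 1) with ha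
  have ha0 : 0 < a := by positivity
  refine ⟨(ENNReal.ofReal (a ^ s)).toNNReal * (1 + B), fun η hη S hS f hf t ht => ?_⟩
  set u : ℝ≥0∞ := ENNReal.ofReal ((t / a) ^ s) with hu
  have hsub : volume.restrict Ω {x | ENNReal.ofReal t < maxTrunc Ω K η f x} ≤
      volume.restrict Ω ({x | u < powMax Ω s f x} ∪ {x | u < powMax Ω s (S f) x}) := by
    refine measure_mono_ae ?_
    filter_upwards [ae_restrict_mem hΩ.measurableSet] with x hx hxt
    by_contra hcon
    have hxt : ENNReal.ofReal t < maxTrunc Ω K η f x := hxt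
    have hcon' : ¬ (u < powMax Ω s f x ∨ u < powMax Ω s (S f) x) := hcon
    rw [not_or, not_lt, not_lt] at hcon'
    have hu' : u ^ (1 / s) = ENNReal.ofReal (t / a) := by
      rw [hu, ENNReal.ofReal_rpow_of_nonneg (by positivity) (by positivity), ← Real.rpow_mul
        (by positivity), mul_one_div_cancel hs0.ne', Real.rpow_one]
    have h1 := hA η hη S hS f hf x hx
    have h2 : maxTrunc Ω K η f x ≤ ENNReal.ofReal t := by
      refine h1.trans ?_
      calc _ ≤ (A : ℝ≥0∞) * (u ^ (1 / s) + u ^ (1 / s)) := by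
            gcongr
            · exact hcon'.1
            · exact hcon'.2
        _ = ENNReal.ofReal (A * (t / a + t / a)) := by
            rw [hu', ← ENNReal.ofReal_add (by positivity) (by positivity),
              ENNReal.ofReal_mul (by positivity), ENNReal.ofReal_coe_nnreal]
        _ ≤ ENNReal.ofReal t := by
            refine ENNReal.ofReal_le_ofReal ?_
            have : (A : ℝ) * (t / a + t / a) = (A / (A + 1)) * t := by rw [ha]; field_simp; ring
            rw [this]
            have h3 : (A : ℝ) / (A + 1) ≤ 1 := by
              rw [div_le_one (by positivity)]; linarith
            nlinarith
    exact absurd hxt (not_lt.2 h2)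
  have hts : ENNReal.ofReal (t ^ s) = ENNReal.ofReal (a ^ s) * u := by
    rw [hu, ← ENNReal.ofReal_mul (by positivity), ← Real.mul_rpow (by positivity) (by positivity)]
    congr 2; field_simp
  rw [ENNReal.coe_mul, ENNReal.coe_toNNReal ENNReal.ofReal_ne_top, hts, mul_assoc, mul_assoc]
  gcongr ENNReal.ofReal (a ^ s) * ?_
  calc u * volume.restrict Ω {x | ENNReal.ofReal t < maxTrunc Ω K η f x}
      ≤ u * (volume.restrict Ω {x | u < powMax Ω s f x} +
          volume.restrict Ω {x | u < powMax Ω s (S f) x}) := by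
        gcongr
        exact hsub.trans (measure_union_le _ _)
    _ ≤ ∫⁻ y, ‖f y‖ₑ ^ s ∂(volume.restrict Ω) + ∫⁻ y, ‖S f y‖ₑ ^ s ∂(volume.restrict Ω) := by
        rw [mul_add]
        exact add_le_add (mul_measure_lt_enlMax_le _ _) (mul_measure_lt_enlMax_le _ _)
    _ ≤ ∫⁻ y, ‖f y‖ₑ ^ s ∂(volume.restrict Ω) + B * ∫⁻ y, ‖f y‖ₑ ^ s ∂(volume.restrict Ω) := by
        gcongr
        exact hS.lintegral_le f hf
    _ = _ := by push_cast; ring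

end

/-! ### The good-`λ` inequality for the maximal truncated operator -/

section

variable {n : ℕ} {Ω : Set (EuclideanSpace ℝ (Fin n))}
  {K : EuclideanSpace ℝ (Fin n) → EuclideanSpace ℝ (Fin n) → ℝ} {C : ℝ} {w : ℝ → ℝ}

/-- The part of `f` away from a small ball `B` around `x`: its truncations at points of `B` are
compared with a truncation of `f` at a point `z` at distance at most `2 d`. The scales between the
radius of `B` and `d` form a steep chain and so cost only a multiple of the maximal function. -/
theorem KernelBounds.exists_enorm_truncatedIntegral_far_le (hΩ : IsOpen Ω)
    (h : KernelBounds Ω K C w) :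
    ∃ A : ℝ≥0, ∀ x ∈ Ω, ∀ d > 0, ∀ z ∈ Ω, ‖z - x‖ ≤ 2 * d → ∀ k, SteepScales Ω x d k →
      ∀ u ∈ Ω, u ∈ Metric.ball x (d / 20 ^ (k + 1)) → ∀ δ > 0,
      ∀ f : EuclideanSpace ℝ (Fin n) → ℝ, Integrable f (volume.restrict Ω) → ∀ M : ℝ≥0∞,
      (∀ r ≥ d / 20 ^ (k + 1), ∫⁻ y in Metric.ball x r, ‖f y‖ₑ ∂(volume.restrict Ω) ≤
        M * volume.restrict Ω (Metric.ball x (5 * r))) →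
      ‖truncatedIntegral Ω K ((Metric.ball x (4 * (d / 20 ^ (k + 1))))ᶜ.indicator f) u δ‖ₑ ≤
        ‖truncatedIntegral Ω K f z (max δ d)‖ₑ + A * M := by
  obtain ⟨A, hA⟩ := h.exists_hormander hΩ.measurableSet
  have hC := h.pos
  set v := volume (Metric.ball (0 : EuclideanSpace ℝ (Fin n)) 1) with hv
  have hvfin : v ≠ ∞ := measure_ball_lt_top.ne
  set L := max C 2 with hL
  have hL2 : 2 ≤ L := le_max_right _ _
  set c₅ : ℝ≥0∞ := ENNReal.ofReal (5 ^ n) * v with hc₅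
  have hc₅fin : c₅ ≠ ∞ := by finiteness
  set A' : ℝ≥0∞ := A * c₅ + A * c₅ + (ENNReal.ofReal (C * 2 ^ n * (4 * 400 ^ n)) * v +
    (ENNReal.ofReal (C * 2 ^ n * 20 ^ n) * c₅ +
    ENNReal.ofReal (C * 2 ^ n * (8 * L) ^ n) * c₅)) + ENNReal.ofReal (C * (4 * L) ^ n) * c₅ with hA'
  have hA'fin : A' ≠ ∞ := by finiteness
  refine ⟨A'.toNNReal, fun x hx d hd z hz hzx k hk u hu hux δ hδ f hf M hM => ?_⟩
  rw [ENNReal.coe_toNNReal hA'fin]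
  set ρ := d / 20 ^ (k + 1) with hρ
  have hρ0 : 0 < ρ := by positivity
  have hρk : d / 20 ^ k = 20 * ρ := by rw [hρ, pow_succ]; field_simp
  have hρd : 20 * ρ ≤ d := by
    rw [← hρk]; exact div_le_self hd.le (one_le_pow₀ (by norm_num))
  set f₂ := (Metric.ball x (4 * ρ))ᶜ.indicator f with hf₂
  have hf₂i : Integrable f₂ (volume.restrict Ω) :=
    hf.indicator Metric.isOpen_ball.measurableSet.compl
  have hf₂le : ∀ y, ‖f₂ y‖ₑ ≤ ‖f y‖ₑ := fun y => enorm_indicator_le_enorm_self _ _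
  have hM₂ : ∀ r > 0, ∫⁻ y in Metric.ball x r, ‖f₂ y‖ₑ ∂(volume.restrict Ω) ≤
      M * volume.restrict Ω (Metric.ball x (5 * r)) := by
    intro r hr
    rcases le_or_gt ρ r with hle | hlt
    · exact (lintegral_mono hf₂le).trans (hM r hle)
    · have : ∫⁻ y in Metric.ball x r, ‖f₂ y‖ₑ ∂(volume.restrict Ω) = 0 := by
        rw [setLIntegral_congr_fun (g := fun _ => 0) Metric.isOpen_ball.measurableSet]
        · simp
        · intro y hy
          have hy' : y ∈ Metric.ball x (4 * ρ) := Metric.ball_subset_ball (by linarith) hy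
          simp [hf₂, hy', -Metric.mem_ball]
      rw [this]; exact zero_le
  rw [Metric.mem_ball, dist_eq_norm] at hux
  set τ := max δ d with hτ
  have hτδ : δ ≤ τ := le_max_left _ _
  have hτd : d ≤ τ := le_max_right _ _
  have hτ0 : 0 < τ := hd.trans_le hτd
  have hux2 : ∀ y, ‖x - y‖ ≤ ‖u - y‖ + ρ := fun y => by
    have := norm_sub_le_norm_sub_add_norm_sub x u y
    rw [norm_sub_rev x u] at this
    linarith
  have hux3 : ∀ y, ‖u - y‖ ≤ ‖x - y‖ + ρ := fun y => by
    have := norm_sub_le_norm_sub_add_norm_sub u x y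
    linarith
  have hzx2 : ∀ y, ‖x - y‖ ≤ ‖z - y‖ + 2 * d := fun y => by
    have := norm_sub_le_norm_sub_add_norm_sub x z y
    rw [norm_sub_rev x z] at this
    linarith
  set G : Set (EuclideanSpace ℝ (Fin n)) := {y | 3 * L * τ < ‖x - y‖} with hG
  have hGm : MeasurableSet G := measurableSet_lt_norm_sub _ x
  have hLτ : 6 * τ ≤ 3 * L * τ := by nlinarith
  have hG6 : ∀ y ∈ G, 6 * τ < ‖x - y‖ := fun y hy => lt_of_le_of_lt hLτ hy
  have hGu : ∀ y ∈ G, δ < ‖u - y‖ := fun y hy => by have := hG6 y hy; have := hux2 y; linarith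
  have hGz : ∀ y ∈ G, τ < ‖z - y‖ := fun y hy => by have := hG6 y hy; have := hzx2 y; linarith
  have hGx : ∀ y ∈ G, τ < ‖x - y‖ := fun y hy => by have := hG6 y hy; linarith
  have hf₂eq : ∀ y, 4 * ρ ≤ ‖x - y‖ → f₂ y = f y := fun y hy => by
    refine indicator_of_mem ?_ _
    rw [mem_compl_iff, Metric.mem_ball, dist_comm, dist_eq_norm, not_lt]; exact hy
  have hf₂zero : ∀ y, ‖x - y‖ < 4 * ρ → f₂ y = 0 := fun y hy => by
    refine indicator_of_notMem ?_ _
    rw [mem_compl_iff, Metric.mem_ball, dist_comm, dist_eq_norm, not_not]; exact hy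
  -- the integrands of the two truncations; both are compared with `hc`, which has its pole at `x`
  set h₁ : EuclideanSpace ℝ (Fin n) → ℝ := fun y => truncKernel K δ u y * f₂ y with hh₁
  set h₂ : EuclideanSpace ℝ (Fin n) → ℝ := fun y => truncKernel K τ z y * f y with hh₂
  set hc : EuclideanSpace ℝ (Fin n) → ℝ := fun y => truncKernel K τ x y * f₂ y with hhc
  have hi₁ : Integrable h₁ (volume.restrict Ω) := h.integrable_truncKernel_mul hΩ hδ hu hf₂i
  have hi₂ : Integrable h₂ (volume.restrict Ω) := h.integrable_truncKernel_mul hΩ hτ0 hz hf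
  have hic : Integrable hc (volume.restrict Ω) := h.integrable_truncKernel_mul hΩ hτ0 hx hf₂i
  have hmain : ∫⁻ y, ‖h₁ y - h₂ y‖ₑ ∂(volume.restrict Ω) ≤
      ∫⁻ y in G, ‖h₁ y - hc y‖ₑ ∂(volume.restrict Ω) +
      ∫⁻ y in G, ‖h₂ y - hc y‖ₑ ∂(volume.restrict Ω) +
      ∫⁻ y in Gᶜ, ‖h₁ y‖ₑ ∂(volume.restrict Ω) + ∫⁻ y in Gᶜ, ‖h₂ y‖ₑ ∂(volume.restrict Ω) := by
    rw [← lintegral_add_compl _ hGm, add_assoc (_ + _)]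
    refine add_le_add ?_ ?_
    · have hm : AEMeasurable (fun y => ‖h₁ y - hc y‖ₑ) (volume.restrict Ω) :=
        (hi₁.sub hic).aestronglyMeasurable.enorm
      rw [← lintegral_add_left' hm.restrict]
      refine lintegral_mono fun y => ?_
      have : h₁ y - h₂ y = (h₁ y - hc y) - (h₂ y - hc y) := by ring
      rw [this]; exact enorm_sub_le
    · rw [← lintegral_add_left' hi₁.aestronglyMeasurable.enorm.restrict]
      exact lintegral_mono fun y => enorm_sub_le
  have hg1 : ∫⁻ y in G, ‖h₁ y - hc y‖ₑ ∂(volume.restrict Ω) ≤ A * (c₅ * M) := by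
    refine le_trans ?_ (hA x hx u hu (2 * d) (by linarith) (by linarith) (fun y => ‖f₂ y‖ₑ) (c₅ * M)
      fun r hr => lintegral_ball_le_of_maximal_bound hM₂ hr)
    have hsub : G ⊆ {y | L * (2 * d) < ‖x - y‖} := fun y hy => by
      have hy : 3 * L * τ < ‖x - y‖ := hy
      exact lt_of_le_of_lt (by nlinarith) hy
    refine le_trans (le_of_eq ?_) (lintegral_mono_set hsub)
    refine setLIntegral_congr_fun hGm fun y hy => ?_
    simp only [hh₁, hhc]
    rw [truncKernel_of_lt (hGu y hy), truncKernel_of_lt (hGx y hy), ← sub_mul, enorm_mul]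
  have hg2 : ∫⁻ y in G, ‖h₂ y - hc y‖ₑ ∂(volume.restrict Ω) ≤ A * (c₅ * M) := by
    refine le_trans ?_ (hA x hx z hz (2 * d) (by linarith) hzx (fun y => ‖f₂ y‖ₑ) (c₅ * M)
      fun r hr => lintegral_ball_le_of_maximal_bound hM₂ hr)
    have hsub : G ⊆ {y | L * (2 * d) < ‖x - y‖} := fun y hy => by
      have hy : 3 * L * τ < ‖x - y‖ := hy
      exact lt_of_le_of_lt (by nlinarith) hy
    refine le_trans (le_of_eq ?_) (lintegral_mono_set hsub)
    refine setLIntegral_congr_fun hGm fun y hy => ?_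
    simp only [hh₂, hhc]
    rw [hf₂eq y (by have := hG6 y hy; linarith), truncKernel_of_lt (hGz y hy),
      truncKernel_of_lt (hGx y hy), ← sub_mul, enorm_mul]
  have hfarK : ∀ a > 0, ∀ y ∈ Ω, 2 * ρ < ‖x - y‖ → a ≤ ‖x - y‖ →
      ‖K u y‖ₑ ≤ ENNReal.ofReal (C * 2 ^ n / a ^ n) := by
    intro a ha y hy h2ρ hay
    have hle := h.enorm_le hu hy (a := a / 2) (by positivity) (by have := hux2 y; linarith)
    refine hle.trans (le_of_eq ?_)
    congr 1
    rw [div_pow]; field_simp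
  set Sa : Set (EuclideanSpace ℝ (Fin n)) := {y | d / 20 ^ k < ‖x - y‖ ∧ ‖x - y‖ ≤ d} with hSa
  set Sb : Set (EuclideanSpace ℝ (Fin n)) := {y | 2 * ρ < ‖x - y‖ ∧ ‖x - y‖ ≤ 20 * ρ} with hSb
  set Sc : Set (EuclideanSpace ℝ (Fin n)) :=
    {y | max (τ / 2) (2 * ρ) < ‖x - y‖ ∧ ‖x - y‖ ≤ 3 * L * τ} with hSc
  have hmeas : ∀ a b : ℝ, MeasurableSet {y : EuclideanSpace ℝ (Fin n) | a < ‖x - y‖ ∧ ‖x - y‖ ≤ b} :=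
    fun a b => (measurableSet_lt measurable_const (measurable_norm_sub_left x)).inter
        (measurableSet_le (measurable_norm_sub_left x) measurable_const)
  have hg3 : ∫⁻ y in Gᶜ, ‖h₁ y‖ₑ ∂(volume.restrict Ω) ≤
      ENNReal.ofReal (C * 2 ^ n * (4 * 400 ^ n)) * (v * M) +
      (ENNReal.ofReal (C * 2 ^ n * 20 ^ n) * (c₅ * M) +
        ENNReal.ofReal (C * 2 ^ n * (8 * L) ^ n) * (c₅ * M)) := by
    have hpt : ∀ y ∈ Gᶜ, ‖h₁ y‖ₑ ≤ (Sa ∪ (Sb ∪ Sc)).indicator (fun y => ‖K u y‖ₑ * ‖f₂ y‖ₑ) y := by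
      intro y hy
      have hy : ‖x - y‖ ≤ 3 * L * τ := not_lt.1 hy
      simp only [hh₁]
      rcases lt_or_ge ‖x - y‖ (4 * ρ) with hs | hs
      · rw [hf₂zero y hs]; simp
      rcases lt_or_ge δ ‖u - y‖ with hδu | hδu
      · have hmem : y ∈ Sa ∪ (Sb ∪ Sc) := by
          rcases le_or_gt ‖x - y‖ (20 * ρ) with h20 | h20
          · exact Or.inr (Or.inl ⟨by linarith, h20⟩)
          rcases le_or_gt ‖x - y‖ d with hxd | hxd
          · exact Or.inl ⟨by rw [hρk]; exact h20, hxd⟩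
          · refine Or.inr (Or.inr ⟨max_lt ?_ (by linarith), hy⟩)
            have := hux3 y
            rcases le_total δ d with hδd | hδd
            · rw [hτ, max_eq_right hδd]; linarith
            · rw [hτ, max_eq_left hδd]; linarith
        rw [indicator_of_mem hmem, truncKernel_of_lt hδu, enorm_mul]
      · rw [truncKernel_of_le hδu]; simp
    calc _ ≤ ∫⁻ y in Gᶜ, (Sa ∪ (Sb ∪ Sc)).indicator (fun y => ‖K u y‖ₑ * ‖f₂ y‖ₑ) y
            ∂(volume.restrict Ω) := setLIntegral_mono' hGm.compl hpt
      _ ≤ ∫⁻ y, (Sa ∪ (Sb ∪ Sc)).indicator (fun y => ‖K u y‖ₑ * ‖f₂ y‖ₑ) y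
            ∂(volume.restrict Ω) := setLIntegral_le_lintegral _ _
      _ = ∫⁻ y in Sa ∪ (Sb ∪ Sc), ‖K u y‖ₑ * ‖f₂ y‖ₑ ∂(volume.restrict Ω) :=
          lintegral_indicator ((hmeas _ _).union ((hmeas _ _).union (hmeas _ _))) _
      _ ≤ _ := by
          refine (lintegral_union_le _ _ _).trans (add_le_add ?_
            ((lintegral_union_le _ _ _).trans (add_le_add ?_ ?_)))
          · exact hk.lintegral_le hΩ.measurableSet hd hM₂ (by positivity)
              fun a ha y hy h1 hay => hfarK a ha y hy (by rw [hρk] at h1; linarith) hay.le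
          · have := lintegral_annulus_le hΩ.measurableSet hM₂ (φ := fun y => ‖K u y‖ₑ) (a := 2 * ρ)
              (b := 40 * ρ) (B := C * 2 ^ n) (by positivity) (by positivity) (by positivity)
              (hmeas (2 * ρ) (20 * ρ)) (fun y hy => by linarith [hy.2])
              (fun y hyΩ hy => hfarK _ (by positivity) y hyΩ hy.1 hy.1.le)
            rwa [show 40 * ρ / (2 * ρ) = 20 by field_simp; norm_num] at this
          · have := lintegral_annulus_le hΩ.measurableSet hM₂ (φ := fun y => ‖K u y‖ₑ) (a := τ / 2)
              (b := 4 * L * τ) (B := C * 2 ^ n) (by positivity) (by positivity) (by positivity)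
              (hmeas (max (τ / 2) (2 * ρ)) (3 * L * τ)) (fun y hy => by nlinarith [hy.2])
              (fun y hyΩ hy => hfarK _ (by positivity) y hyΩ ((le_max_right _ _).trans_lt hy.1)
                ((le_max_left _ _).trans hy.1.le))
            rwa [show 4 * L * τ / (τ / 2) = 8 * L by field_simp; norm_num] at this
  have hg4 : ∫⁻ y in Gᶜ, ‖h₂ y‖ₑ ∂(volume.restrict Ω) ≤
      ENNReal.ofReal (C * (4 * L) ^ n) * (c₅ * M) := by
    calc _ ≤ ∫⁻ y in Gᶜ, ‖truncKernel K τ z y‖ₑ * ‖f y‖ₑ ∂(volume.restrict Ω) := by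
          refine lintegral_mono fun y => ?_
          simp only [hh₂]; rw [enorm_mul]
      _ ≤ ENNReal.ofReal (C / τ ^ n) *
          ∫⁻ y in Metric.ball x (4 * L * τ), ‖f y‖ₑ ∂(volume.restrict Ω) := by
          refine lintegral_mul_le_of_subset_ball hΩ.measurableSet hGm.compl (fun y hy => ?_)
            ENNReal.ofReal_ne_top fun y hy _ => ?_
          · have hy : ‖x - y‖ ≤ 3 * L * τ := not_lt.1 hy
            rw [Metric.mem_ball, dist_comm, dist_eq_norm]
            nlinarith
          · rw [← ofReal_norm]
            exact ENNReal.ofReal_le_ofReal (h.norm_truncKernel_le hz hy hτ0)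
      _ ≤ ENNReal.ofReal (C / τ ^ n) * (M * (ENNReal.ofReal ((5 * (4 * L * τ)) ^ n) * v)) := by
          gcongr
          refine (hM _ (by nlinarith)).trans ?_
          gcongr
          exact volume_restrict_ball_le Ω x (by positivity)
      _ = (ENNReal.ofReal (C / τ ^ n) * ENNReal.ofReal ((5 * (4 * L * τ)) ^ n)) * (v * M) := by ring
      _ = (ENNReal.ofReal (C * (4 * L) ^ n) * ENNReal.ofReal (5 ^ n)) * (v * M) := by
          rw [← ENNReal.ofReal_mul (by positivity), ← ENNReal.ofReal_mul (by positivity)]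
          congr 2
          rw [mul_pow 5, mul_pow (4 * L)]
          field_simp
      _ = _ := by rw [hc₅]; ring
  rw [truncatedIntegral_eq, truncatedIntegral_eq]
  have e : ∫ y, h₁ y ∂(volume.restrict Ω) =
      ∫ y, h₂ y ∂(volume.restrict Ω) + ∫ y, (h₁ y - h₂ y) ∂(volume.restrict Ω) := by
    rw [integral_sub hi₁ hi₂]; ring
  calc ‖∫ y, h₁ y ∂(volume.restrict Ω)‖ₑ ≤ ‖∫ y, h₂ y ∂(volume.restrict Ω)‖ₑ +
        ‖∫ y, (h₁ y - h₂ y) ∂(volume.restrict Ω)‖ₑ := by rw [e]; exact enorm_add_le _ _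
    _ ≤ _ := by
      gcongr
      refine (enorm_integral_le_lintegral_enorm _).trans (hmain.trans ?_)
      refine (add_le_add (add_le_add (add_le_add hg1 hg2) hg3) hg4).trans (le_of_eq ?_)
      rw [hA']; ring

/-- The relative distributional inequality between the maximal truncated operator and the maximal
function. Disjoint doubling balls fill a fixed proportion of the level set at `t`; where the maximal
function is small, the weak type bound for the part of `f` near such a ball shows that at most half
of the ball remains in the level set at `(1 + ε) * t`. -/
theorem KernelBounds.exists_good_lambda (hn : 0 < n) (hΩ : IsOpen Ω) (hΩb : Bornology.IsBounded Ω)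
    [IsFiniteMeasure (volume.restrict Ω)] (h : KernelBounds Ω K C w) {s : ℝ} (hs : 1 < s) {B : ℝ≥0}
    (hS : ∀ η > 0, ∃ S, LocalOp Ω K s B η S) {ε : ℝ} (hε : 0 < ε) :
    ∃ γ > 0, ∀ η > 0, ∀ f, MemLp f (ENNReal.ofReal s) (volume.restrict Ω) → ∀ t > 0,
      volume.restrict Ω {x | ENNReal.ofReal ((1 + ε) * t) < maxTrunc Ω K η f x} ≤
        ENNReal.ofReal (1 - 1 / (2 * (2 * 20 ^ n))) *
          volume.restrict Ω {x | ENNReal.ofReal t < maxTrunc Ω K η f x} +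
        volume.restrict Ω {x | ENNReal.ofReal (γ * t) < powMax Ω s f x ^ (1 / s)} := by
  obtain ⟨A₁, hA₁⟩ := h.exists_maxTrunc_weak hΩ hs B
  obtain ⟨A₂, hA₂⟩ := h.exists_enorm_truncatedIntegral_far_le hΩ
  have hs0 : 0 < s := by linarith
  set D : ℝ := 2 * 20 ^ n with hD
  have hD2 : 2 ≤ D := by
    have : (1 : ℝ) ≤ 20 ^ n := one_le_pow₀ (by norm_num)
    linarith
  have hD0 : 0 < D := by linarith
  set κ : ℝ := (1 / (2 * (A₁ + 1) * D)) ^ (1 / s) with hκ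
  have hκ0 : 0 < κ := by positivity
  have hκs : κ ^ s = 1 / (2 * (A₁ + 1) * D) := by
    rw [hκ, ← Real.rpow_mul (by positivity), one_div_mul_cancel hs0.ne', Real.rpow_one]
  set γ : ℝ := min (ε / (2 * (A₂ + 1))) (min (κ * ε / 2) κ) with hγ
  have hγ0 : 0 < γ := by positivity
  have hγ1 : A₂ * γ ≤ ε / 2 := by
    have h1 : γ ≤ ε / (2 * (A₂ + 1)) := min_le_left _ _
    rw [le_div_iff₀ (by positivity)] at h1
    nlinarith [A₂.coe_nonneg]
  have hγ2 : A₁ * D * (2 * γ / ε) ^ s ≤ 1 / 2 := by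
    have h1 : 2 * γ / ε ≤ κ := by
      have : γ ≤ κ * ε / 2 := (min_le_right _ _).trans (min_le_left _ _)
      rw [div_le_iff₀ hε]; linarith
    calc A₁ * D * (2 * γ / ε) ^ s ≤ A₁ * D * κ ^ s := by gcongr
      _ ≤ (A₁ + 1) * D * κ ^ s := by gcongr; linarith
      _ = 1 / 2 := by rw [hκs]; field_simp
  have hγ3 : A₁ * γ ^ s < 1 := by
    have h1 : γ ≤ κ := (min_le_right _ _).trans (min_le_right _ _)
    calc A₁ * γ ^ s ≤ A₁ * κ ^ s := by gcongr
      _ ≤ (A₁ + 1) * D * κ ^ s := by gcongr; nlinarith [A₁.coe_nonneg]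
      _ = 1 / 2 := by rw [hκs]; field_simp
      _ < 1 := by norm_num
  refine ⟨γ, hγ0, fun η hη f hf t ht => ?_⟩
  obtain ⟨S, hS⟩ := hS η hη
  have hfi : Integrable f (volume.restrict Ω) :=
    hf.integrable (by rw [← ENNReal.ofReal_one]; exact ENNReal.ofReal_le_ofReal hs.le)
  set F := maxTrunc Ω K η f with hF
  set g := fun x => powMax Ω s f x ^ (1 / s) with hg
  set m := volume.restrict Ω with hm
  set U : Set (EuclideanSpace ℝ (Fin n)) := Ω ∩ {x | ENNReal.ofReal t < F x} with hU
  have hUo : IsOpen U := h.isOpen_lt_maxTrunc hn hΩ hη hfi _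
  have hmU : m {x | ENNReal.ofReal t < F x} = m U := by
    refine measure_congr ?_
    filter_upwards [ae_restrict_mem hΩ.measurableSet] with x hx
    exact propext ⟨fun hxt => ⟨hx, hxt⟩, fun hxt => hxt.2⟩
  -- a point where the maximal function is small controls `∫ |f| ^ s` over the balls containing it
  have hgs : ∀ x₀ z r, g x₀ ≤ ENNReal.ofReal (γ * t) → x₀ ∈ Metric.ball z r →
      ∫⁻ y in Metric.ball z r, ‖f y‖ₑ ^ s ∂m ≤
        ENNReal.ofReal ((γ * t) ^ s) * m (Metric.ball z (5 * r)) := by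
    intro x₀ z r hx₀ hr
    refine (lintegral_ball_le_enlMax _ hr).trans ?_
    gcongr
    rw [← ENNReal.ofReal_rpow_of_nonneg (by positivity) hs0.le]
    have : enlMax m (fun y => ‖f y‖ₑ ^ s) x₀ = g x₀ ^ s := by
      rw [hg]
      simp only [powMax]
      rw [← ENNReal.rpow_mul, one_div_mul_cancel hs0.ne', ENNReal.rpow_one]
    rw [this]
    gcongr
  by_cases hZ : (Ω \ U).Nonempty
  swap
  · -- the level set is all of `Ω`, so by the weak type bound the maximal function is large
    have hΩU : Ω ⊆ U := by
      rw [not_nonempty_iff_eq_empty, sdiff_eq_empty] at hZ; exact hZ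
    refine le_add_left ?_
    refine measure_mono_ae ?_
    filter_upwards [ae_restrict_mem hΩ.measurableSet] with x hx _
    change ENNReal.ofReal (γ * t) < g x
    by_contra hcon
    rw [not_lt] at hcon
    obtain ⟨r, hr0, hr⟩ := hΩb.subset_ball_lt 0 x
    have hw := hA₁ η hη S hS f hf t ht
    have hmall : m (Metric.ball x (5 * r)) = m Ω := by
      rw [hm, Measure.restrict_apply Metric.isOpen_ball.measurableSet, Measure.restrict_apply_self,
        inter_eq_right.2 (hr.trans (Metric.ball_subset_ball (by linarith)))]
    have hint : ∫⁻ y, ‖f y‖ₑ ^ s ∂m ≤ ENNReal.ofReal ((γ * t) ^ s) * m Ω := by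
      rw [← hmall]
      refine le_trans (le_of_eq ?_) (hgs x x r hcon (hr hx))
      rw [hm, Measure.restrict_restrict Metric.isOpen_ball.measurableSet,
        inter_eq_right.2 hr]
    have hmΩ : m {x | ENNReal.ofReal t < F x} = m Ω := by
      rw [hmU]
      exact le_antisymm (measure_mono inter_subset_left) (measure_mono hΩU)
    rw [hmΩ] at hw
    have hmpos : m Ω ≠ 0 := by
      have := measure_ball_pos_of_mem hΩ hx (r := 5 * r) (by linarith)
      rw [← hm, hmall] at this; exact this.ne'
    have h2 : ENNReal.ofReal (t ^ s) * m Ω ≤ ENNReal.ofReal (A₁ * (γ * t) ^ s) * m Ω := by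
      refine hw.trans ?_
      rw [ENNReal.ofReal_mul (by positivity), ENNReal.ofReal_coe_nnreal, mul_assoc]
      gcongr
    have h3 := (ENNReal.mul_le_mul_iff_left hmpos (measure_ne_top _ _)).1 h2
    rw [ENNReal.ofReal_le_ofReal_iff (by positivity), Real.mul_rpow hγ0.le ht.le] at h3
    have : 0 < t ^ s := by positivity
    nlinarith
  -- around each `x ∈ U` a doubling ball of radius `ρ x`, reached by a steep chain from the distance
  -- `d x` to the complement of `U`, so that the ball is contained in `U`
  obtain ⟨z₀, hz₀⟩ := hZ
  set d : EuclideanSpace ℝ (Fin n) → ℝ := fun x => Metric.infDist x (Ω \ U) with hd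
  have hdpos : ∀ x ∈ U, 0 < d x := by
    intro x hx
    refine (Metric.infDist_pos_iff_notMem_closure ⟨z₀, hz₀⟩).1 fun hcl => ?_
    obtain ⟨y, hyU, hy⟩ := mem_closure_iff.1 hcl U hUo hx
    exact hy.2 hyU
  have hdball : ∀ x ∈ U, Metric.ball x (d x) ∩ Ω ⊆ U := by
    rintro x hx y ⟨hy, hyΩ⟩
    by_contra hyU
    have := Metric.infDist_le_dist_of_mem (x := x) (show y ∈ Ω \ U from ⟨hyΩ, hyU⟩)
    rw [Metric.mem_ball, dist_comm] at hy
    exact absurd hy (not_lt.2 this)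
  have hk : ∀ x, ∃ k, x ∈ U → SteepScales Ω x (d x) k ∧ m (Metric.ball x (d x / 20 ^ k)) ≤
      ENNReal.ofReal D * m (Metric.ball x (d x / 20 ^ (k + 1))) := by
    intro x
    by_cases hx : x ∈ U
    · obtain ⟨k, hk⟩ := exists_steepScales_down hΩ hx.1 (hdpos x hx)
      exact ⟨k, fun _ => hk⟩
    · exact ⟨0, fun hx' => absurd hx' hx⟩
  choose k hk using hk
  set ρ : EuclideanSpace ℝ (Fin n) → ℝ := fun x => d x / 20 ^ (k x + 1) with hρ
  have hρ0 : ∀ x ∈ U, 0 < ρ x := fun x hx => div_pos (hdpos x hx) (by positivity)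
  have hρd : ∀ x ∈ U, ρ x ≤ d x := fun x hx =>
    div_le_self (hdpos x hx).le (one_le_pow₀ (by norm_num))
  have hρk : ∀ x, d x / 20 ^ (k x) = 20 * ρ x := fun x => by
    simp only [hρ]; rw [pow_succ]; field_simp
  have hdoub : ∀ x ∈ U, m (Metric.ball x (20 * ρ x)) ≤ ENNReal.ofReal D * m (Metric.ball x (ρ x)) :=
    fun x hx => by rw [← hρk]; exact (hk x hx).2
  obtain ⟨V, hVU, hdisj, hcov⟩ := Vitali.exists_disjoint_subfamily_covering_enlargement_closedBall
    U id ρ (Metric.diam Ω) (fun x hx => (hρd x hx).trans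
      ((Metric.infDist_le_dist_of_mem hz₀).trans (Metric.dist_le_diam_of_mem hΩb hx.1 hz₀.1)))
    4 (by norm_num)
  have hcount : V.Countable := by
    refine hdisj.countable_of_nonempty_interior fun b hb => ?_
    exact ⟨b, interior_mono Metric.ball_subset_closedBall
      (by rw [Metric.isOpen_ball.interior_eq]; exact Metric.mem_ball_self (hρ0 b (hVU hb)))⟩
  have hdisj' : V.PairwiseDisjoint fun b => Metric.ball b (ρ b) :=
    hdisj.mono fun b => Metric.ball_subset_closedBall
  set W : Set (EuclideanSpace ℝ (Fin n)) := ⋃ b ∈ V, Metric.ball b (ρ b) with hW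
  have hWm : MeasurableSet W :=
    (isOpen_biUnion fun b _ => Metric.isOpen_ball).measurableSet
  have hmW : m W = ∑' b : V, m (Metric.ball b.1 (ρ b.1)) :=
    measure_biUnion hcount hdisj' fun b _ => Metric.isOpen_ball.measurableSet
  have hUW : m U ≤ ENNReal.ofReal D * m W := by
    have hsub : U ⊆ ⋃ b ∈ V, Metric.ball b (20 * ρ b) := by
      intro x hx
      obtain ⟨b, hb, hxb⟩ := hcov x hx
      refine mem_biUnion hb (Metric.closedBall_subset_ball ?_
        (hxb (Metric.mem_closedBall_self (hρ0 x hx).le)))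
      have := hρ0 b (hVU hb)
      linarith
    calc m U ≤ ∑' b : V, m (Metric.ball b.1 (20 * ρ b.1)) :=
          (measure_mono hsub).trans (measure_biUnion_le m hcount _)
      _ ≤ ∑' b : V, ENNReal.ofReal D * m (Metric.ball b.1 (ρ b.1)) :=
          ENNReal.tsum_le_tsum fun b => hdoub b.1 (hVU b.2)
      _ = _ := by rw [ENNReal.tsum_mul_left, hmW]
  have hWU : W ∩ Ω ⊆ U := by
    rintro x ⟨hxW, hxΩ⟩
    obtain ⟨b, hb, hxb⟩ := mem_iUnion₂.1 hxW
    exact hdball b (hVU hb) ⟨Metric.ball_subset_ball (hρd b (hVU hb)) hxb, hxΩ⟩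
  set E : Set (EuclideanSpace ℝ (Fin n)) :=
    {x | ENNReal.ofReal ((1 + ε) * t) < F x ∧ g x ≤ ENNReal.ofReal (γ * t)} with hE
  -- at most half of each selected ball remains in the level set
  have hEb : ∀ b ∈ V, m (E ∩ Metric.ball b (ρ b)) ≤
      ENNReal.ofReal (1 / 2) * m (Metric.ball b (ρ b)) := by
    intro b hb
    have hbU := hVU hb
    by_cases hne : ∃ x₀ ∈ Metric.ball b (ρ b), g x₀ ≤ ENNReal.ofReal (γ * t)
    swap
    · have : E ∩ Metric.ball b (ρ b) = ∅ := by
        ext x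
        simp only [mem_inter_iff, mem_empty_iff_false, iff_false, not_and]
        intro hxE hxb
        exact hne ⟨x, hxb, hxE.2⟩
      rw [this]; simp
    obtain ⟨x₀, hx₀b, hx₀⟩ := hne
    have hb0 := hρ0 b hbU
    set f₁ := (Metric.ball b (4 * ρ b)).indicator f with hf₁
    set f₂ := (Metric.ball b (4 * ρ b))ᶜ.indicator f with hf₂
    have hf₁m : MemLp f₁ (ENNReal.ofReal s) m := hf.indicator Metric.isOpen_ball.measurableSet
    have hf₁i : Integrable f₁ m := hfi.indicator Metric.isOpen_ball.measurableSet
    have hf₂i : Integrable f₂ m := hfi.indicator Metric.isOpen_ball.measurableSet.compl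
    have hff : f = f₁ + f₂ := (indicator_self_add_compl _ _).symm
    -- at the point `z` just outside `U` the maximal truncated operator is at most `t`, which controls
    -- the contribution of `f₂` on the ball
    obtain ⟨z, hz, hzd⟩ := (Metric.infDist_lt_iff (x := b) ⟨z₀, hz₀⟩).1
      (show Metric.infDist b (Ω \ U) < 2 * d b by have := hdpos b hbU; simp only [hd] at this ⊢; linarith)
    have hFz : F z ≤ ENNReal.ofReal t := not_lt.1 fun hcon => hz.2 ⟨hz.1, hcon⟩
    have hM : ∀ r ≥ ρ b, ∫⁻ y in Metric.ball b r, ‖f y‖ₑ ∂m ≤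
        ENNReal.ofReal (γ * t) * m (Metric.ball b (5 * r)) := by
      intro r hr
      refine (lintegral_ball_le_powMax hf.1 hs.le (Metric.ball_subset_ball hr hx₀b)).trans ?_
      gcongr
    have hfar : ∀ u ∈ Ω, u ∈ Metric.ball b (ρ b) → F u ≤ maxTrunc Ω K η f₁ u +
        ENNReal.ofReal ((1 + ε / 2) * t) := by
      intro u hu hub
      rw [hF]
      conv_lhs => rw [hff]
      refine h.maxTrunc_add_le hΩ hη hu hf₁i hf₂i fun δ hδ => ?_
      refine (hA₂ b hbU.1 (d b) (hdpos b hbU) z hz.1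
        (by rw [← dist_eq_norm, dist_comm]; exact hzd.le) (k b) (hk b hbU).1 u hu hub δ
        (hη.trans_le hδ) f hfi _ hM).trans ?_
      have h1 : ‖truncatedIntegral Ω K f z (max δ (d b))‖ₑ ≤ ENNReal.ofReal t :=
        (enorm_truncatedIntegral_le_maxTrunc (hδ.trans (le_max_left _ _)) f z).trans hFz
      calc _ ≤ ENNReal.ofReal t + A₂ * ENNReal.ofReal (γ * t) := by gcongr
        _ = ENNReal.ofReal (t + A₂ * (γ * t)) := by
            rw [ENNReal.ofReal_add ht.le (by positivity),
              ENNReal.ofReal_mul (p := (A₂ : ℝ)) A₂.coe_nonneg, ENNReal.ofReal_coe_nnreal]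
        _ ≤ _ := ENNReal.ofReal_le_ofReal (by nlinarith)
    have hsubE : m (E ∩ Metric.ball b (ρ b)) ≤
        m {x | ENNReal.ofReal (ε / 2 * t) < maxTrunc Ω K η f₁ x} := by
      refine measure_mono_ae ?_
      filter_upwards [ae_restrict_mem hΩ.measurableSet] with u hu huE
      have huE : u ∈ E ∩ Metric.ball b (ρ b) := huE
      have h1 := hfar u hu huE.2
      have h2 : ENNReal.ofReal (ε / 2 * t) + ENNReal.ofReal ((1 + ε / 2) * t) <
          maxTrunc Ω K η f₁ u + ENNReal.ofReal ((1 + ε / 2) * t) := by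
        refine lt_of_lt_of_le ?_ h1
        rw [← ENNReal.ofReal_add (by positivity) (by positivity)]
        convert huE.1.1 using 2
        ring
      exact lt_of_add_lt_add_right h2
    have hwk := hA₁ η hη S hS f₁ hf₁m (ε / 2 * t) (by positivity)
    have hf₁int : ∫⁻ y, ‖f₁ y‖ₑ ^ s ∂m ≤
        ENNReal.ofReal ((γ * t) ^ s) * (ENNReal.ofReal D * m (Metric.ball b (ρ b))) := by
      calc ∫⁻ y, ‖f₁ y‖ₑ ^ s ∂m = ∫⁻ y, (Metric.ball b (4 * ρ b)).indicator (fun y => ‖f y‖ₑ ^ s) y ∂m := by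
            refine lintegral_congr fun y => ?_
            by_cases hy : y ∈ Metric.ball b (4 * ρ b)
            · rw [hf₁, indicator_of_mem hy, indicator_of_mem hy]
            · rw [hf₁, indicator_of_notMem hy, indicator_of_notMem hy]; simp [hs0]
        _ = ∫⁻ y in Metric.ball b (4 * ρ b), ‖f y‖ₑ ^ s ∂m :=
            lintegral_indicator Metric.isOpen_ball.measurableSet _
        _ ≤ _ := by
            refine (hgs x₀ b (4 * ρ b) hx₀ (Metric.ball_subset_ball (by linarith) hx₀b)).trans ?_
            gcongr
            rw [show 5 * (4 * ρ b) = 20 * ρ b by ring]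
            exact hdoub b hbU
    have hpos : 0 < (ε / 2 * t) ^ s := by positivity
    calc m (E ∩ Metric.ball b (ρ b))
        ≤ ENNReal.ofReal (((ε / 2 * t) ^ s)⁻¹) * (ENNReal.ofReal ((ε / 2 * t) ^ s) *
          m {x | ENNReal.ofReal (ε / 2 * t) < maxTrunc Ω K η f₁ x}) := by
          rw [← mul_assoc, ← ENNReal.ofReal_mul (by positivity), inv_mul_cancel₀ hpos.ne',
            ENNReal.ofReal_one, one_mul]
          exact hsubE
      _ ≤ ENNReal.ofReal (((ε / 2 * t) ^ s)⁻¹) * (A₁ * (ENNReal.ofReal ((γ * t) ^ s) *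
          (ENNReal.ofReal D * m (Metric.ball b (ρ b))))) := by
          exact mul_le_mul_right (hwk.trans (mul_le_mul_right hf₁int _)) _
      _ = ENNReal.ofReal (A₁ * D * (2 * γ / ε) ^ s) * m (Metric.ball b (ρ b)) := by
          rw [← ENNReal.ofReal_coe_nnreal (p := A₁), ← mul_assoc, ← mul_assoc, ← mul_assoc,
            ← ENNReal.ofReal_mul (by positivity), ← ENNReal.ofReal_mul (by positivity),
            ← ENNReal.ofReal_mul (by positivity)]
          congr 2
          have : γ * t = (2 * γ / ε) * (ε / 2 * t) := by field_simp
          rw [this, Real.mul_rpow (x := 2 * γ / ε) (y := ε / 2 * t) (by positivity) (by positivity)]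
          generalize (ε / 2 * t) ^ s = X at hpos
          field_simp
      _ ≤ _ := by gcongr
  have hEW : m (E ∩ W) ≤ ENNReal.ofReal (1 / 2) * m W := by
    calc m (E ∩ W) = m (⋃ b ∈ V, E ∩ Metric.ball b (ρ b)) := by rw [hW, inter_iUnion₂]
      _ ≤ ∑' b : V, m (E ∩ Metric.ball b.1 (ρ b.1)) := measure_biUnion_le m hcount _
      _ ≤ ∑' b : V, ENNReal.ofReal (1 / 2) * m (Metric.ball b.1 (ρ b.1)) :=
          ENNReal.tsum_le_tsum fun b => hEb b.1 b.2
      _ = _ := by rw [ENNReal.tsum_mul_left, hmW]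
  -- up to null sets, `E` and `W` lie in `U`
  have hEU : m (E \ W) + m W ≤ m U := by
    have h1 : m (E \ W) ≤ m (U \ W) := by
      refine measure_mono_ae ?_
      filter_upwards [ae_restrict_mem hΩ.measurableSet] with u hu huE
      have huE : u ∈ E \ W := huE
      refine ⟨⟨hu, lt_of_le_of_lt (ENNReal.ofReal_le_ofReal ?_) huE.1.1⟩, huE.2⟩
      nlinarith
    have h2 : m W ≤ m (U ∩ W) := by
      refine measure_mono_ae ?_
      filter_upwards [ae_restrict_mem hΩ.measurableSet] with u hu huW
      exact ⟨hWU ⟨huW, hu⟩, huW⟩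
    calc m (E \ W) + m W ≤ m (U \ W) + m (U ∩ W) := add_le_add h1 h2
      _ = m U := by rw [add_comm, measure_inter_add_sdiff U hWm]
  have hfinal : m E ≤ ENNReal.ofReal (1 - 1 / (2 * D)) * m U := by
    have hUfin : m U ≠ ∞ := measure_ne_top _ _
    have hWfin : m W ≠ ∞ := measure_ne_top _ _
    have hEfin : m E ≠ ∞ := measure_ne_top _ _
    have hE1 : m E ≤ ENNReal.ofReal (1 / 2) * m W + m (E \ W) := by
      rw [← measure_inter_add_sdiff E hWm]; gcongr
    have r1 := ENNReal.toReal_mono (by finiteness) hE1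
    have r2 := ENNReal.toReal_mono hUfin hEU
    have r3 := ENNReal.toReal_mono (by finiteness) hUW
    rw [ENNReal.toReal_add (by finiteness) (by finiteness), ENNReal.toReal_mul,
      ENNReal.toReal_ofReal (by norm_num)] at r1
    rw [ENNReal.toReal_add (by finiteness) (by finiteness)] at r2
    rw [ENNReal.toReal_mul, ENNReal.toReal_ofReal hD0.le] at r3
    have hnn : 0 ≤ 1 - 1 / (2 * D) := by
      rw [sub_nonneg, div_le_one (by positivity)]; linarith
    rw [← ENNReal.toReal_le_toReal hEfin (by finiteness), ENNReal.toReal_mul,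
      ENNReal.toReal_ofReal hnn]
    have r4 : (m U).toReal / D ≤ (m W).toReal := by
      rw [div_le_iff₀ hD0]; linarith
    have e : (1 - 1 / (2 * D)) * (m U).toReal = (m U).toReal - (m U).toReal / D / 2 := by
      field_simp
    rw [e]
    linarith
  rw [hmU]
  calc m {x | ENNReal.ofReal ((1 + ε) * t) < F x}
      ≤ m (E ∪ {x | ENNReal.ofReal (γ * t) < g x}) := by
        refine measure_mono fun x hx => ?_
        rcases le_or_gt (g x) (ENNReal.ofReal (γ * t)) with h1 | h1
        · exact Or.inl ⟨hx, h1⟩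
        · exact Or.inr h1
    _ ≤ m E + m {x | ENNReal.ofReal (γ * t) < g x} := measure_union_le _ _
    _ ≤ _ := by gcongr

/-- A bound for the maximal truncated operator on `L ^ q` for all `q > s`, uniform on compact sets
of exponents, from a bound on `L ^ s` of the operators `S`. -/
theorem KernelBounds.exists_maxTrunc_strong (hn : 0 < n) (hΩ : IsOpen Ω)
    (hΩb : Bornology.IsBounded Ω)
    [IsFiniteMeasure (volume.restrict Ω)] (h : KernelBounds Ω K C w) {s : ℝ} (hs : 1 < s) {B : ℝ≥0}
    (hS : ∀ η > 0, ∃ S, LocalOp Ω K s B η S) {q₀ q₁ : ℝ} (hq₀ : s < q₀) (hq₁ : q₀ ≤ q₁) :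
    ∃ A : ℝ≥0, ∀ q ∈ Icc q₀ q₁, ∀ η > 0, ∀ f, MemLp f (ENNReal.ofReal q) (volume.restrict Ω) →
      ∫⁻ x, maxTrunc Ω K η f x ^ q ∂(volume.restrict Ω) ≤
        A * ∫⁻ x, ‖f x‖ₑ ^ q ∂(volume.restrict Ω) := by
  have hs0 : 0 < s := by linarith
  have hq1s : 0 < q₁ := by linarith
  have hC := h.pos
  set θ : ℝ := 1 - 1 / (2 * (2 * 20 ^ n)) with hθ
  have h20 : (1 : ℝ) ≤ 20 ^ n := one_le_pow₀ (by norm_num)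
  have hθ1 : θ < 1 := by
    have : (0 : ℝ) < 1 / (2 * (2 * 20 ^ n)) := by positivity
    linarith
  have hθ0 : 0 < θ := by
    have : (1 : ℝ) / (2 * (2 * 20 ^ n)) < 1 := by
      rw [div_lt_one (by positivity)]; linarith
    linarith
  set σ : ℝ := (1 + θ) / 2 with hσ
  have hσ1 : σ < 1 := by linarith
  have hσ0 : 0 < σ := by linarith
  -- the factor `H > 1` is chosen so that `θ * H ^ q₁ = σ < 1`
  set H : ℝ := (σ / θ) ^ (1 / q₁) with hH
  have hσθ : 1 < σ / θ := by rw [one_lt_div hθ0]; linarith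
  have hH1 : 1 < H := Real.one_lt_rpow hσθ (by positivity)
  have hHq : H ^ q₁ = σ / θ := by
    rw [hH, ← Real.rpow_mul (by positivity), one_div_mul_cancel hq1s.ne', Real.rpow_one]
  obtain ⟨γ₁, hγ₁, hgood⟩ := h.exists_good_lambda hn hΩ hΩb hs hS (ε := H - 1) (by linarith)
  set γ := min γ₁ 1 with hγ
  have hγ0 : 0 < γ := by positivity
  have hγle1 : γ ≤ 1 := min_le_right _ _
  set A : ℝ := (σ / θ / (1 - σ) / γ ^ q₁) * ((q₁ / s) / (q₀ / s - 1) * 2 ^ (q₁ / s)) with hA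
  have hq0s : 0 < q₀ / s - 1 := by rw [sub_pos, one_lt_div hs0]; exact hq₀
  have h1σ : 0 < 1 - σ := by linarith
  have hA0 : 0 ≤ A := by positivity
  refine ⟨A.toNNReal, fun q hq η hη f hf => ?_⟩
  have hqs : s < q := hq₀.trans_le hq.1
  have hq0 : 0 < q := by linarith
  have hfs : MemLp f (ENNReal.ofReal s) (volume.restrict Ω) :=
    hf.mono_exponent (ENNReal.ofReal_le_ofReal hqs.le)
  have hfi : Integrable f (volume.restrict Ω) :=
    hf.integrable (by rw [← ENNReal.ofReal_one]; exact ENNReal.ofReal_le_ofReal (by linarith))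
  have hbd : ∀ᵐ x ∂(volume.restrict Ω), maxTrunc Ω K η f x ≤
      ENNReal.ofReal (C / η ^ n) * ∫⁻ y, ‖f y‖ₑ ∂(volume.restrict Ω) := by
    filter_upwards [ae_restrict_mem hΩ.measurableSet] with x hx
    exact h.maxTrunc_le hΩ hη hx f
  have hbfin : ENNReal.ofReal (C / η ^ n) * ∫⁻ y, ‖f y‖ₑ ∂(volume.restrict Ω) < ∞ :=
    ENNReal.mul_lt_top ENNReal.ofReal_lt_top hfi.2
  have hint : ∫⁻ x, maxTrunc Ω K η f x ^ q ∂(volume.restrict Ω) < ∞ := by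
    calc _ ≤ ∫⁻ x, (ENNReal.ofReal (C / η ^ n) * ∫⁻ y, ‖f y‖ₑ ∂(volume.restrict Ω)) ^ q
          ∂(volume.restrict Ω) := by
          refine lintegral_mono_ae ?_
          filter_upwards [hbd] with x hx
          gcongr
      _ < ∞ := by
          rw [lintegral_const]
          exact ENNReal.mul_lt_top (ENNReal.rpow_lt_top_of_nonneg hq0.le hbfin.ne)
            (measure_lt_top _ _)
  have hgl := lintegral_rpow_le_of_good_lambda (volume.restrict Ω)
    (h.aemeasurable_maxTrunc hn hΩ hη hfi)
    (G := fun x => powMax Ω s f x ^ (1 / s)) ((measurable_enlMax _).pow_const _).aemeasurable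
    (by filter_upwards [hbd] with x hx; exact hx.trans_lt hbfin)
    (q := q) (H := H) (κ := θ) (γ := γ) (ρ := σ) hq0 (by linarith) hγ0 hσ0.le hσ1
    (by
      calc θ * H ^ q ≤ θ * H ^ q₁ := by
            gcongr
            · exact hH1.le
            · exact hq.2
        _ = σ := by rw [hHq]; field_simp) hint
    (by
      intro t ht
      have := hgood η hη f hfs t ht
      rw [show 1 + (H - 1) = H by ring] at this
      refine this.trans (add_le_add le_rfl (measure_mono fun x hx => ?_))
      have hx : ENNReal.ofReal (γ₁ * t) < powMax Ω s f x ^ (1 / s) := hx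
      refine lt_of_le_of_lt (b := ENNReal.ofReal (γ₁ * t)) ?_ hx
      exact ENNReal.ofReal_le_ofReal (by gcongr; exact min_le_left _ _))
  have hr1 : 1 < q / s := by rw [one_lt_div hs0]; exact hqs
  have hmax := lintegral_enlMax_rpow_le (μ := volume.restrict Ω) (g := fun y => ‖f y‖ₑ ^ s)
    (hf.1.enorm.pow_const s) (r := q / s) hr1
  have e1 : ∀ x, (powMax Ω s f x ^ (1 / s)) ^ q =
      enlMax (volume.restrict Ω) (fun y => ‖f y‖ₑ ^ s) x ^ (q / s) := fun x => by
    rw [← ENNReal.rpow_mul, powMax]; congr 1; ring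
  have e2 : ∀ x, (‖f x‖ₑ ^ s) ^ (q / s) = ‖f x‖ₑ ^ q := fun x => by
    rw [← ENNReal.rpow_mul]; congr 1; field_simp
  simp only [e2] at hmax
  simp only [e1] at hgl
  refine hgl.trans ((mul_le_mul_right hmax _).trans ?_)
  rw [← mul_assoc, ← ENNReal.ofReal_mul (by positivity)]
  refine mul_le_mul_left (ENNReal.ofReal_le_ofReal ?_) _
  rw [hA]
  have hHle : H ^ q ≤ σ / θ := by
    rw [← hHq]; exact Real.rpow_le_rpow_of_exponent_le hH1.le hq.2
  have hγle : γ ^ q₁ ≤ γ ^ q := Real.rpow_le_rpow_of_exponent_ge hγ0 hγle1 hq.2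
  have hrs : 0 < q / s - 1 := by linarith
  have hle0 := hq.1
  have hle1 := hq.2
  gcongr
  norm_num

end

/-! ### Principal values and boundedness on `L ^ q` -/

section

variable {n : ℕ} {Ω : Set (EuclideanSpace ℝ (Fin n))}
  {K : EuclideanSpace ℝ (Fin n) → EuclideanSpace ℝ (Fin n) → ℝ} {C : ℝ} {w : ℝ → ℝ}

theorem PVExistsAt.tendsto {f : EuclideanSpace ℝ (Fin n) → ℝ} {x : EuclideanSpace ℝ (Fin n)}
    (h : PVExistsAt Ω K f x) :
    Tendsto (truncatedIntegral Ω K f x) (𝓝[>] 0) (𝓝 (pvOperator Ω K f x)) :=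
  tendsto_nhds_limUnder h

theorem tendsto_one_div_succ_nhdsGT :
    Tendsto (fun k : ℕ => 1 / ((k : ℝ) + 1)) atTop (𝓝[>] 0) :=
  tendsto_nhdsWithin_iff.2 ⟨tendsto_one_div_add_atTop_nhds_zero_nat,
    Eventually.of_forall fun k => by simp only [mem_Ioi]; positivity⟩

theorem KernelBounds.aestronglyMeasurable_truncatedIntegral (hn : 0 < n) (hΩ : IsOpen Ω)
    (h : KernelBounds Ω K C w) {δ : ℝ} (hδ : 0 < δ) {f : EuclideanSpace ℝ (Fin n) → ℝ}
    (hf : Integrable f (volume.restrict Ω)) :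
    AEStronglyMeasurable (fun x => truncatedIntegral Ω K f x δ) (volume.restrict Ω) :=
  (h.continuousOn_truncatedIntegral hn hΩ hδ hf).aestronglyMeasurable hΩ.measurableSet

theorem KernelBounds.aestronglyMeasurable_pvOperator (hn : 0 < n) (hΩ : IsOpen Ω)
    (h : KernelBounds Ω K C w) {f : EuclideanSpace ℝ (Fin n) → ℝ}
    (hf : Integrable f (volume.restrict Ω))
    (hpv : ∀ᵐ x ∂(volume.restrict Ω), PVExistsAt Ω K f x) :
    AEStronglyMeasurable (pvOperator Ω K f) (volume.restrict Ω) := by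
  refine aestronglyMeasurable_of_tendsto_ae (u := atTop) (f := fun (k : ℕ) x =>
    truncatedIntegral Ω K f x (1 / ((k : ℝ) + 1)))
    (fun k => h.aestronglyMeasurable_truncatedIntegral hn hΩ (by positivity) hf) ?_
  filter_upwards [hpv] with x hx
  exact hx.tendsto.comp tendsto_one_div_succ_nhdsGT

/-- Splitting off the part of `f` far from `y`: all truncations at radii `δ ≤ ρ` act on it through
the full kernel. -/
theorem KernelBounds.truncatedIntegral_eq_add (hΩ : IsOpen Ω) (h : KernelBounds Ω K C w)
    {f : EuclideanSpace ℝ (Fin n) → ℝ} (hf : Integrable f (volume.restrict Ω))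
    {x y : EuclideanSpace ℝ (Fin n)} (hy : y ∈ Ω) {ρ δ : ℝ} (hyx : y ∈ Metric.ball x ρ)
    (hδ : 0 < δ) (hδρ : δ ≤ ρ) :
    truncatedIntegral Ω K f y δ =
      truncatedIntegral Ω K ((Metric.closedBall x (2 * ρ)).indicator f) y δ +
        ∫ z in {z | z ∈ Ω ∧ 2 * ρ < ‖x - z‖}, K y z * f z := by
  have hm : MeasurableSet (Metric.closedBall x (2 * ρ)) := Metric.isClosed_closedBall.measurableSet
  conv_lhs => rw [← indicator_self_add_compl (Metric.closedBall x (2 * ρ)) f]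
  rw [h.truncatedIntegral_add hΩ hδ hy (hf.indicator hm) (hf.indicator hm.compl)]
  congr 1
  rw [truncatedIntegral_eq, setIntegral_lt_norm_sub_eq]
  refine integral_congr_ae (Eventually.of_forall fun z => ?_)
  rw [Metric.mem_ball, dist_eq_norm] at hyx
  by_cases hz : 2 * ρ < ‖x - z‖
  · have h1 : z ∈ (Metric.closedBall x (2 * ρ))ᶜ := by
      rw [mem_compl_iff, Metric.mem_closedBall, dist_comm, dist_eq_norm, not_le]; exact hz
    have h2 : δ < ‖y - z‖ := by
      have := norm_sub_le_norm_sub_add_norm_sub x y z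
      rw [norm_sub_rev x y] at this
      linarith
    simp only [indicator_of_mem h1, truncKernel_of_lt h2]
    exact (indicator_of_mem (s := {z | 2 * ρ < ‖x - z‖}) hz fun z => K y z * f z).symm
  · have h1 : z ∉ (Metric.closedBall x (2 * ρ))ᶜ := by
      rw [mem_compl_iff, Metric.mem_closedBall, dist_comm, dist_eq_norm, not_le]; exact hz
    simp only [indicator_of_notMem h1, mul_zero]
    exact (indicator_of_notMem (s := {z | 2 * ρ < ‖x - z‖}) hz fun z => K y z * f z).symm

theorem KernelBounds.pvOperator_eq_add (hΩ : IsOpen Ω) (h : KernelBounds Ω K C w)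
    {f : EuclideanSpace ℝ (Fin n) → ℝ} (hf : Integrable f (volume.restrict Ω))
    {x y : EuclideanSpace ℝ (Fin n)} (hy : y ∈ Ω) {ρ : ℝ} (hyx : y ∈ Metric.ball x ρ)
    (h1 : PVExistsAt Ω K f y)
    (h2 : PVExistsAt Ω K ((Metric.closedBall x (2 * ρ)).indicator f) y) :
    pvOperator Ω K f y = pvOperator Ω K ((Metric.closedBall x (2 * ρ)).indicator f) y +
        ∫ z in {z | z ∈ Ω ∧ 2 * ρ < ‖x - z‖}, K y z * f z := by
  have hρ := Metric.pos_of_mem_ball hyx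
  refine tendsto_nhds_unique h1.tendsto ((h2.tendsto.add_const _).congr' ?_)
  filter_upwards [Ioc_mem_nhdsGT hρ] with δ hδ
  exact (h.truncatedIntegral_eq_add hΩ hf hy hyx hδ.1 hδ.2).symm

theorem IsCalderonZygmundOperator.exists_localOp (hn : 0 < n) (hΩ : IsOpen Ω)
    [IsFiniteMeasure (volume.restrict Ω)] (hK : IsCalderonZygmundOperator Ω K) :
    ∃ B : ℝ≥0, ∀ η > 0, LocalOp Ω K 2 B η (pvOperator Ω K) := by
  obtain ⟨C, w, h⟩ := hK.kernel.exists_kernelBounds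
  obtain ⟨A, hA⟩ := hK.bounded_L2
  have e2 : ENNReal.ofReal 2 = 2 := by simp
  refine ⟨A ^ 2, fun η hη => ⟨?_, ?_, ?_⟩⟩
  · intro f hf
    rw [e2] at hf
    exact h.aestronglyMeasurable_pvOperator hn hΩ (hf.integrable (by norm_num)) (hK.pv_exists f hf)
  · intro f hf
    rw [e2] at hf
    have := hA f hf
    rw [eLpNorm_eq_lintegral_rpow_enorm_toReal (by norm_num) (by norm_num),
      eLpNorm_eq_lintegral_rpow_enorm_toReal (by norm_num) (by norm_num)] at this
    simp only [ENNReal.toReal_ofNat] at this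
    have h2 := ENNReal.rpow_le_rpow this (z := 2) (by norm_num)
    rw [ENNReal.mul_rpow_of_nonneg _ _ (by norm_num), ← ENNReal.rpow_mul, ← ENNReal.rpow_mul] at h2
    norm_num at h2
    simpa using h2
  · intro f hf x hx ρ hρ
    have hf1 := hf.indicator (s := Metric.closedBall x (2 * ρ))
      Metric.isClosed_closedBall.measurableSet
    rw [e2] at hf hf1
    filter_upwards [hK.pv_exists f hf, hK.pv_exists _ hf1, ae_restrict_mem hΩ.measurableSet]
      with y h1 h2 hy hyx
    exact h.pvOperator_eq_add hΩ (hf.integrable (by norm_num)) hy hyx h1 h2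

/-- The truncated operators are bounded on `L ^ s (Ω)`, uniformly in the truncation radius. -/
def TruncBounded (Ω : Set (EuclideanSpace ℝ (Fin n)))
    (K : EuclideanSpace ℝ (Fin n) → EuclideanSpace ℝ (Fin n) → ℝ) (s : ℝ) (A : ℝ≥0) : Prop :=
  ∀ δ > 0, ∀ f, MemLp f (ENNReal.ofReal s) (volume.restrict Ω) →
    ∫⁻ x, ‖truncatedIntegral Ω K f x δ‖ₑ ^ s ∂(volume.restrict Ω) ≤
      A * ∫⁻ x, ‖f x‖ₑ ^ s ∂(volume.restrict Ω)

theorem integrable_of_memLp_ofReal [IsFiniteMeasure (volume.restrict Ω)] {s : ℝ} (hs : 1 ≤ s)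
    {f : EuclideanSpace ℝ (Fin n) → ℝ} (hf : MemLp f (ENNReal.ofReal s) (volume.restrict Ω)) :
    Integrable f (volume.restrict Ω) :=
  hf.integrable (by rw [← ENNReal.ofReal_one]; exact ENNReal.ofReal_le_ofReal hs)

theorem KernelBounds.localOp_truncatedIntegral (hn : 0 < n) (hΩ : IsOpen Ω)
    [IsFiniteMeasure (volume.restrict Ω)] (h : KernelBounds Ω K C w) {s : ℝ} (hs : 1 ≤ s)
    {A : ℝ≥0} (hA : TruncBounded Ω K s A) {η : ℝ} (hη : 0 < η) :
    LocalOp Ω K s A η (fun f x => truncatedIntegral Ω K f x η) where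
  aestronglyMeasurable f hf :=
    h.aestronglyMeasurable_truncatedIntegral hn hΩ hη (integrable_of_memLp_ofReal hs hf)
  lintegral_le f hf := hA η hη f hf
  split f hf x hx ρ hρ := by
    filter_upwards [ae_restrict_mem hΩ.measurableSet] with y hy hyx
    exact h.truncatedIntegral_eq_add hΩ (integrable_of_memLp_ofReal hs hf) hy hyx hη hρ

theorem KernelBounds.integral_truncatedIntegral_mul (hΩ : IsOpen Ω)
    [IsFiniteMeasure (volume.restrict Ω)] (h : KernelBounds Ω K C w) {δ : ℝ} (hδ : 0 < δ)
    {f g : EuclideanSpace ℝ (Fin n) → ℝ} (hf : Integrable f (volume.restrict Ω))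
    (hg : Integrable g (volume.restrict Ω)) :
    ∫ x, g x * truncatedIntegral Ω K f x δ ∂(volume.restrict Ω) =
      ∫ y, f y * truncatedIntegral Ω (fun x y => K y x) g y δ ∂(volume.restrict Ω) := by
  have hint : Integrable (Function.uncurry fun x y => truncKernel K δ x y * (g x * f y))
      ((volume.restrict Ω).prod (volume.restrict Ω)) := by
    refine (hg.mul_prod hf).bdd_mul (c := C / δ ^ n)
      (h.aestronglyMeasurable_uncurry_truncKernel hΩ hδ) ?_
    have hae : ∀ᵐ p ∂((volume.restrict Ω).prod (volume.restrict Ω)), p ∈ Ω ×ˢ Ω := by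
      rw [Measure.prod_restrict]
      exact ae_restrict_mem (hΩ.measurableSet.prod hΩ.measurableSet)
    filter_upwards [hae] with p hp
    exact h.norm_truncKernel_le hp.1 hp.2 hδ
  have hswap := integral_integral_swap hint
  simp only [truncatedIntegral_eq, ← integral_const_mul]
  refine Eq.trans ?_ (hswap.trans ?_)
  · refine integral_congr_ae (Eventually.of_forall fun x => ?_)
    refine integral_congr_ae (Eventually.of_forall fun y => ?_)
    simp only
    ring
  · refine integral_congr_ae (Eventually.of_forall fun y => ?_)
    refine integral_congr_ae (Eventually.of_forall fun x => ?_)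
    simp only [truncKernel_swap]
    ring

/-- Duality: the truncations of the transposed kernel are the transposes of the truncations. -/
theorem KernelBounds.truncBounded_of_swap (hn : 0 < n) (hΩ : IsOpen Ω)
    [IsFiniteMeasure (volume.restrict Ω)] (h : KernelBounds Ω K C w) {q q' : ℝ}
    (hqq : q.HolderConjugate q') {A : ℝ≥0} (hA : TruncBounded Ω (fun x y => K y x) q' A) :
    TruncBounded Ω K q (A ^ (q - 1)) := by
  intro δ hδ f hf
  have hq1 : 1 < q := hqq.lt
  have hq'1 : 1 < q' := hqq.symm.lt
  have hq0 : 0 < q := by linarith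
  have hq'0 : 0 < q' := by linarith
  have hfi := integrable_of_memLp_ofReal hq1.le hf
  set F : EuclideanSpace ℝ (Fin n) → ℝ := fun x => truncatedIntegral Ω K f x δ with hF
  have hFm : AEStronglyMeasurable F (volume.restrict Ω) :=
    h.aestronglyMeasurable_truncatedIntegral hn hΩ hδ hfi
  obtain ⟨b, hb⟩ : ∃ b : ℝ, ∀ x ∈ Ω, ‖F x‖ ≤ b := by
    have hfin : ENNReal.ofReal (C / δ ^ n) * ∫⁻ y, ‖f y‖ₑ ∂(volume.restrict Ω) ≠ ∞ :=
      ENNReal.mul_ne_top ENNReal.ofReal_ne_top hfi.2.ne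
    refine ⟨(ENNReal.ofReal (C / δ ^ n) * ∫⁻ y, ‖f y‖ₑ ∂(volume.restrict Ω)).toReal,
      fun x hx => ?_⟩
    have := h.enorm_truncatedIntegral_le hΩ hδ hx f
    rw [← ofReal_norm] at this
    exact (ENNReal.ofReal_le_iff_le_toReal hfin).1 this
  set I := ∫⁻ x, ‖F x‖ₑ ^ q ∂(volume.restrict Ω) with hI
  set J := ∫⁻ x, ‖f x‖ₑ ^ q ∂(volume.restrict Ω) with hJ
  have hIfin : I ≠ ∞ := by
    refine ne_of_lt (lt_of_le_of_lt (lintegral_mono_ae (g := fun _ => ENNReal.ofReal b ^ q) ?_) ?_)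
    · filter_upwards [ae_restrict_mem hΩ.measurableSet] with x hx
      gcongr
      rw [← ofReal_norm]
      exact ENNReal.ofReal_le_ofReal (hb x hx)
    · rw [lintegral_const]
      exact ENNReal.mul_lt_top (ENNReal.rpow_lt_top_of_nonneg hq0.le ENNReal.ofReal_ne_top)
        (measure_lt_top _ _)
  -- the extremal function for the pairing with `F`
  set g : EuclideanSpace ℝ (Fin n) → ℝ := fun x => SignType.sign (F x) * |F x| ^ (q - 1) with hg
  have hgenorm : ∀ x, ‖g x‖ₑ = ‖F x‖ₑ ^ (q - 1) ∨ F x = 0 := by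
    intro x
    by_cases hx : F x = 0
    · exact Or.inr hx
    · left
      have : |((SignType.sign (F x) : SignType) : ℝ)| = 1 := by
        rcases lt_or_gt_of_ne hx with h1 | h1
        · simp [sign_neg h1]
        · simp [sign_pos h1]
      rw [hg, Real.enorm_eq_ofReal_abs, abs_mul, this, one_mul,
        abs_of_nonneg (Real.rpow_nonneg (abs_nonneg _) _), Real.enorm_eq_ofReal_abs,
        ENNReal.ofReal_rpow_of_nonneg (abs_nonneg _) (by linarith)]
  have hgpow : ∀ x, ‖g x‖ₑ ^ q' = ‖F x‖ₑ ^ q := by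
    intro x
    rcases hgenorm x with h1 | h1
    · rw [h1, ← ENNReal.rpow_mul, hqq.sub_one_mul_conj]
    · simp [hg, h1, hq0, hq'0]
  have hgm : AEStronglyMeasurable g (volume.restrict Ω) := by
    have hmeas : Measurable fun t : ℝ => (SignType.sign t : ℝ) * |t| ^ (q - 1) := by
      have hs : Measurable fun t : ℝ => ((SignType.sign t : SignType) : ℝ) := by
        have : (fun t : ℝ => ((SignType.sign t : SignType) : ℝ)) =
            fun t => if 0 < t then 1 else if t < 0 then -1 else 0 := by
          funext t
          rw [sign_apply]
          split_ifs <;> simp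
        rw [this]
        exact Measurable.ite measurableSet_Ioi measurable_const
          (Measurable.ite measurableSet_Iio measurable_const measurable_const)
      fun_prop
    exact (hmeas.comp_aemeasurable hFm.aemeasurable).aestronglyMeasurable
  have hgq' : MemLp g (ENNReal.ofReal q') (volume.restrict Ω) := by
    refine ⟨hgm, ?_⟩
    rw [eLpNorm_lt_top_iff_lintegral_rpow_enorm_lt_top (by simpa using hq'0) ENNReal.ofReal_ne_top,
      ENNReal.toReal_ofReal hq'0.le]
    simp only [hgpow]
    exact lt_top_iff_ne_top.2 hIfin
  have hgi := integrable_of_memLp_ofReal hq'1.le hgq'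
  have hgF : ∀ x, ‖F x‖ₑ ^ q = ENNReal.ofReal (g x * F x) := by
    intro x
    have : g x * F x = |F x| ^ q := by
      by_cases hx : F x = 0
      · simp [hx, Real.zero_rpow hq0.ne']
      · have h1 : 0 < |F x| := abs_pos.2 hx
        have h2 : ((SignType.sign (F x) : SignType) : ℝ) * F x = |F x| := sign_mul_self _
        calc g x * F x = (SignType.sign (F x) * F x) * |F x| ^ (q - 1) := by
              simp only [hg]; ring
          _ = |F x| ^ q := by
              rw [h2, Real.rpow_sub_one h1.ne']; field_simp
    rw [this, Real.enorm_eq_ofReal_abs, ENNReal.ofReal_rpow_of_nonneg (abs_nonneg _) hq0.le]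
  have hIle : I ≤ ‖∫ x, g x * F x ∂(volume.restrict Ω)‖ₑ := by
    have hnn : 0 ≤ᵐ[volume.restrict Ω] fun x => g x * F x := by
      refine Eventually.of_forall fun x => ?_
      have h2 : ((SignType.sign (F x) : SignType) : ℝ) * F x = |F x| := sign_mul_self _
      have : g x * F x = |F x| * |F x| ^ (q - 1) := by
        conv_rhs => enter [1]; rw [← h2]
        simp only [hg]; ring
      simp only [Pi.zero_apply]
      rw [this]; positivity
    have hint : Integrable (fun x => g x * F x) (volume.restrict Ω) := by
      refine hgi.mul_bdd (c := b) hFm ?_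
      filter_upwards [ae_restrict_mem hΩ.measurableSet] with x hx
      exact hb x hx
    rw [Real.enorm_eq_ofReal (integral_nonneg_of_ae hnn),
      ofReal_integral_eq_lintegral_ofReal hint hnn, hI]
    simp only [hgF]
    exact le_rfl
  have hchain : I ≤ J ^ (1 / q) * (A * I) ^ (1 / q') := by
    refine hIle.trans ?_
    simp only [hF]
    rw [h.integral_truncatedIntegral_mul hΩ hδ hfi hgi]
    refine (enorm_integral_le_lintegral_enorm _).trans ?_
    simp only [enorm_mul]
    refine (ENNReal.lintegral_mul_le_Lp_mul_Lq (volume.restrict Ω) hqq hf.1.enorm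
      (h.swap.aestronglyMeasurable_truncatedIntegral hn hΩ hδ hgi).enorm).trans ?_
    gcongr
    refine (hA δ hδ g hgq').trans ?_
    simp only [hgpow]
    exact le_rfl
  have hsum : 1 / q + 1 / q' = 1 := by
    have := hqq.inv_add_inv_eq_one
    simpa [one_div] using this
  have hq1' : q * (1 / q') = q - 1 := by
    have : 1 / q' = 1 - 1 / q := by linarith
    rw [this]; field_simp
  rcases eq_or_ne I 0 with h0 | h0
  · rw [h0]; exact zero_le
  have hI1 : I = I ^ (1 / q) * I ^ (1 / q') := by
    rw [← ENNReal.rpow_add_of_nonneg _ _ (by positivity) (by positivity), hsum, ENNReal.rpow_one]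
  rw [ENNReal.mul_rpow_of_nonneg _ _ (by positivity), ← mul_assoc] at hchain
  have h0' : I ^ (1 / q') ≠ 0 := (ENNReal.rpow_pos (pos_iff_ne_zero.2 h0) hIfin).ne'
  have hfin' : I ^ (1 / q') ≠ ∞ := ENNReal.rpow_ne_top_of_nonneg (by positivity) hIfin
  have h3 : I ^ (1 / q) ≤ J ^ (1 / q) * (A : ℝ≥0∞) ^ (1 / q') := by
    rw [← ENNReal.mul_le_mul_iff_left h0' hfin', ← hI1]
    exact hchain
  have h4 := ENNReal.rpow_le_rpow h3 hq0.le
  rw [← ENNReal.rpow_mul, one_div_mul_cancel hq0.ne', ENNReal.rpow_one,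
    ENNReal.mul_rpow_of_nonneg _ _ hq0.le, ← ENNReal.rpow_mul, one_div_mul_cancel hq0.ne',
    ENNReal.rpow_one, ← ENNReal.rpow_mul, mul_comm (1 / q') q, hq1', mul_comm] at h4
  rwa [ENNReal.coe_rpow_of_nonneg _ (by linarith)]

theorem KernelBounds.exists_truncBounded_of_localOp (hn : 0 < n) (hΩ : IsOpen Ω)
    (hΩb : Bornology.IsBounded Ω) [IsFiniteMeasure (volume.restrict Ω)] (h : KernelBounds Ω K C w)
    {s : ℝ} (hs : 1 < s) {B : ℝ≥0} (hS : ∀ η > 0, ∃ S, LocalOp Ω K s B η S) {q₀ q₁ : ℝ}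
    (hq₀ : s < q₀) (hq₁ : q₀ ≤ q₁) : ∃ A : ℝ≥0, ∀ q ∈ Icc q₀ q₁, TruncBounded Ω K q A := by
  obtain ⟨A, hA⟩ := h.exists_maxTrunc_strong hn hΩ hΩb hs hS hq₀ hq₁
  refine ⟨A, fun q hq δ hδ f hf => le_trans (lintegral_mono fun x => ?_) (hA q hq δ hδ f hf)⟩
  have : 0 < q := by linarith [hq.1]
  dsimp only
  gcongr
  exact enorm_truncatedIntegral_le_maxTrunc le_rfl f x

/-- The truncations of a Calderón–Zygmund operator are bounded on every `L ^ q (Ω)`, `1 < q < ∞`,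
uniformly on compact sets of exponents. The extrapolation step only raises the exponent, so it is
applied to `K` starting from `L ^ 2`, and then to the transposed kernel starting from an
exponent close to `1`, which duality provides. -/
theorem IsCalderonZygmundOperator.exists_truncBounded (hn : 0 < n) (hΩ : IsOpen Ω)
    (hΩb : Bornology.IsBounded Ω) [IsFiniteMeasure (volume.restrict Ω)]
    (hK : IsCalderonZygmundOperator Ω K) {q₀ q₁ : ℝ} (hq₀ : 1 < q₀) (hq₁ : q₀ ≤ q₁) :
    ∃ A : ℝ≥0, ∀ q ∈ Icc q₀ q₁, TruncBounded Ω K q A := by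
  obtain ⟨C, w, h⟩ := hK.kernel.exists_kernelBounds
  obtain ⟨B, hB⟩ := hK.exists_localOp hn hΩ
  have hq₁1 : 1 < q₁ := by linarith
  -- `p₁ = q₁'` and `p₀ = q₀'` are the dual exponents, `1 < p₁ ≤ p₀`
  have hc₀ := Real.HolderConjugate.conjExponent hq₀
  have hc₁ := Real.HolderConjugate.conjExponent hq₁1
  set p₀ := q₀.conjExponent with hp₀
  set p₁ := q₁.conjExponent with hp₁
  have hp₁1 : 1 < p₁ := hc₁.symm.lt
  set s := (1 + min p₁ 2) / 2 with hs
  have hmin : 1 < min p₁ 2 := lt_min hp₁1 (by norm_num)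
  have hs1 : 1 < s := by rw [hs]; linarith
  have hsp : s < p₁ := by have := min_le_left p₁ 2; rw [hs]; linarith
  have hs2 : s < 2 := by have := min_le_right p₁ 2; rw [hs]; linarith
  have hcs := Real.HolderConjugate.conjExponent hs1
  have hs'2 : 2 < s.conjExponent := by
    rw [Real.conjExponent, lt_div_iff₀ (by linarith)]; linarith
  obtain ⟨A₁, hA₁⟩ := h.exists_truncBounded_of_localOp hn hΩ hΩb (s := 2) (by norm_num)
    (fun η hη => ⟨_, hB η hη⟩) hs'2 le_rfl
  have hdual : TruncBounded Ω (fun x y => K y x) s (A₁ ^ (s - 1)) :=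
    h.swap.truncBounded_of_swap hn hΩ hcs (hA₁ _ ⟨le_rfl, le_rfl⟩)
  have hconj_anti : ∀ {a b : ℝ}, 1 < a → a ≤ b → b.conjExponent ≤ a.conjExponent := by
    intro a b ha hab
    rw [Real.conjExponent, Real.conjExponent, div_le_div_iff₀ (by linarith) (by linarith)]
    nlinarith
  obtain ⟨A₂, hA₂⟩ := h.swap.exists_truncBounded_of_localOp hn hΩ hΩb hs1
    (fun η hη => ⟨_, h.swap.localOp_truncatedIntegral hn hΩ hs1.le hdual hη⟩) hsp
    (hconj_anti hq₀ hq₁)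
  refine ⟨(max 1 A₂) ^ (q₁ - 1), fun q hq δ hδ f hf => ?_⟩
  have hq1 : 1 < q := by linarith [hq.1]
  have hcq := Real.HolderConjugate.conjExponent hq1
  have := h.truncBounded_of_swap hn hΩ hcq
    (hA₂ q.conjExponent ⟨hconj_anti hq1 hq.2, hconj_anti hq₀ hq.1⟩) δ hδ f hf
  refine this.trans ?_
  gcongr
  calc A₂ ^ (q - 1) ≤ (max 1 A₂) ^ (q - 1) :=
        NNReal.rpow_le_rpow (le_max_right _ _) (by linarith)
    _ ≤ (max 1 A₂) ^ (q₁ - 1) :=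
        NNReal.rpow_le_rpow_of_exponent_le (le_max_left _ _) (by linarith [hq.2])

/-- Almost everywhere existence of principal values on `L ^ s (Ω)`, `s > 1`, by approximation with
bounded functions and the weak type bound for the maximal truncated operator. -/
theorem IsCalderonZygmundOperator.ae_pvExistsAt (hn : 0 < n) (hΩ : IsOpen Ω)
    (hΩb : Bornology.IsBounded Ω) [IsFiniteMeasure (volume.restrict Ω)]
    (hK : IsCalderonZygmundOperator Ω K) {s : ℝ} (hs : 1 < s)
    {f : EuclideanSpace ℝ (Fin n) → ℝ} (hf : MemLp f (ENNReal.ofReal s) (volume.restrict Ω)) :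
    ∀ᵐ x ∂(volume.restrict Ω), PVExistsAt Ω K f x := by
  obtain ⟨C, w, h⟩ := hK.kernel.exists_kernelBounds
  obtain ⟨B, hB⟩ := hK.exists_truncBounded hn hΩ hΩb hs le_rfl
  obtain ⟨A, hA⟩ := h.exists_maxTrunc_weak hΩ hs B
  have hs0 : 0 < s := by linarith
  set m := volume.restrict Ω with hm
  -- the truncations `φ N` of the values of `f` are bounded, hence in `L ^ 2`, where principal values
  -- exist by hypothesis
  set φ : ℕ → EuclideanSpace ℝ (Fin n) → ℝ := fun N x => max (-(N : ℝ)) (min N (f x)) with hφ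
  have hφm : ∀ N, AEStronglyMeasurable (φ N) m := fun N => by
    have hc : Continuous fun t : ℝ => max (-(N : ℝ)) (min N t) := by fun_prop
    exact hc.comp_aestronglyMeasurable hf.1
  have hφb : ∀ N x, ‖φ N x‖ ≤ N := fun N x => by
    have : (0 : ℝ) ≤ N := N.cast_nonneg
    rw [Real.norm_eq_abs, abs_le]
    exact ⟨le_max_left _ _, max_le (by linarith) (min_le_left _ _)⟩
  have hφL : ∀ N p, MemLp (φ N) p m := fun N p =>
    MemLp.of_bound (hφm N) N (Eventually.of_forall (hφb N))
  have hdiff : ∀ N x, ‖f x - φ N x‖ₑ ≤ ‖f x‖ₑ := by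
    intro N x
    have hN : (0 : ℝ) ≤ N := N.cast_nonneg
    rw [Real.enorm_eq_ofReal_abs, Real.enorm_eq_ofReal_abs]
    refine ENNReal.ofReal_le_ofReal ?_
    simp only [hφ]
    rcases le_total (f x) N with h1 | h1
    · rw [min_eq_right h1]
      rcases le_total (-(N : ℝ)) (f x) with h2 | h2
      · rw [max_eq_right h2]; simp
      · rw [max_eq_left h2, abs_of_nonpos (by linarith), abs_of_nonpos (by linarith)]; linarith
    · rw [min_eq_left h1, max_eq_right (by linarith), abs_of_nonneg (by linarith),
        abs_of_nonneg (by linarith)]; linarith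
  have hzero : ∀ x, ∀ᶠ N : ℕ in atTop, f x - φ N x = 0 := by
    intro x
    filter_upwards [eventually_ge_atTop ⌈|f x|⌉₊] with N hN
    have h1 : |f x| ≤ N := (Nat.le_ceil _).trans (by exact_mod_cast hN)
    rw [abs_le] at h1
    simp only [hφ]
    rw [min_eq_right h1.2, max_eq_right h1.1, sub_self]
  have hfin : ∫⁻ x, ‖f x‖ₑ ^ s ∂m ≠ ∞ := by
    have := hf.2
    rw [eLpNorm_lt_top_iff_lintegral_rpow_enorm_lt_top (by simpa using hs0) ENNReal.ofReal_ne_top,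
      ENNReal.toReal_ofReal hs0.le] at this
    exact this.ne
  have hlim : Tendsto (fun N => ∫⁻ x, ‖(f - φ N) x‖ₑ ^ s ∂m) atTop (𝓝 0) := by
    have := tendsto_lintegral_of_dominated_convergence' (μ := m)
      (F := fun N x => ‖(f - φ N) x‖ₑ ^ s) (f := fun _ => 0) (fun x => ‖f x‖ₑ ^ s)
      (fun N => (hf.1.sub (hφm N)).enorm.pow_const s)
      (fun N => Eventually.of_forall fun x => by
        have := hdiff N x
        dsimp only [Pi.sub_apply]
        gcongr) hfin
      (Eventually.of_forall fun x => by
        refine tendsto_const_nhds.congr' ?_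
        filter_upwards [hzero x] with N hN
        rw [Pi.sub_apply, hN]
        simp [hs0])
    simpa using this
  -- the weak type bound with all truncation radii
  have hweak : ∀ g, MemLp g (ENNReal.ofReal s) m → ∀ t > 0, ENNReal.ofReal (t ^ s) *
      m {x | ∃ δ > 0, ENNReal.ofReal t < ‖truncatedIntegral Ω K g x δ‖ₑ} ≤
        A * ∫⁻ y, ‖g y‖ₑ ^ s ∂m := by
    intro g hg t ht
    set V : ℕ → Set (EuclideanSpace ℝ (Fin n)) := fun k =>
      {x | ENNReal.ofReal t < maxTrunc Ω K (1 / ((k : ℝ) + 1)) g x} with hV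
    have hmono : Monotone V := by
      intro i j hij x hx
      have hx : ENNReal.ofReal t < maxTrunc Ω K (1 / ((i : ℝ) + 1)) g x := hx
      refine hx.trans_le (iSup₂_le fun δ hδ => enorm_truncatedIntegral_le_maxTrunc ?_ g x)
      exact le_trans (by gcongr) hδ
    have hsub : {x | ∃ δ > 0, ENNReal.ofReal t < ‖truncatedIntegral Ω K g x δ‖ₑ} ⊆ ⋃ k, V k := by
      rintro x ⟨δ, hδ, hx⟩
      obtain ⟨k, hk⟩ := exists_nat_one_div_lt hδ
      exact mem_iUnion.2 ⟨k, hx.trans_le (enorm_truncatedIntegral_le_maxTrunc hk.le g x)⟩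
    calc _ ≤ ENNReal.ofReal (t ^ s) * m (⋃ k, V k) := by gcongr
      _ = ⨆ k, ENNReal.ofReal (t ^ s) * m (V k) := by
          rw [hmono.measure_iUnion, ENNReal.mul_iSup]
      _ ≤ _ := iSup_le fun k => hA _ (by positivity) _
          (h.localOp_truncatedIntegral hn hΩ hs.le (hB s ⟨le_rfl, le_rfl⟩) (by positivity)) g hg t ht
  -- the oscillation of the truncated integrals is small almost everywhere
  have hosc : ∀ t > 0, ∀ᵐ x ∂m, ∀ᶠ p : ℝ × ℝ in 𝓝[>] 0 ×ˢ 𝓝[>] 0,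
      dist (truncatedIntegral Ω K f x p.1) (truncatedIntegral Ω K f x p.2) < 4 * t := by
    intro t ht
    rw [ae_iff]
    set Z := {x | ¬ ∀ᶠ p : ℝ × ℝ in 𝓝[>] 0 ×ˢ 𝓝[>] 0,
      dist (truncatedIntegral Ω K f x p.1) (truncatedIntegral Ω K f x p.2) < 4 * t} with hZ
    have hle : ∀ N, ENNReal.ofReal (t ^ s) * m Z ≤ A * ∫⁻ x, ‖(f - φ N) x‖ₑ ^ s ∂m := by
      intro N
      have hgm : MemLp (f - φ N) (ENNReal.ofReal s) m := hf.sub (hφL N _)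
      refine le_trans ?_ (hweak _ hgm t ht)
      gcongr ENNReal.ofReal (t ^ s) * ?_
      refine measure_mono_ae ?_
      filter_upwards [hK.pv_exists (φ N) (hφL N 2), ae_restrict_mem hΩ.measurableSet]
        with x hx hxΩ hxZ
      have hxZ : ¬ ∀ᶠ p : ℝ × ℝ in 𝓝[>] 0 ×ˢ 𝓝[>] 0,
        dist (truncatedIntegral Ω K f x p.1) (truncatedIntegral Ω K f x p.2) < 4 * t := hxZ
      by_contra hcon
      have hcon : ¬ ∃ δ > 0, ENNReal.ofReal t < ‖truncatedIntegral Ω K (f - φ N) x δ‖ₑ := hcon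
      push Not at hcon
      refine hxZ ?_
      have hev : ∀ᶠ δ in 𝓝[>] (0 : ℝ), dist (truncatedIntegral Ω K (φ N) x δ)
          (pvOperator Ω K (φ N) x) < t := (Metric.tendsto_nhds.1 hx.tendsto) t ht
      have hpos : ∀ᶠ δ in 𝓝[>] (0 : ℝ), 0 < δ := self_mem_nhdsWithin
      have hboth := hev.and hpos
      filter_upwards [hboth.prod_mk hboth] with p hp
      have hsplit : ∀ δ > 0, |truncatedIntegral Ω K f x δ - truncatedIntegral Ω K (φ N) x δ| ≤ t := by
        intro δ hδ
        have h1 := h.truncatedIntegral_add hΩ hδ hxΩ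
          (integrable_of_memLp_ofReal hs.le (hφL N _)) (integrable_of_memLp_ofReal hs.le hgm)
        rw [add_sub_cancel] at h1
        have h2 := hcon δ hδ
        rw [Real.enorm_eq_ofReal_abs, ENNReal.ofReal_le_ofReal_iff ht.le] at h2
        rw [h1, add_sub_cancel_left]
        exact h2
      have a1 := hsplit p.1 hp.1.2
      have a2 := hsplit p.2 hp.2.2
      have a3 := hp.1.1
      have a4 := hp.2.1
      rw [Real.dist_eq] at a3 a4 ⊢
      rw [abs_le] at a1 a2
      rw [abs_lt] at a3 a4 ⊢
      constructor <;> linarith [a1.1, a1.2, a2.1, a2.2, a3.1, a3.2, a4.1, a4.2]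
    have hlim' : Tendsto (fun N => (A : ℝ≥0∞) * ∫⁻ x, ‖(f - φ N) x‖ₑ ^ s ∂m) atTop (𝓝 0) := by
      have := ENNReal.Tendsto.const_mul (a := (A : ℝ≥0∞)) hlim (Or.inr ENNReal.coe_ne_top)
      simpa using this
    have h0 : ENNReal.ofReal (t ^ s) * m Z ≤ 0 :=
      ge_of_tendsto hlim' (Eventually.of_forall hle)
    have hts : ENNReal.ofReal (t ^ s) ≠ 0 := by
      simp only [ne_eq, ENNReal.ofReal_eq_zero, not_le]; positivity
    exact (mul_eq_zero.1 (le_antisymm h0 zero_le)).resolve_left hts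
  have hall : ∀ᵐ x ∂m, ∀ k : ℕ, ∀ᶠ p : ℝ × ℝ in 𝓝[>] 0 ×ˢ 𝓝[>] 0,
      dist (truncatedIntegral Ω K f x p.1) (truncatedIntegral Ω K f x p.2) <
        4 * (1 / ((k : ℝ) + 1)) := ae_all_iff.2 fun k => hosc _ (by positivity)
  filter_upwards [hall] with x hx
  have hcauchy : Cauchy (map (truncatedIntegral Ω K f x) (𝓝[>] 0)) := by
    refine cauchy_map_iff.2 ⟨inferInstance, Metric.uniformity_basis_dist.tendsto_right_iff.2 ?_⟩
    intro ε hε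
    obtain ⟨k, hk⟩ := exists_nat_one_div_lt (show 0 < ε / 4 by positivity)
    filter_upwards [hx k] with p hp
    exact hp.trans (by linarith)
  exact CompleteSpace.complete hcauchy

theorem IsCalderonZygmundOperator.exists_lintegral_pvOperator_le (hn : 0 < n) (hΩ : IsOpen Ω)
    (hΩb : Bornology.IsBounded Ω) [IsFiniteMeasure (volume.restrict Ω)]
    (hK : IsCalderonZygmundOperator Ω K) {q₀ q₁ : ℝ} (hq₀ : 1 < q₀) (hq₁ : q₀ ≤ q₁) :
    ∃ A : ℝ≥0, ∀ q ∈ Icc q₀ q₁, ∀ f, MemLp f (ENNReal.ofReal q) (volume.restrict Ω) →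
      ∫⁻ x, ‖pvOperator Ω K f x‖ₑ ^ q ∂(volume.restrict Ω) ≤
        A * ∫⁻ x, ‖f x‖ₑ ^ q ∂(volume.restrict Ω) := by
  obtain ⟨C, w, h⟩ := hK.kernel.exists_kernelBounds
  obtain ⟨A, hA⟩ := hK.exists_truncBounded hn hΩ hΩb hq₀ hq₁
  refine ⟨A, fun q hq f hf => ?_⟩
  have hq1 : 1 < q := by linarith [hq.1]
  have hq0 : 0 < q := by linarith
  have hfi := integrable_of_memLp_ofReal hq1.le hf
  set T : ℕ → EuclideanSpace ℝ (Fin n) → ℝ≥0∞ :=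
    fun k x => ‖truncatedIntegral Ω K f x (1 / ((k : ℝ) + 1))‖ₑ ^ q with hT
  have hlim : ∀ᵐ x ∂(volume.restrict Ω), ‖pvOperator Ω K f x‖ₑ ^ q = liminf (fun k => T k x) atTop := by
    filter_upwards [hK.ae_pvExistsAt hn hΩ hΩb hq1 hf] with x hx
    have h1 := (hx.tendsto.comp tendsto_one_div_succ_nhdsGT).enorm
    exact ((ENNReal.continuous_rpow_const.tendsto _).comp h1).liminf_eq.symm
  rw [lintegral_congr_ae hlim]
  refine (lintegral_liminf_le' fun k => ?_).trans ?_
  · exact (h.aestronglyMeasurable_truncatedIntegral hn hΩ (by positivity) hfi).enorm.pow_const q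
  · refine liminf_le_of_frequently_le' (Eventually.of_forall fun k => ?_).frequently
    exact hA q hq _ (by positivity) f hf

end

/-! ### Morrey spaces -/

section

variable {n : ℕ} {Ω : Set (EuclideanSpace ℝ (Fin n))} {f : EuclideanSpace ℝ (Fin n) → ℝ}

/-- In an open set no point is at maximal distance from a given one. -/
theorem IsOpen.exists_dist_lt_dist (hn : 0 < n) (hΩ : IsOpen Ω) (x : EuclideanSpace ℝ (Fin n))
    {y : EuclideanSpace ℝ (Fin n)} (hy : y ∈ Ω) : ∃ z ∈ Ω, dist x y < dist x z := by
  have key : ∀ v : EuclideanSpace ℝ (Fin n), ∃ t > (0 : ℝ), y + t • v ∈ Ω := by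
    intro v
    have hc : Tendsto (fun t : ℝ => y + t • v) (𝓝[>] 0) (𝓝 y) := by
      have : Continuous fun t : ℝ => y + t • v := by fun_prop
      simpa using (this.tendsto 0).mono_left nhdsWithin_le_nhds
    obtain ⟨t, ht, h0⟩ := ((hc.eventually (hΩ.mem_nhds hy)).and self_mem_nhdsWithin).exists
    exact ⟨t, h0, ht⟩
  rcases eq_or_ne x y with rfl | hxy
  · obtain ⟨t, ht, hz⟩ := key (EuclideanSpace.single ⟨0, hn⟩ (1 : ℝ))
    refine ⟨_, hz, ?_⟩
    simp [dist_eq_norm, norm_smul, ht.ne']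
  · obtain ⟨t, ht, hz⟩ := key (y - x)
    refine ⟨_, hz, ?_⟩
    have h1 : 0 < ‖y - x‖ := norm_pos_iff.2 (sub_ne_zero.2 hxy.symm)
    rw [dist_comm x y, dist_comm x, dist_eq_norm, dist_eq_norm,
      show y + t • (y - x) - x = (1 + t) • (y - x) by module, norm_smul, Real.norm_eq_abs,
      abs_of_pos (by positivity)]
    nlinarith

theorem IsOpen.subset_ball_diam (hn : 0 < n) (hΩ : IsOpen Ω) (hΩb : Bornology.IsBounded Ω)
    {x : EuclideanSpace ℝ (Fin n)} (hx : x ∈ Ω) : Ω ⊆ Metric.ball x (Metric.diam Ω) := by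
  intro y hy
  obtain ⟨z, hz, h⟩ := hΩ.exists_dist_lt_dist hn x hy
  rw [Metric.mem_ball, dist_comm]
  exact h.trans_le (Metric.dist_le_diam_of_mem hΩb hx hz)

theorem volume_ball_ne_zero (x : EuclideanSpace ℝ (Fin n)) {r : ℝ} (hr : 0 < r) :
    volume (Metric.ball x r) ≠ 0 :=
  (Metric.measure_ball_pos volume x hr).ne'

theorem volume_ball_mul (x : EuclideanSpace ℝ (Fin n)) {a r : ℝ} (ha : 0 < a) (hr : 0 < r) :
    volume (Metric.ball x (a * r)) = ENNReal.ofReal (a ^ n) * volume (Metric.ball x r) := by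
  rw [Measure.addHaar_ball_of_pos volume x hr, Measure.addHaar_ball_of_pos volume x (by positivity),
    ← mul_assoc, ← ENNReal.ofReal_mul (by positivity)]
  simp [mul_pow]

theorem lintegral_ball_le_morreyNorm_of_le_diam {q μ : ℝ} (hq : 0 < q)
    {x : EuclideanSpace ℝ (Fin n)} (hx : x ∈ Ω) {r : ℝ} (hr : 0 < r) (hrd : r ≤ Metric.diam Ω) :
    ∫⁻ y in Metric.ball x r, ‖f y‖ₑ ^ q ∂(volume.restrict Ω) ≤
      volume (Metric.ball x r) ^ μ * morreyNorm Ω q μ f ^ q := by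
  have h1 : ((∫⁻ y in Metric.ball x r ∩ Ω, ‖f y‖ₑ ^ q) / volume (Metric.ball x r) ^ μ) ^ (1 / q) ≤
      morreyNorm Ω q μ f := by
    unfold morreyNorm
    exact le_iSup₂_of_le x hx (le_iSup₂_of_le r ⟨hr, hrd⟩ le_rfl)
  have h2 := ENNReal.rpow_le_rpow h1 hq.le
  rw [← ENNReal.rpow_mul, one_div_mul_cancel hq.ne', ENNReal.rpow_one] at h2
  have h0 := volume_ball_ne_zero x hr
  have ht : volume (Metric.ball x r) ≠ ∞ := measure_ball_lt_top.ne
  rw [ENNReal.div_le_iff (by simp [ENNReal.rpow_eq_zero_iff, h0, ht])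
    (ENNReal.rpow_ne_top_of_ne_zero h0 ht), mul_comm] at h2
  rwa [Measure.restrict_restrict measurableSet_ball]

/-- The radii in the Morrey norm may be taken arbitrarily large, as `Ω` is contained in the ball
of radius `diam Ω` around each of its points. -/
theorem lintegral_ball_le_morreyNorm (hn : 0 < n) (hΩ : IsOpen Ω) (hΩb : Bornology.IsBounded Ω)
    {q μ : ℝ} (hq : 0 < q) (hμ : 0 ≤ μ) {x : EuclideanSpace ℝ (Fin n)} (hx : x ∈ Ω) {r : ℝ}
    (hr : 0 < r) :
    ∫⁻ y in Metric.ball x r, ‖f y‖ₑ ^ q ∂(volume.restrict Ω) ≤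
      volume (Metric.ball x r) ^ μ * morreyNorm Ω q μ f ^ q := by
  rcases le_or_gt r (Metric.diam Ω) with h | h
  · exact lintegral_ball_le_morreyNorm_of_le_diam hq hx hr h
  · have hsub := hΩ.subset_ball_diam hn hΩb hx
    have hd : 0 < Metric.diam Ω := Metric.pos_of_mem_ball (hsub hx)
    calc ∫⁻ y in Metric.ball x r, ‖f y‖ₑ ^ q ∂(volume.restrict Ω)
        ≤ ∫⁻ y in Metric.ball x (Metric.diam Ω), ‖f y‖ₑ ^ q ∂(volume.restrict Ω) := by
          rw [Measure.restrict_restrict measurableSet_ball,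
            Measure.restrict_restrict measurableSet_ball]
          exact lintegral_mono_set fun y hy => ⟨hsub hy.2, hy.2⟩
      _ ≤ volume (Metric.ball x (Metric.diam Ω)) ^ μ * morreyNorm Ω q μ f ^ q :=
          lintegral_ball_le_morreyNorm_of_le_diam hq hx hd le_rfl
      _ ≤ _ := mul_le_mul_left
          (ENNReal.rpow_le_rpow (measure_mono (Metric.ball_subset_ball h.le)) hμ) _

theorem memLp_of_morreyNorm_lt_top (hn : 0 < n) (hΩ : IsOpen Ω) (hΩb : Bornology.IsBounded Ω)
    {q μ : ℝ} (hq : 0 < q) (hμ : 0 ≤ μ) (hf : AEStronglyMeasurable f (volume.restrict Ω))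
    (hN : morreyNorm Ω q μ f < ∞) : MemLp f (ENNReal.ofReal q) (volume.restrict Ω) := by
  rcases Ω.eq_empty_or_nonempty with rfl | ⟨x, hx⟩
  · simp
  refine ⟨hf, ?_⟩
  rw [eLpNorm_lt_top_iff_lintegral_rpow_enorm_lt_top (by simpa using hq) (by simp),
    ENNReal.toReal_ofReal hq.le]
  have hsub := hΩ.subset_ball_diam hn hΩb hx
  have hd : 0 < Metric.diam Ω := Metric.pos_of_mem_ball (hsub hx)
  have h := lintegral_ball_le_morreyNorm (f := f) hn hΩ hΩb hq hμ hx hd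
  rw [Measure.restrict_restrict measurableSet_ball, inter_eq_right.2 hsub] at h
  exact h.trans_lt (ENNReal.mul_lt_top
    (ENNReal.rpow_lt_top_of_nonneg hμ measure_ball_lt_top.ne)
    (ENNReal.rpow_lt_top_of_nonneg hq.le hN.ne))

/-- On a ball `B`, Hölder's inequality bounds the mean of `|f|` by `|B| ^ (-(1 - μ) / q)` times the
Morrey norm. -/
theorem lintegral_ball_enorm_le_morreyNorm (hn : 0 < n) (hΩ : IsOpen Ω)
    (hΩb : Bornology.IsBounded Ω) {q μ : ℝ} (hq : 1 ≤ q) (hμ : 0 ≤ μ)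
    (hf : AEStronglyMeasurable f (volume.restrict Ω)) {x : EuclideanSpace ℝ (Fin n)} (hx : x ∈ Ω)
    {r : ℝ} (hr : 0 < r) :
    ∫⁻ y in Metric.ball x r, ‖f y‖ₑ ∂(volume.restrict Ω) ≤
      volume (Metric.ball x r) * volume (Metric.ball x r) ^ (-((1 - μ) / q)) *
        morreyNorm Ω q μ f := by
  have hq0 : 0 < q := by linarith
  have h0 := volume_ball_ne_zero x hr
  have ht : volume (Metric.ball x r) ≠ ∞ := measure_ball_lt_top.ne
  refine (lintegral_le_rpow_mul_measure_univ hf.enorm.restrict hq).trans ?_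
  have h1 := ENNReal.rpow_le_rpow
    (lintegral_ball_le_morreyNorm (f := f) hn hΩ hΩb hq0 hμ hx hr) (z := 1 / q) (by positivity)
  rw [ENNReal.mul_rpow_of_nonneg _ _ (by positivity), ← ENNReal.rpow_mul, ← ENNReal.rpow_mul,
    mul_one_div_cancel hq0.ne', ENNReal.rpow_one] at h1
  have h2 : (volume.restrict Ω).restrict (Metric.ball x r) univ ^ (1 - 1 / q) ≤
      volume (Metric.ball x r) ^ (1 - 1 / q) := by
    refine ENNReal.rpow_le_rpow ?_ (by rw [sub_nonneg, div_le_one hq0]; exact hq)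
    rw [Measure.restrict_apply_univ]
    exact Measure.restrict_apply_le _ _
  refine (mul_le_mul' h1 h2).trans_eq ?_
  have h3 : volume (Metric.ball x r) * volume (Metric.ball x r) ^ (-((1 - μ) / q)) =
      volume (Metric.ball x r) ^ (μ * (1 / q)) * volume (Metric.ball x r) ^ (1 - 1 / q) := by
    conv_lhs => enter [1]; rw [← ENNReal.rpow_one (volume (Metric.ball x r))]
    rw [← ENNReal.rpow_add _ _ h0 ht, ← ENNReal.rpow_add _ _ h0 ht]
    congr 1
    field_simp
    ring
  rw [h3]
  ring

/-- Raising the exponent and lowering `(1 - μ) / q` strengthens the Morrey norm: Hölder's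
inequality on each ball, whose radius is at most `diam Ω`. -/
theorem morreyNorm_le_mul_morreyNorm {q₁ q₂ μ₁ μ₂ : ℝ} (hq₁ : 1 ≤ q₁) (hq : q₁ ≤ q₂)
    (hμ₁ : 0 ≤ μ₁) (hμ₂ : μ₂ ≤ 1) (h : (1 - μ₂) / q₂ ≤ (1 - μ₁) / q₁)
    (hf : AEStronglyMeasurable f (volume.restrict Ω)) :
    morreyNorm Ω q₁ μ₁ f ≤
      max 1 (volume (Metric.ball (0 : EuclideanSpace ℝ (Fin n)) (Metric.diam Ω))) *
        morreyNorm Ω q₂ μ₂ f := by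
  have hq₁0 : 0 < q₁ := by linarith
  have hq₂0 : 0 < q₂ := by linarith
  conv_lhs => unfold morreyNorm
  refine iSup₂_le fun x hx => iSup₂_le fun r hr => ?_
  obtain ⟨hr, hrd⟩ := hr
  have h0 := volume_ball_ne_zero x hr
  have ht : volume (Metric.ball x r) ≠ ∞ := measure_ball_lt_top.ne
  have hV : volume (Metric.ball x r) ≤
      max 1 (volume (Metric.ball (0 : EuclideanSpace ℝ (Fin n)) (Metric.diam Ω))) := by
    rw [Measure.addHaar_ball_center volume x r]
    exact (measure_mono (Metric.ball_subset_ball hrd)).trans (le_max_right _ _)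
  set V := volume (Metric.ball x r)
  set N := morreyNorm Ω q₂ μ₂ f
  have e1 : ∫⁻ y in Metric.ball x r ∩ Ω, ‖f y‖ₑ ^ q₁ ≤
      V ^ (μ₂ * (q₁ / q₂)) * N ^ q₁ * V ^ (1 - q₁ / q₂) := by
    rw [← Measure.restrict_restrict measurableSet_ball]
    refine (lintegral_le_rpow_mul_measure_univ (hf.enorm.restrict.pow_const q₁)
      (s := q₂ / q₁) (by rw [le_div_iff₀ hq₁0]; linarith)).trans ?_
    simp only [one_div_div, ← ENNReal.rpow_mul, mul_div_cancel₀ q₂ hq₁0.ne']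
    refine mul_le_mul' ?_ (ENNReal.rpow_le_rpow ?_ ?_)
    · refine (ENNReal.rpow_le_rpow (lintegral_ball_le_morreyNorm_of_le_diam (μ := μ₂) hq₂0 hx hr hrd)
        (by positivity)).trans_eq ?_
      rw [ENNReal.mul_rpow_of_nonneg _ _ (by positivity), ← ENNReal.rpow_mul, ← ENNReal.rpow_mul,
        mul_div_cancel₀ q₁ hq₂0.ne']
    · rw [Measure.restrict_apply_univ]
      exact Measure.restrict_apply_le _ _
    · rw [sub_nonneg, div_le_one hq₂0]
      exact hq
  have e2 : V ^ (μ₂ * (q₁ / q₂)) * N ^ q₁ * V ^ (1 - q₁ / q₂) / V ^ μ₁ =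
      (V ^ ((1 - μ₁) / q₁ - (1 - μ₂) / q₂) * N) ^ q₁ := by
    rw [ENNReal.mul_rpow_of_nonneg _ _ hq₁0.le, ← ENNReal.rpow_mul, mul_right_comm, mul_comm,
      ← ENNReal.rpow_add _ _ h0 ht, mul_comm, ENNReal.mul_div_right_comm, ← ENNReal.rpow_sub _ _ h0 ht]
    congr 2
    field_simp
    ring
  refine (ENNReal.rpow_le_rpow ((ENNReal.div_le_div_right e1 _).trans_eq e2)
    (by positivity)).trans ?_
  rw [← ENNReal.rpow_mul, mul_one_div_cancel hq₁0.ne', ENNReal.rpow_one]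
  refine mul_le_mul_left ?_ _
  refine (ENNReal.rpow_le_rpow hV (sub_nonneg.2 h)).trans ?_
  conv_rhs => rw [← ENNReal.rpow_one (max 1 _)]
  refine ENNReal.rpow_le_rpow_of_exponent_le (le_max_left _ _) ?_
  have : (1 - μ₁) / q₁ ≤ 1 := by rw [div_le_one hq₁0]; linarith
  have : 0 ≤ (1 - μ₂) / q₂ := div_nonneg (by linarith) hq₂0.le
  linarith

end

/-! ### Calderón–Zygmund operators on Morrey spaces -/

section

variable {n : ℕ} {Ω : Set (EuclideanSpace ℝ (Fin n))}
  {K : EuclideanSpace ℝ (Fin n) → EuclideanSpace ℝ (Fin n) → ℝ} {C : ℝ} {w : ℝ → ℝ}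

/-- The contribution of the complement of the double ball, summed over dyadic annuli. On the annulus
of radius `2 ^ k * r` the kernel is of size `|B(x, 2 ^ k * r)|⁻¹`, so that the sum is geometric with
ratio at most `2 ^ (-(1 - μ₁) / q₁)`. -/
theorem KernelBounds.exists_enorm_far_integral_le (hn : 0 < n) (hΩ : IsOpen Ω)
    (hΩb : Bornology.IsBounded Ω) (h : KernelBounds Ω K C w) {q₁ μ₁ : ℝ} (hμ₁ : μ₁ < 1) :
    ∃ G : ℝ≥0, ∀ q ∈ Icc 1 q₁, ∀ μ ∈ Icc 0 μ₁, ∀ f : EuclideanSpace ℝ (Fin n) → ℝ,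
      AEStronglyMeasurable f (volume.restrict Ω) → ∀ x ∈ Ω, ∀ r > 0, ∀ y ∈ Ω, y ∈ Metric.ball x r →
        ‖∫ z in {z | z ∈ Ω ∧ 2 * r < ‖x - z‖}, K y z * f z‖ₑ ≤
          G * (volume (Metric.ball x r) ^ (-((1 - μ) / q)) * morreyNorm Ω q μ f) := by
  set ω : ℝ≥0∞ := volume (Metric.ball (0 : EuclideanSpace ℝ (Fin n)) 1)
  have hω : ω ≠ ∞ := measure_ball_lt_top.ne
  set ϑ : ℝ≥0∞ := 2 ^ (-((1 - μ₁) / q₁)) with hϑ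
  set G : ℝ≥0∞ := ENNReal.ofReal (C * 4 ^ n) * ω * (1 - ϑ)⁻¹ with hG
  rcases lt_or_ge q₁ 1 with hq₁ | hq₁
  · exact ⟨0, fun q hq => absurd (hq.1.trans hq.2) (not_le.2 hq₁)⟩
  have hϑ1 : ϑ < 1 := by
    refine ENNReal.rpow_lt_one_of_one_lt_of_neg (by norm_num) ?_
    rw [neg_lt_zero]
    exact div_pos (by linarith) (by linarith)
  have hGt : G ≠ ∞ := by
    refine ENNReal.mul_ne_top (by finiteness) (ENNReal.inv_ne_top.2 ?_)
    exact (tsub_pos_of_lt hϑ1).ne'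
  refine ⟨G.toNNReal, fun q hq μ hμ f hf x hx r hr y hy hyx => ?_⟩
  rw [ENNReal.coe_toNNReal hGt]
  have hq0 : 0 < q := by linarith [hq.1]
  set κ : ℝ := (1 - μ) / q with hκ
  set V := volume (Metric.ball x r) with hV
  set N := morreyNorm Ω q μ f
  have hκ0 : (1 - μ₁) / q₁ ≤ κ :=
    div_le_div₀ (by linarith [hμ.2]) (by linarith [hμ.2]) hq0 hq.2
  have hκpos : 0 ≤ κ := div_nonneg (by linarith [hμ.2]) hq0.le
  have hV0 : V ≠ 0 := volume_ball_ne_zero x hr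
  have hVt : V ≠ ∞ := measure_ball_lt_top.ne
  have hmn := measurable_norm_sub_left x
  set S : ℕ → Set (EuclideanSpace ℝ (Fin n)) := fun k =>
    {z | 2 ^ k * (2 * r) ≤ ‖x - z‖ ∧ ‖x - z‖ < 2 ^ k * (4 * r)} with hS
  have hSm : ∀ k, MeasurableSet (S k) := fun k =>
    (measurableSet_le measurable_const hmn).inter (measurableSet_lt hmn measurable_const)
  have hcover : {z | 2 * r < ‖x - z‖} ⊆ ⋃ k, S k := by
    intro z hz
    rw [mem_ofPred_eq] at hz
    obtain ⟨k, hk1, hk2⟩ := exists_nat_pow_near (x := ‖x - z‖ / (2 * r)) (y := 2)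
      (by rw [le_div_iff₀ (by positivity)]; linarith) (by norm_num)
    rw [le_div_iff₀ (by positivity)] at hk1
    rw [div_lt_iff₀ (by positivity), pow_succ] at hk2
    exact mem_iUnion.2 ⟨k, hk1, by linarith⟩
  -- the contribution of a single annulus
  have hterm : ∀ k, ∫⁻ z in S k, ‖K y z‖ₑ * ‖f z‖ₑ ∂(volume.restrict Ω) ≤
      ENNReal.ofReal (C * 4 ^ n) * ω * (V ^ (-κ) * N) * ϑ ^ k := by
    intro k
    have h2k : (1 : ℝ) ≤ 2 ^ k := one_le_pow₀ (by norm_num)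
    have hrk : 0 < 2 ^ k * r := by positivity
    have hVk : volume (Metric.ball x (2 ^ k * (4 * r))) =
        ENNReal.ofReal ((2 ^ k * 4) ^ n) * V := by
      rw [← mul_assoc, volume_ball_mul x (by positivity) hr]
    have e1 : ∫⁻ z in S k, ‖K y z‖ₑ * ‖f z‖ₑ ∂(volume.restrict Ω) ≤
        ENNReal.ofReal (C / (2 ^ k * r) ^ n) *
          ∫⁻ z in Metric.ball x (2 ^ k * (4 * r)), ‖f z‖ₑ ∂(volume.restrict Ω) := by
      refine lintegral_mul_le_of_subset_ball hΩ.measurableSet (hSm k) (fun z hz => ?_)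
        ENNReal.ofReal_ne_top fun z hz hzS => h.enorm_le hy hz hrk ?_
      · rw [Metric.mem_ball, dist_comm, dist_eq_norm]
        exact hz.2
      · rw [Metric.mem_ball, dist_eq_norm] at hyx
        have := norm_sub_le_norm_sub_add_norm_sub x y z
        rw [norm_sub_rev x y] at this
        have := hzS.1
        nlinarith
    have e2 := lintegral_ball_enorm_le_morreyNorm hn hΩ hΩb hq.1 hμ.1 hf hx
      (r := 2 ^ k * (4 * r)) (by positivity)
    rw [← hκ] at e2
    have e3 : ENNReal.ofReal (C / (2 ^ k * r) ^ n) * volume (Metric.ball x (2 ^ k * (4 * r))) =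
        ENNReal.ofReal (C * 4 ^ n) * ω := by
      have hC := h.pos
      rw [Measure.addHaar_ball_of_pos volume x (by positivity), ← mul_assoc,
        ← ENNReal.ofReal_mul (by positivity), finrank_euclideanSpace_fin]
      congr 2
      rw [show (2 : ℝ) ^ k * (4 * r) = 4 * (2 ^ k * r) by ring, mul_pow 4]
      field_simp
    have e4 : volume (Metric.ball x (2 ^ k * (4 * r))) ^ (-κ) ≤ ϑ ^ k * V ^ (-κ) := by
      rw [hVk, ENNReal.mul_rpow_of_ne_top ENNReal.ofReal_ne_top hVt]
      refine mul_le_mul_left ?_ _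
      have hle : (2 : ℝ≥0∞) ^ (k : ℝ) ≤ ENNReal.ofReal ((2 ^ k * 4) ^ n) := by
        rw [ENNReal.rpow_natCast, show (2 : ℝ≥0∞) ^ k = ENNReal.ofReal (2 ^ k) by
          rw [ENNReal.ofReal_pow (by norm_num)]; simp]
        refine ENNReal.ofReal_le_ofReal ?_
        calc (2 : ℝ) ^ k ≤ 2 ^ k * 4 := by linarith
          _ ≤ (2 ^ k * 4) ^ n := le_self_pow₀ (by linarith) hn.ne'
      calc ENNReal.ofReal ((2 ^ k * 4) ^ n) ^ (-κ) ≤ ((2 : ℝ≥0∞) ^ (k : ℝ)) ^ (-κ) := by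
            rw [ENNReal.rpow_neg, ENNReal.rpow_neg, ENNReal.inv_le_inv]
            exact ENNReal.rpow_le_rpow hle hκpos
        _ = ((2 : ℝ≥0∞) ^ (-κ)) ^ (k : ℝ) := by
            rw [← ENNReal.rpow_mul, ← ENNReal.rpow_mul, mul_comm]
        _ ≤ ϑ ^ (k : ℝ) := by
            refine ENNReal.rpow_le_rpow ?_ (by positivity)
            exact ENNReal.rpow_le_rpow_of_exponent_le (by norm_num) (neg_le_neg hκ0)
        _ = ϑ ^ k := ENNReal.rpow_natCast _ _
    calc _ ≤ _ := e1
      _ ≤ _ := mul_le_mul_right e2 _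
      _ = ENNReal.ofReal (C / (2 ^ k * r) ^ n) * volume (Metric.ball x (2 ^ k * (4 * r))) *
          volume (Metric.ball x (2 ^ k * (4 * r))) ^ (-κ) * N := by ring
      _ ≤ ENNReal.ofReal (C * 4 ^ n) * ω * (ϑ ^ k * V ^ (-κ)) * N := by
          rw [e3]
          exact mul_le_mul_left (mul_le_mul_right e4 _) _
      _ = _ := by ring
  calc ‖∫ z in {z | z ∈ Ω ∧ 2 * r < ‖x - z‖}, K y z * f z‖ₑ
      ≤ ∫⁻ z in {z | 2 * r < ‖x - z‖}, ‖K y z‖ₑ * ‖f z‖ₑ ∂(volume.restrict Ω) := by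
        rw [setIntegral_lt_norm_sub_eq]
        refine (enorm_integral_le_lintegral_enorm _).trans_eq ?_
        simp only [enorm_indicator_eq_indicator_enorm, enorm_mul]
        exact lintegral_indicator (measurableSet_lt_norm_sub _ _) _
    _ ≤ ∫⁻ z in ⋃ k, S k, ‖K y z‖ₑ * ‖f z‖ₑ ∂(volume.restrict Ω) := lintegral_mono_set hcover
    _ ≤ ∑' k, ∫⁻ z in S k, ‖K y z‖ₑ * ‖f z‖ₑ ∂(volume.restrict Ω) := lintegral_iUnion_le _ _
    _ ≤ ∑' k, ENNReal.ofReal (C * 4 ^ n) * ω * (V ^ (-κ) * N) * ϑ ^ k := ENNReal.tsum_le_tsum hterm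
    _ = G * (V ^ (-κ) * N) := by
        rw [ENNReal.tsum_mul_left, ENNReal.tsum_geometric]
        ring

/-- Calderón–Zygmund operators are bounded on `L ^ (q, μ) (Ω)`, uniformly for `q` in a compact
subinterval of `(1, ∞)` and `μ` in a compact subinterval of `[0, 1)`. -/
theorem IsCalderonZygmundOperator.exists_morreyNorm_pvOperator_le
    (hK : IsCalderonZygmundOperator Ω K) (hn : 0 < n) (hΩ : IsOpen Ω)
    (hΩb : Bornology.IsBounded Ω) {q₀ q₁ μ₁ : ℝ} (hq₀ : 1 < q₀) (hq₁ : q₀ ≤ q₁) (hμ₁ : μ₁ < 1) :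
    ∃ A : ℝ≥0, ∀ q ∈ Icc q₀ q₁, ∀ μ ∈ Icc 0 μ₁, ∀ f : EuclideanSpace ℝ (Fin n) → ℝ,
      AEStronglyMeasurable f (volume.restrict Ω) → morreyNorm Ω q μ f < ∞ →
        morreyNorm Ω q μ (pvOperator Ω K f) ≤ A * morreyNorm Ω q μ f := by
  have hfin : IsFiniteMeasure (volume.restrict Ω) :=
    ⟨by rw [Measure.restrict_apply_univ]; exact hΩb.measure_lt_top⟩
  obtain ⟨C, w, h⟩ := hK.kernel.exists_kernelBounds
  obtain ⟨A, hA⟩ := hK.exists_lintegral_pvOperator_le hn hΩ hΩb hq₀ hq₁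
  obtain ⟨G, hG⟩ := h.exists_enorm_far_integral_le hn hΩ hΩb (q₁ := q₁) hμ₁
  refine ⟨2 * (A * 3 ^ n + 1 + G), fun q hq μ hμ f hf hN => ?_⟩
  have hq1 : 1 < q := hq₀.trans_le hq.1
  have hq0 : 0 < q := by linarith
  have hfL := memLp_of_morreyNorm_lt_top hn hΩ hΩb hq0 hμ.1 hf hN
  have hfi := integrable_of_memLp_ofReal hq1.le hfL
  have hpv := hK.ae_pvExistsAt hn hΩ hΩb hq1 hfL
  set N := morreyNorm Ω q μ f
  conv_lhs => unfold morreyNorm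
  refine iSup₂_le fun x hx => iSup₂_le fun r hr => ?_
  obtain ⟨hr, hrd⟩ := hr
  set V := volume (Metric.ball x r) with hV
  have hV0 : V ≠ 0 := volume_ball_ne_zero x hr
  have hVt : V ≠ ∞ := measure_ball_lt_top.ne
  set f₁ := (Metric.closedBall x (2 * r)).indicator f with hf₁
  have hcb : MeasurableSet (Metric.closedBall x (2 * r)) := Metric.isClosed_closedBall.measurableSet
  have hf₁L : MemLp f₁ (ENNReal.ofReal q) (volume.restrict Ω) := hfL.indicator hcb
  have hpv₁ := hK.ae_pvExistsAt hn hΩ hΩb hq1 hf₁L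
  set J : ℝ≥0∞ := G * (V ^ (-((1 - μ) / q)) * N) with hJ
  have hlocal : ∫⁻ y, ‖pvOperator Ω K f₁ y‖ₑ ^ q ∂(volume.restrict Ω) ≤
      A * 3 ^ n * (V ^ μ * N ^ q) := by
    have e1 : ∫⁻ y, ‖f₁ y‖ₑ ^ q ∂(volume.restrict Ω) ≤
        ∫⁻ y in Metric.ball x (3 * r), ‖f y‖ₑ ^ q ∂(volume.restrict Ω) := by
      rw [← lintegral_indicator measurableSet_ball]
      refine lintegral_mono fun y => ?_
      by_cases hy : y ∈ Metric.closedBall x (2 * r)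
      · have hy3 : y ∈ Metric.ball x (3 * r) :=
          Metric.closedBall_subset_ball (by linarith) hy
        rw [hf₁, indicator_of_mem hy, indicator_of_mem hy3]
      · rw [hf₁, indicator_of_notMem hy]
        simp [ENNReal.zero_rpow_of_pos hq0]
    have e2 : volume (Metric.ball x (3 * r)) ^ μ ≤ 3 ^ n * V ^ μ := by
      rw [volume_ball_mul x (by norm_num) hr, ENNReal.mul_rpow_of_nonneg _ _ hμ.1]
      refine mul_le_mul_left ?_ _
      rw [ENNReal.ofReal_pow (by norm_num), ENNReal.ofReal_ofNat]
      conv_rhs => rw [← ENNReal.rpow_one ((3 : ℝ≥0∞) ^ n)]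
      exact ENNReal.rpow_le_rpow_of_exponent_le (one_le_pow₀ (by norm_num)) (by linarith [hμ.2])
    calc _ ≤ A * ∫⁻ y, ‖f₁ y‖ₑ ^ q ∂(volume.restrict Ω) := hA q hq f₁ hf₁L
      _ ≤ A * (3 ^ n * V ^ μ * N ^ q) := by
          refine mul_le_mul_right (e1.trans ?_) _
          refine (lintegral_ball_le_morreyNorm hn hΩ hΩb hq0 hμ.1 hx (by positivity)).trans ?_
          exact mul_le_mul_left e2 _
      _ = _ := by ring
  have hfar : ∫⁻ _ in Metric.ball x r ∩ Ω, J ^ q ≤ G ^ q * (V ^ μ * N ^ q) := by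
    rw [setLIntegral_const]
    refine (mul_le_mul_right (measure_mono inter_subset_left) _).trans_eq ?_
    rw [hJ, ENNReal.mul_rpow_of_nonneg _ _ hq0.le, ENNReal.mul_rpow_of_nonneg _ _ hq0.le,
      ← ENNReal.rpow_mul]
    have : V ^ μ = V ^ (-((1 - μ) / q) * q) * V := by
      conv_rhs => enter [2]; rw [← ENNReal.rpow_one V]
      rw [← ENNReal.rpow_add _ _ hV0 hVt]
      congr 1
      field_simp
      ring
    rw [this]
    ring
  have hsplit : ∫⁻ y in Metric.ball x r ∩ Ω, ‖pvOperator Ω K f y‖ₑ ^ q ≤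
      2 ^ q * ((A * 3 ^ n + 1 + G) ^ q * (V ^ μ * N ^ q)) := by
    have hpt : ∀ᵐ y ∂(volume.restrict (Metric.ball x r ∩ Ω)), ‖pvOperator Ω K f y‖ₑ ^ q ≤
        2 ^ q * (‖pvOperator Ω K f₁ y‖ₑ ^ q + J ^ q) := by
      rw [← Measure.restrict_restrict measurableSet_ball]
      filter_upwards [ae_restrict_of_ae hpv, ae_restrict_of_ae hpv₁,
        ae_restrict_of_ae (ae_restrict_mem hΩ.measurableSet),
        ae_restrict_mem measurableSet_ball] with y h1 h2 hy hyx
      rw [h.pvOperator_eq_add hΩ hfi hy hyx h1 h2]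
      refine (ENNReal.rpow_le_rpow ((enorm_add_le _ _).trans (add_le_add_right
        (hG q ⟨hq1.le, hq.2⟩ μ hμ f hf x hx r hr y hy hyx) _)) hq0.le).trans ?_
      refine (ENNReal.rpow_add_le_mul_rpow_add_rpow _ _ hq1.le).trans (mul_le_mul_left ?_ _)
      exact ENNReal.rpow_le_rpow_of_exponent_le (by norm_num) (by linarith)
    have hfin2 : (2 : ℝ≥0∞) ^ q ≠ ∞ := by finiteness
    calc _ ≤ ∫⁻ y in Metric.ball x r ∩ Ω, 2 ^ q * (‖pvOperator Ω K f₁ y‖ₑ ^ q + J ^ q) :=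
          lintegral_mono_ae hpt
      _ = 2 ^ q * ((∫⁻ y in Metric.ball x r ∩ Ω, ‖pvOperator Ω K f₁ y‖ₑ ^ q) +
            ∫⁻ _ in Metric.ball x r ∩ Ω, J ^ q) := by
          rw [lintegral_const_mul' _ _ hfin2, lintegral_add_right _ measurable_const]
      _ ≤ 2 ^ q * (A * 3 ^ n * (V ^ μ * N ^ q) + G ^ q * (V ^ μ * N ^ q)) := by
          refine mul_le_mul_right (add_le_add ((lintegral_mono_set inter_subset_right).trans hlocal)
            hfar) _
      _ ≤ _ := by
          rw [← add_mul]
          refine mul_le_mul_right (mul_le_mul_left ?_ _) _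
          refine le_trans ?_ (ENNReal.add_rpow_le_rpow_add _ _ hq1.le)
          refine add_le_add_left ?_ _
          calc (A * 3 ^ n : ℝ≥0∞) ≤ A * 3 ^ n + 1 := le_self_add
            _ = (A * 3 ^ n + 1) ^ (1 : ℝ) := (ENNReal.rpow_one _).symm
            _ ≤ _ := ENNReal.rpow_le_rpow_of_exponent_le le_add_self hq1.le
  refine (ENNReal.rpow_le_rpow (ENNReal.div_le_div_right hsplit _) (by positivity)).trans_eq ?_
  have e : 2 ^ q * ((A * 3 ^ n + 1 + G) ^ q * (V ^ μ * N ^ q)) / V ^ μ =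
      (2 * (A * 3 ^ n + 1 + G) * N) ^ q := by
    rw [ENNReal.mul_rpow_of_nonneg _ _ hq0.le, ENNReal.mul_rpow_of_nonneg _ _ hq0.le,
      show (2 : ℝ≥0∞) ^ q * ((A * 3 ^ n + 1 + G) ^ q * (V ^ μ * N ^ q)) =
        2 ^ q * (A * 3 ^ n + 1 + G) ^ q * N ^ q * V ^ μ by ring]
    refine ENNReal.mul_div_cancel_right ?_ (ENNReal.rpow_ne_top_of_ne_zero hV0 hVt)
    simp [ENNReal.rpow_eq_zero_iff, hV0, hVt]
  rw [e, ← ENNReal.rpow_mul, mul_one_div_cancel hq0.ne', ENNReal.rpow_one]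
  push_cast
  rfl

end

/-! ### Grand grand Morrey spaces -/

section

variable {n : ℕ} {Ω : Set (EuclideanSpace ℝ (Fin n))}
  {K : EuclideanSpace ℝ (Fin n) → EuclideanSpace ℝ (Fin n) → ℝ} {p lam θ α : ℝ}

theorem grandEndpoint_pos (hp : 1 < p) (hlam : 0 < lam) (hα : 0 ≤ α) :
    0 < grandEndpoint p lam α := by
  unfold grandEndpoint
  split_ifs with h
  · linarith
  · exact lt_min (by linarith) (div_pos hlam (lt_of_le_of_ne hα (Ne.symm h)))

theorem grandEndpoint_le_sub_one : grandEndpoint p lam α ≤ p - 1 := by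
  unfold grandEndpoint
  split_ifs
  · exact le_rfl
  · exact min_le_left _ _

theorem mul_lt_of_lt_grandEndpoint (hlam : 0 < lam) (hα : 0 ≤ α) {ε : ℝ}
    (hε : ε < grandEndpoint p lam α) : α * ε < lam := by
  unfold grandEndpoint at hε
  split_ifs at hε with h
  · simpa [h] using hlam
  · have h1 := hε.trans_le (min_le_right _ _)
    rwa [lt_div_iff₀ (lt_of_le_of_ne hα (Ne.symm h)), mul_comm] at h1

theorem ofReal_mul_morreyNorm_le_grandGrandMorreyNorm (f : EuclideanSpace ℝ (Fin n) → ℝ) {ε : ℝ}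
    (hε : ε ∈ Ioo 0 (grandEndpoint p lam α)) :
    ENNReal.ofReal (ε ^ (θ / (p - ε))) * morreyNorm Ω (p - ε) (lam - α * ε) f ≤
      grandGrandMorreyNorm Ω p lam θ α f := by
  unfold grandGrandMorreyNorm
  exact le_iSup₂_of_le ε hε le_rfl

theorem morreyNorm_lt_top_of_grandGrandMorreyNorm_lt_top {f : EuclideanSpace ℝ (Fin n) → ℝ}
    (hf : grandGrandMorreyNorm Ω p lam θ α f < ∞) {ε : ℝ}
    (hε : ε ∈ Ioo 0 (grandEndpoint p lam α)) : morreyNorm Ω (p - ε) (lam - α * ε) f < ∞ := by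
  have h := (ofReal_mul_morreyNorm_le_grandGrandMorreyNorm f hε).trans_lt hf
  refine ENNReal.lt_top_of_mul_ne_top_right h.ne ?_
  exact (ENNReal.ofReal_pos.2 (Real.rpow_pos_of_pos hε.1 _)).ne'

/-- Up to a constant, only the parameters `ε ≤ σ` matter in the grand grand Morrey norm: for
`ε ≥ σ` the weights are bounded, and the norm of `L ^ (p - ε, lam - α * ε)` is controlled by the one
for `ε = σ`, since `(1 - lam + α * ε) / (p - ε)` increases with `ε`. -/
theorem exists_grandGrandMorreyNorm_le_mul_iSup (hθ : 0 < θ) (hlam0 : 0 < lam)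
    (hlam1 : lam < 1) (hα : 0 ≤ α) {σ : ℝ} (hσ : σ ∈ Ioo 0 (grandEndpoint p lam α)) :
    ∃ A : ℝ≥0, ∀ f : EuclideanSpace ℝ (Fin n) → ℝ, AEStronglyMeasurable f (volume.restrict Ω) →
      grandGrandMorreyNorm Ω p lam θ α f ≤
        A * ⨆ ε ∈ Ioc 0 σ, ENNReal.ofReal (ε ^ (θ / (p - ε))) *
          morreyNorm Ω (p - ε) (lam - α * ε) f := by
  set W : ℝ≥0∞ := max 1 (volume (Metric.ball (0 : EuclideanSpace ℝ (Fin n)) (Metric.diam Ω)))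
  have hW : W ≠ ∞ := max_ne_top ENNReal.one_ne_top measure_ball_lt_top.ne
  set a : ℝ≥0∞ := ENNReal.ofReal (σ ^ (θ / (p - σ))) with ha
  have ha0 : a ≠ 0 := (ENNReal.ofReal_pos.2 (Real.rpow_pos_of_pos hσ.1 _)).ne'
  set b : ℝ≥0∞ := ENNReal.ofReal (max 1 (p - 1) ^ θ) with hb
  set A : ℝ≥0∞ := 1 + b * W * a⁻¹ with hA
  have hAt : A ≠ ∞ := by
    have := ENNReal.inv_ne_top.2 ha0
    finiteness
  refine ⟨A.toNNReal, fun f hf => ?_⟩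
  rw [ENNReal.coe_toNNReal hAt]
  set M : ℝ≥0∞ := ⨆ ε ∈ Ioc 0 σ, ENNReal.ofReal (ε ^ (θ / (p - ε))) *
    morreyNorm Ω (p - ε) (lam - α * ε) f
  have hσM : a * morreyNorm Ω (p - σ) (lam - α * σ) f ≤ M :=
    le_iSup₂_of_le σ ⟨hσ.1, le_rfl⟩ le_rfl
  unfold grandGrandMorreyNorm
  refine iSup₂_le fun ε hε => ?_
  rcases le_or_gt ε σ with h | h
  · calc _ ≤ M := le_iSup₂_of_le ε ⟨hε.1, h⟩ le_rfl
      _ = 1 * M := (one_mul _).symm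
      _ ≤ A * M := mul_le_mul_left le_self_add _
  · have hpε : 1 < p - ε := by linarith [hε.2.trans_le (grandEndpoint_le_sub_one (lam := lam))]
    have hε2 := mul_lt_of_lt_grandEndpoint hlam0 hα hε.2
    have hασ : α * σ ≤ α * ε := mul_le_mul_of_nonneg_left h.le hα
    have hασ0 : 0 ≤ α * σ := mul_nonneg hα hσ.1.le
    have e1 : morreyNorm Ω (p - ε) (lam - α * ε) f ≤
        W * morreyNorm Ω (p - σ) (lam - α * σ) f := by
      refine morreyNorm_le_mul_morreyNorm hpε.le (by linarith) (by linarith) (by linarith) ?_ hf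
      exact div_le_div₀ (by linarith) (by linarith) (by linarith) (by linarith)
    have e2 : ENNReal.ofReal (ε ^ (θ / (p - ε))) ≤ b := by
      refine ENNReal.ofReal_le_ofReal ?_
      calc ε ^ (θ / (p - ε)) ≤ max 1 (p - 1) ^ (θ / (p - ε)) :=
            Real.rpow_le_rpow hε.1.le (le_max_of_le_right (by linarith)) (by positivity)
        _ ≤ max 1 (p - 1) ^ θ :=
            Real.rpow_le_rpow_of_exponent_le (le_max_left _ _) (div_le_self hθ.le hpε.le)
    have e3 : morreyNorm Ω (p - σ) (lam - α * σ) f ≤ a⁻¹ * M :=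
      (ENNReal.mul_le_iff_le_inv ha0 ENNReal.ofReal_ne_top).1 hσM
    calc _ ≤ b * (W * (a⁻¹ * M)) := mul_le_mul' e2 (e1.trans (mul_le_mul_right e3 _))
      _ = b * W * a⁻¹ * M := by ring
      _ ≤ A * M := mul_le_mul_left le_add_self _

/-- In dimension zero all truncation sets are empty. -/
theorem pvExistsAt_of_dimension_zero (hn : n = 0) (f : EuclideanSpace ℝ (Fin n) → ℝ)
    (x : EuclideanSpace ℝ (Fin n)) : PVExistsAt Ω K f x := by
  subst hn
  refine ⟨0, tendsto_const_nhds.congr' ?_⟩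
  filter_upwards [self_mem_nhdsWithin] with δ hδ
  have : {y | y ∈ Ω ∧ δ < ‖x - y‖} = ∅ := by
    ext y
    simp [Subsingleton.elim x y, (mem_Ioi.1 hδ).le]
  simp [truncatedIntegral, this]

/-- In dimension zero `diam Ω = 0`, and the supremum in the Morrey norm is empty. -/
theorem grandGrandMorreyNorm_of_dimension_zero (hn : n = 0)
    (f : EuclideanSpace ℝ (Fin n) → ℝ) : grandGrandMorreyNorm Ω p lam θ α f = 0 := by
  subst hn
  have hd : Metric.diam Ω = 0 := Metric.diam_subsingleton Set.subsingleton_of_subsingleton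
  have hM : ∀ q μ, morreyNorm Ω q μ f = 0 := fun q μ => by
    simp only [morreyNorm, hd, Ioc_self, mem_empty_iff_false, iSup_false, iSup_bot]
    rfl
  refine le_antisymm (iSup₂_le fun ε _ => ?_) zero_le
  rw [hM, mul_zero]

end

theorem theorem2 {n : ℕ} (Ω : Set (EuclideanSpace ℝ (Fin n)))
    (hΩ : IsOpen Ω) (hΩb : Bornology.IsBounded Ω)
    (K : EuclideanSpace ℝ (Fin n) → EuclideanSpace ℝ (Fin n) → ℝ)
    (hK : IsCalderonZygmundOperator Ω K)
    (p θ lam α : ℝ) (hp : 1 < p) (hθ : 0 < θ) (hlam0 : 0 < lam) (hlam1 : lam < 1) (hα : 0 ≤ α) :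
    ∃ C : ℝ≥0, ∀ f : EuclideanSpace ℝ (Fin n) → ℝ, MemGrandGrandMorrey Ω p lam θ α f →
      (∀ᵐ x ∂(volume.restrict Ω), PVExistsAt Ω K f x) ∧
      MemGrandGrandMorrey Ω p lam θ α (pvOperator Ω K f) ∧
      grandGrandMorreyNorm Ω p lam θ α (pvOperator Ω K f) ≤
        C * grandGrandMorreyNorm Ω p lam θ α f := by
  rcases Nat.eq_zero_or_pos n with hn | hn
  · refine ⟨0, fun f _ => ⟨Eventually.of_forall (pvExistsAt_of_dimension_zero hn f), ⟨?_, ?_⟩, ?_⟩⟩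
    · subst hn
      exact (continuous_of_const fun x y => by rw [Subsingleton.elim x y]).aestronglyMeasurable
    · simp [grandGrandMorreyNorm_of_dimension_zero hn]
    · simp [grandGrandMorreyNorm_of_dimension_zero hn]
  have hfin : IsFiniteMeasure (volume.restrict Ω) :=
    ⟨by rw [Measure.restrict_apply_univ]; exact hΩb.measure_lt_top⟩
  have hend := grandEndpoint_pos hp hlam0 hα
  -- for `ε ≤ σ` the exponents `p - ε` stay away from `1`, so that one constant serves them all
  set σ := grandEndpoint p lam α / 2 with hσdef
  have hσ : σ ∈ Ioo 0 (grandEndpoint p lam α) := ⟨half_pos hend, half_lt_self hend⟩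
  have hpσ : 1 < p - σ := by linarith [hσ.2.trans_le (grandEndpoint_le_sub_one (lam := lam))]
  have hmσ := mul_lt_of_lt_grandEndpoint hlam0 hα hσ.2
  obtain ⟨A, hA⟩ := hK.exists_morreyNorm_pvOperator_le hn hΩ hΩb hpσ
    (sub_le_self p hσ.1.le) hlam1
  obtain ⟨B, hB⟩ := exists_grandGrandMorreyNorm_le_mul_iSup (Ω := Ω) hθ hlam0 hlam1 hα hσ
  refine ⟨B * A, fun f hf => ?_⟩
  obtain ⟨hfm, hfN⟩ := hf
  have hfL := memLp_of_morreyNorm_lt_top hn hΩ hΩb (by linarith) (by linarith) hfm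
    (morreyNorm_lt_top_of_grandGrandMorreyNorm_lt_top hfN hσ)
  have hpv := hK.ae_pvExistsAt hn hΩ hΩb hpσ hfL
  obtain ⟨C, w, h⟩ := hK.kernel.exists_kernelBounds
  have hTm := h.aestronglyMeasurable_pvOperator hn hΩ (integrable_of_memLp_ofReal hpσ.le hfL) hpv
  have hle : grandGrandMorreyNorm Ω p lam θ α (pvOperator Ω K f) ≤
      (B * A : ℝ≥0) * grandGrandMorreyNorm Ω p lam θ α f := by
    refine (hB _ hTm).trans ?_
    rw [ENNReal.coe_mul, mul_assoc]
    refine mul_le_mul_right (iSup₂_le fun ε hε => ?_) _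
    have hε' : ε ∈ Ioo 0 (grandEndpoint p lam α) := ⟨hε.1, hε.2.trans_lt hσ.2⟩
    have hmε := mul_lt_of_lt_grandEndpoint hlam0 hα hε'.2
    have hαε := mul_nonneg hα hε.1.le
    calc _ ≤ ENNReal.ofReal (ε ^ (θ / (p - ε))) *
          (A * morreyNorm Ω (p - ε) (lam - α * ε) f) :=
          mul_le_mul_right (hA (p - ε) ⟨by linarith [hε.2], by linarith [hε.1]⟩ (lam - α * ε)
            ⟨by linarith, by linarith⟩ f hfm
            (morreyNorm_lt_top_of_grandGrandMorreyNorm_lt_top hfN hε')) _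
      _ = A * (ENNReal.ofReal (ε ^ (θ / (p - ε))) *
          morreyNorm Ω (p - ε) (lam - α * ε) f) := by ring
      _ ≤ _ := mul_le_mul_right (ofReal_mul_morreyNorm_le_grandGrandMorreyNorm f hε') _
  exact ⟨hpv, ⟨hTm, hle.trans_lt (ENNReal.mul_lt_top ENNReal.coe_lt_top hfN)⟩, hle⟩
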